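/- \textbf{Setting.} Let $X_1,X_2,\dots$ be i.i.d. real random variables with distribution function $F$, put $F^{\leftarrow}(u)=\inf\{x: F(x)\ge u\}$ and $V(t)=F^{\leftarrow}(e^{-1/t})$ for $t>0$. Fix $\gamma>0$ and $\rho\le 0$; the expression $(x^{\rho}-1)/\rho$ is read as $\log x$ when $\rho=0$. "Ultimately of constant sign" means that the function is eventually strictly positive or eventually strictly negative. For a block length $m\ge 1$ let $M_i^{(m)}=\max_{(i-1)m<j\le im}X_j$, $i=1,\dots,k$, with order statistics $M^{(m)}_{1:k}\le\dots\le M^{(m)}_{k:k}$, and let the hybrid-Hill estimator be $$\hat\gamma^{H2}=\hat\gamma^{H2}(k_0,k)=\frac1{k_0}\sum_{i=0}^{k_0-1}\log M^{(m)}_{k-i:k}-\log M^{(m)}_{k-k_0:k}.$$ \textbf{Assumptions.} (Condition B) First, $V$ satisfies Condition A1: $\lim_{t\to\infty}\{\log V(tx)-\log V(t)\}=\gamma\log x$ for all $x>0$, and for all $\varepsilon,\delta>0$ there is $t_0$ such that $|V(tx)/V(t)-x^\gamma|\le\varepsilon x^{\gamma+\delta}$ for all $t\ge t_0$, $x\ge1$.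 Second, for every $m\ge1$ and $x>0$, $$\lim_{t\to\infty}\frac{1-F^m\bigl(xV(m(t-1/2))\bigr)}{1-F^m\bigl(V(m(t-1/2))\bigr)}=x^{-1/\gamma}.$$ (Condition A2, $V\in 2RV(\gamma,\rho)$) There is a function $A$, ultimately of constant sign, with $A(t)\to0$, such that for all $x>0$ $$\lim_{t\to\infty}\frac{V(tx)/V(t)-x^\gamma}{A(t)}=x^\gamma\,\frac{x^\rho-1}{\rho}.$$ \textbf{Theorem.} Put $\tilde\rho=\max(\rho,-1)$ and let $m\ge1$. (1) If $\rho=-1$, suppose in addition that $\liminf_{t\to\infty}|tA(t)+m\gamma/2|>0$. Then there exists a function $\tilde A$, ultimately of constant sign and with $\tilde A(t)\to0$ as $t\to\infty$, such that $$\lim_{t\to\infty}\frac{\log V(m(tx-\tfrac12))-\log V(m(t-\tfrac12))-\gamma\log x}{\tilde A(mt)}=\frac{x^{\tilde\rho}-1}{\tilde\rho}\qquad(\ast)$$ locally uniformly for $x>0$; moreover $|\tilde A|$ is regularly varying at infinity with index $\tilde\rho$. (2) Let $\tilde A$ be any function, ultimately of constant sign and tending to $0$, for which $(\ast)$ holds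 locally uniformly for $x>0$. Let $k_0=k_0(k)$ be positive integers with $k_0\to\infty$ and $k_0/k\to0$ as $k\to\infty$, and suppose that, with $n=mk$, $\sqrt{k_0}\,\tilde A(n/k_0)\to\lambda\in\mathbb R$. Then, as $k\to\infty$, $$\sqrt{k_0}\,\bigl(\hat\gamma^{H2}-\gamma\bigr)\xrightarrow{d}N\Bigl(\frac{\lambda}{1-\tilde\rho},\gamma^2\Bigr).$$ -/

import Mathlib

open MeasureTheory ProbabilityTheory Filter Topology

noncomputable section

/-- Left-continuous generalised inverse `F^←(u) = inf {x : F x ≥ u}`. -/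
def genInv (F : ℝ → ℝ) (u : ℝ) : ℝ := sInf {x : ℝ | u ≤ F x}

/-- The quantile-type function `V(t) = (1 / (-log F))^←(t) = F^←(exp (-1/t))`, for `t > 0`. -/
def quantileV (F : ℝ → ℝ) (t : ℝ) : ℝ := genInv F (Real.exp (-1 / t))

/-- `f` is regularly varying at infinity with index `α`. -/
def RegVar (f : ℝ → ℝ) (α : ℝ) : Prop :=
  ∀ x : ℝ, 0 < x → Tendsto (fun t => f (t * x) / f t) atTop (𝓝 (x ^ α))

/-- `(x^ρ - 1) / ρ`, read as its limit `log x` when `ρ = 0`. -/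
def boxCox (ρ x : ℝ) : ℝ := if ρ = 0 then Real.log x else (x ^ ρ - 1) / ρ

/-- Ultimately of constant sign (and, being a divisor, ultimately nonzero). -/
def UltimatelyConstantSign (A : ℝ → ℝ) : Prop :=
  (∀ᶠ t in atTop, 0 < A t) ∨ (∀ᶠ t in atTop, A t < 0)

/-- The first order condition A1 on `V`. -/
structure ConditionA1 (V : ℝ → ℝ) (γ : ℝ) : Prop where
  log_tendsto : ∀ x : ℝ, 0 < x →
    Tendsto (fun t => Real.log (V (t * x)) - Real.log (V t)) atTop (𝓝 (γ * Real.log x))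
  uniform_bound : ∀ ε δ : ℝ, 0 < ε → 0 < δ → ∃ t₀ : ℝ, ∀ t x : ℝ, t₀ ≤ t → 1 ≤ x →
    |V (t * x) / V t - x ^ γ| ≤ ε * x ^ (γ + δ)

/-- The shift `g(t) = t - 1/2`. -/
def shiftHalf (t : ℝ) : ℝ := t - 1 / 2

/-- Condition B on the distribution function `F`: the function `V` of `F` satisfies A1 and, for
every block length `m ≥ 1`, the tail `1 - F^m`, normalised at `V(m(t - 1/2))`, has a Pareto
limit. -/
structure ConditionB (F : ℝ → ℝ) (γ : ℝ) : Prop where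
  conditionA1 : ConditionA1 (quantileV F) γ
  tail_tendsto : ∀ m : ℕ, 1 ≤ m → ∀ x : ℝ, 0 < x →
    Tendsto (fun t =>
        (1 - F (x * quantileV F (m * shiftHalf t)) ^ m) /
          (1 - F (quantileV F (m * shiftHalf t)) ^ m))
      atTop (𝓝 (x ^ (-1 / γ)))

/-- Condition A2, `V ∈ 2RV(γ, ρ)` with auxiliary function `A`. -/
structure ConditionA2 (V : ℝ → ℝ) (γ ρ : ℝ) (A : ℝ → ℝ) : Prop where
  const_sign : UltimatelyConstantSign A
  tendsto_zero : Tendsto A atTop (𝓝 0)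
  second_order : ∀ x : ℝ, 0 < x →
    Tendsto (fun t => (V (t * x) / V t - x ^ γ) / A t) atTop (𝓝 (x ^ γ * boxCox ρ x))

/-- The second order relation for `t ↦ log V(m(t - 1/2))`, with second order parameter `ρ'` and
auxiliary function `A'` evaluated at `m t`, locally uniformly in `x > 0`. -/
structure ShiftedSecondOrder (V : ℝ → ℝ) (γ ρ' : ℝ) (m : ℕ) (A' : ℝ → ℝ) : Prop where
  const_sign : UltimatelyConstantSign A'
  tendsto_zero : Tendsto A' atTop (𝓝 0)
  second_order : TendstoLocallyUniformlyOn
    (fun t x => (Real.log (V (m * shiftHalf (t * x))) - Real.log (V (m * shiftHalf t))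
        - γ * Real.log x) / A' (m * t))
    (fun x => boxCox ρ' x) atTop (Set.Ioi 0)

/-- The maximum of the `i`-th block of length `m ≥ 1` (blocks and observations are counted
from `0`): `max {X_j : i m ≤ j < (i + 1) m}`. -/
def blockMax {Ω : Type*} (X : ℕ → Ω → ℝ) (m i : ℕ) (ω : Ω) : ℝ :=
  ⨆ j : Fin m, X (i * m + j) ω

/-- The `j`-th ascending order statistic `v_{j:k}` of `v`, for `1 ≤ j ≤ k`
(with value `0` for other `j`). -/
def orderStat {k : ℕ} (v : Fin k → ℝ) (j : ℕ) : ℝ :=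
  if h : 1 ≤ j ∧ j ≤ k then v (Tuple.sort v ⟨j - 1, by omega⟩) else 0

/-- The hybrid-Hill estimator
`(1/k₀) ∑_{i=0}^{k₀-1} log M_{k-i:k} - log M_{k-k₀:k}` based on `k` block maxima `M`. -/
def hybridHill {Ω : Type*} (X : ℕ → Ω → ℝ) (m k k₀ : ℕ) (ω : Ω) : ℝ :=
  (1 / (k₀ : ℝ)) * ∑ i ∈ Finset.range k₀,
      Real.log (orderStat (fun l : Fin k => blockMax X m l ω) (k - i))
    - Real.log (orderStat (fun l : Fin k => blockMax X m l ω) (k - k₀))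

end

open scoped ENNReal

noncomputable section

/-! A block maximum has distribution function `F ^ m`, so it is distributed as `V(m τ(1/U))` with
`U` uniform on (0,1) and `τ(p) = -1 / log (1 - 1/p)` (`paretoToFrechet`). Since `τ(p) = p - 1/2 +
O(1/p)`, the logarithm of a block maximum is `W(P + O(1/P))` with `P = 1/U` standard Pareto and
`W(t) = log V(m(t - 1/2))`. The relation (∗) is thus the second order condition natural for a Hill
estimator built from block maxima.

Part (1). Condition A2 passes to `log V`, and monotonicity of `V` makes `log V` measurable, which
upgrades pointwise to locally uniform convergence (`tendsto_increment_of_seq`). The shift replaces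
the ratio `x` by `x (1 + z)` with `z ≈ (1 - 1/x) / (2 t)`. This adds a term of auxiliary size `mγ/2`
divided by `m t`, with second order parameter -1 (`LocUnif.shift`). Comparing `A(t)` with `(mγ/2)/t`
gives three cases: `A` wins if `ρ > -1`, the new term wins if `ρ < -1`, and for `ρ = -1` their sum
is the auxiliary function, the lower bound on `|t A(t) + mγ/2|` excluding cancellation.

Part (2). Let `T` be the `(k₀ + 1)`-th smallest of `k` uniform variables. It is beta distributed,
and given `T` the smaller ones behave as `T U_i` with `U_i` independent and uniform
(`lintegral_unifPi_symm_eq`). Hence the estimator has the law of an average of `L((1/T)(1/U_i)) -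
L(1/T)` over `k₀` terms, where `L(p) = W(τ(p) + 1/2)` (`map_hybridHill_eq`). A Potter bound,
transported from `W` to `L` (`LocUnif.potter_bound_pareto`), replaces each term by `-γ log U_i +
Ã(m/T) boxCox ρ̃ (1/U_i)` plus an integrable error of smaller order. The error in `τ` is harmless
because `t² |Ã(t)| → ∞` when `ρ̃ ≥ -1`. The central limit theorem for `-log U_i` gives the variance
`γ²`. The law of large numbers, with `E boxCox ρ̃ (1/U) = 1/(1 - ρ̃)`, gives the bias, once `T k /
k₀ → 1` in probability lets `Ã(m/T)` be replaced by `Ã(n/k₀)`. -/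

/-! ### The limit function of second order relations -/

lemma boxCox_one (ρ : ℝ) : boxCox ρ 1 = 0 := by simp [boxCox]

/-- The cocycle identity used in every chaining argument: an increment from `t` to `txy` is one from
`t` to `tx` followed by one from `tx`, whose auxiliary size has changed by `x ^ ρ`. -/
lemma boxCox_mul (ρ : ℝ) {x y : ℝ} (hx : 0 < x) (hy : 0 < y) :
    boxCox ρ (x * y) = boxCox ρ x + x ^ ρ * boxCox ρ y := by
  unfold boxCox
  split_ifs with h
  · subst h; simp [Real.log_mul hx.ne' hy.ne']
  · rw [Real.mul_rpow hx.le hy.le]; field_simp; ring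

lemma continuousAt_boxCox (ρ : ℝ) {x : ℝ} (hx : 0 < x) : ContinuousAt (boxCox ρ) x := by
  unfold boxCox
  split_ifs with h
  · exact Real.continuousAt_log hx.ne'
  · exact ((Real.continuousAt_rpow_const x ρ (Or.inl hx.ne')).sub_const 1).div_const ρ

lemma boxCox_le_log {ρ x : ℝ} (hρ : ρ ≤ 0) (hx : 1 ≤ x) : boxCox ρ x ≤ Real.log x := by
  unfold boxCox
  split_ifs with h
  · exact le_rfl
  · have hρ' : ρ < 0 := lt_of_le_of_ne hρ h
    rw [div_le_iff_of_neg hρ', Real.rpow_def_of_pos (by linarith)]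
    linarith [Real.add_one_le_exp (Real.log x * ρ)]

lemma boxCox_pos {ρ x : ℝ} (hρ : ρ ≤ 0) (hx : 1 < x) : 0 < boxCox ρ x := by
  unfold boxCox
  split_ifs with h
  · exact Real.log_pos hx
  · have hρ' : ρ < 0 := lt_of_le_of_ne hρ h
    exact div_pos_of_neg_of_neg (by linarith [Real.rpow_lt_one_of_one_lt_of_neg hx hρ']) hρ'

lemma boxCox_nonneg {ρ x : ℝ} (hρ : ρ ≤ 0) (hx : 1 ≤ x) : 0 ≤ boxCox ρ x := by
  rcases hx.eq_or_lt with rfl | h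
  · rw [boxCox_one]
  · exact (boxCox_pos hρ h).le

lemma measurable_boxCox (ρ : ℝ) : Measurable (boxCox ρ) := by
  unfold boxCox
  split_ifs with h
  · exact Real.measurable_log
  · fun_prop

/-! ### Locally uniform convergence -/

/-- Convergence as `t → ∞`, locally uniformly in `x > 0`, to a continuous limit, expressed as
joint convergence along `atTop ×ˢ 𝓝 x`. -/
def LocUnif (f : ℝ → ℝ → ℝ) (φ : ℝ → ℝ) : Prop :=
  ∀ x, 0 < x → Tendsto (fun p : ℝ × ℝ => f p.1 p.2) (atTop ×ˢ 𝓝 x) (𝓝 (φ x))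

/-- Uniform closeness near `x` compares `f t y` with `φ y`; continuity of the limit allows `φ y` to
be exchanged for the fixed value `φ x`. -/
lemma locUnif_iff {f : ℝ → ℝ → ℝ} {φ : ℝ → ℝ} (hφ : ∀ x, 0 < x → ContinuousAt φ x) :
    TendstoLocallyUniformlyOn f φ atTop (Set.Ioi 0) ↔ LocUnif f φ := by
  rw [tendstoLocallyUniformlyOn_iff_filter]
  refine forall₂_congr fun x hx => ?_
  rw [isOpen_Ioi.nhdsWithin_eq hx, Metric.tendstoUniformlyOnFilter_iff]
  have hc : Tendsto (fun p : ℝ × ℝ => φ p.2) (atTop ×ˢ 𝓝 x) (𝓝 (φ x)) :=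
    (hφ x hx).tendsto.comp tendsto_snd
  have key : (∀ ε > 0, ∀ᶠ p : ℝ × ℝ in atTop ×ˢ 𝓝 x, dist (φ p.2) (f p.1 p.2) < ε) ↔
      Tendsto (fun p : ℝ × ℝ => φ p.2 - f p.1 p.2) (atTop ×ˢ 𝓝 x) (𝓝 0) := by
    rw [Metric.tendsto_nhds]
    simp [Real.dist_eq]
  rw [key]
  constructor
  · intro h
    simpa using hc.sub h
  · intro h
    simpa using hc.sub h

lemma LocUnif.tendsto_at {f : ℝ → ℝ → ℝ} {φ : ℝ → ℝ} (h : LocUnif f φ) {x : ℝ} (hx : 0 < x) :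
    Tendsto (fun t => f t x) atTop (𝓝 (φ x)) :=
  (h x hx).comp (tendsto_id.prodMk tendsto_const_nhds)

/-- Uniformity over a compact interval. -/
lemma LocUnif.eventually_Icc {f : ℝ → ℝ → ℝ} {φ : ℝ → ℝ} (h : LocUnif f φ)
    (hφ : ∀ x, 0 < x → ContinuousAt φ x) {b c ε : ℝ} (hb : 0 < b) (hε : 0 < ε) :
    ∀ᶠ t in atTop, ∀ x ∈ Set.Icc b c, |f t x - φ x| < ε := by
  have h1 := (tendstoLocallyUniformlyOn_iff_tendstoUniformlyOn_of_compact
    (isCompact_Icc (a := b) (b := c))).1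
    (((locUnif_iff hφ).2 h).mono fun x hx => lt_of_lt_of_le hb hx.1)
  filter_upwards [Metric.tendstoUniformlyOn_iff.1 h1 ε hε] with t ht x hx
  have := ht x hx
  rwa [dist_comm, Real.dist_eq] at this

lemma tendsto_fst_mul_snd_atTop {x : ℝ} (hx : 0 < x) :
    Tendsto (fun p : ℝ × ℝ => p.1 * p.2) (atTop ×ˢ 𝓝 x) atTop :=
  tendsto_fst.atTop_mul_pos hx tendsto_snd

lemma eventually_snd_pos {x : ℝ} (hx : 0 < x) : ∀ᶠ p : ℝ × ℝ in atTop ×ˢ 𝓝 x, 0 < p.2 :=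
  tendsto_snd.eventually (lt_mem_nhds hx)

/-! ### Regular variation and Potter bounds -/

/-- The auxiliary function of a locally uniform second order relation is regularly varying,
locally uniformly. -/
lemma LocUnif.auxiliary_ratio {W a : ℝ → ℝ} {γ ρ : ℝ} (hρ : ρ ≤ 0) (ha : ∀ᶠ t in atTop, a t ≠ 0)
    (h : LocUnif (fun t x => (W (t * x) - W t - γ * Real.log x) / a t) (boxCox ρ)) :
    LocUnif (fun t x => a (t * x) / a t) (fun x => x ^ ρ) := by
  intro x hx
  have hm := tendsto_fst_mul_snd_atTop hx
  -- The increment of `W` from `tx` to `2tx` is measured twice: directly, in units of `a (t x)`, and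
  -- as a difference of increments from `t`, in units of `a t`. The quotient of the two limits is `x
  -- ^ ρ`.
  have hb2 : boxCox ρ 2 ≠ 0 := (boxCox_pos hρ one_lt_two).ne'
  have h2 : Tendsto (fun p : ℝ × ℝ =>
      (W (p.1 * p.2 * 2) - W (p.1 * p.2) - γ * Real.log 2) / a (p.1 * p.2)) (atTop ×ˢ 𝓝 x)
      (𝓝 (boxCox ρ 2)) := (h.tendsto_at two_pos).comp hm
  have h1 : Tendsto (fun p : ℝ × ℝ =>
      (W (p.1 * (p.2 * 2)) - W p.1 - γ * Real.log (p.2 * 2)) / a p.1) (atTop ×ˢ 𝓝 x)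
      (𝓝 (boxCox ρ (x * 2))) :=
    (h (x * 2) (by positivity)).comp (tendsto_fst.prodMk (tendsto_snd.mul_const 2))
  have h3 := (h1.sub (h x hx)).div h2 hb2
  rw [boxCox_mul ρ hx two_pos, add_sub_cancel_left, mul_div_assoc, div_self hb2, mul_one] at h3
  refine h3.congr' ?_
  filter_upwards [h2.eventually_ne hb2, hm.eventually ha, tendsto_fst.eventually ha,
    eventually_snd_pos hx] with p hp1 hp2 hp3 hp4
  have hn : W (p.1 * p.2 * 2) - W (p.1 * p.2) - γ * Real.log 2 ≠ 0 := fun h0 => by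
    simp [h0] at hp1
  have e : Real.log (p.2 * 2) = Real.log p.2 + Real.log 2 := Real.log_mul hp4.ne' two_ne_zero
  simp only [Pi.div_apply]
  rw [← mul_assoc, e, ← sub_div]
  have : W (p.1 * p.2 * 2) - W p.1 - γ * (Real.log p.2 + Real.log 2) -
      (W (p.1 * p.2) - W p.1 - γ * Real.log p.2) =
      W (p.1 * p.2 * 2) - W (p.1 * p.2) - γ * Real.log 2 := by ring
  rw [this]
  field_simp

/-- A function of regular variation with positive index tends to infinity. -/
lemma tendsto_atTop_of_regVar {f : ℝ → ℝ} {α : ℝ} (hα : 0 < α) (hf : ∀ᶠ t in atTop, 0 < f t)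
    (h : LocUnif (fun t x => f (t * x) / f t) (fun x => x ^ α)) : Tendsto f atTop atTop := by
  have hcont : ∀ x : ℝ, 0 < x → ContinuousAt (fun x : ℝ => x ^ α) x := fun x hx =>
    Real.continuousAt_rpow_const x α (Or.inl hx.ne')
  obtain ⟨c, hc1, hc2⟩ : ∃ c : ℝ, 1 < c ∧ c < 2 ^ α :=
    exists_between (Real.one_lt_rpow one_lt_two hα)
  obtain ⟨t₀, ht₀⟩ := eventually_atTop.1 (((hf.and ((h.tendsto_at two_pos).eventually
    (lt_mem_nhds hc2))).and (h.eventually_Icc hcont (b := 1) (c := 2) one_pos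
      (half_pos one_pos))).and (eventually_gt_atTop 0))
  have hpos : ∀ t, t₀ ≤ t → 0 < f t := fun t ht => (ht₀ t ht).1.1.1
  have ht0 : 0 < t₀ := (ht₀ t₀ le_rfl).2
  -- Each doubling gains a factor `c > 1`. The initial bound `f t₀ / 2` on the first dyadic block
  -- comes from uniform convergence there with error `1/2`.
  have hlow : ∀ n : ℕ, ∀ x, (2 : ℝ) ^ n ≤ x → x ≤ 2 ^ (n + 1) → c ^ n * (f t₀ / 2) ≤ f (t₀ * x) := by
    intro n
    induction n with
    | zero =>
      intro x h1 h2
      have hx1 : 1 ≤ x := by simpa using h1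
      have h3 := (ht₀ t₀ le_rfl).1.2 x ⟨hx1, by simpa using h2⟩
      have h4 : (1 : ℝ) ≤ x ^ α := Real.one_le_rpow hx1 hα.le
      have h5 : 1 / 2 < f (t₀ * x) / f t₀ := by linarith [(abs_lt.1 h3).1]
      rw [lt_div_iff₀ (hpos _ le_rfl)] at h5
      simp only [pow_zero]; linarith
    | succ n ih =>
      intro x h1 h2
      have e1 : (2 : ℝ) ^ (n + 1) = 2 ^ n * 2 := pow_succ _ _
      have e2 : (2 : ℝ) ^ (n + 1 + 1) = 2 ^ (n + 1) * 2 := pow_succ _ _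
      have h3 := ih (x / 2) (by linarith) (by linarith)
      have hx1 : 1 ≤ x / 2 := by
        have : (1 : ℝ) ≤ 2 ^ n := one_le_pow₀ one_le_two
        linarith
      have h4 := (ht₀ (t₀ * (x / 2)) (by nlinarith)).1.1.2
      rw [lt_div_iff₀ (hpos _ (by nlinarith)), show t₀ * (x / 2) * 2 = t₀ * x by ring] at h4
      calc c ^ (n + 1) * (f t₀ / 2) = c * (c ^ n * (f t₀ / 2)) := by ring
        _ ≤ c * f (t₀ * (x / 2)) := by gcongr
        _ ≤ f (t₀ * x) := h4.le
  rw [tendsto_atTop]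
  intro M
  obtain ⟨n, hn⟩ := ((tendsto_pow_atTop_atTop_of_one_lt hc1).eventually
    (eventually_ge_atTop (M / (f t₀ / 2)))).exists
  have hf0 : 0 < f t₀ / 2 := half_pos (hpos _ le_rfl)
  rw [div_le_iff₀ hf0] at hn
  filter_upwards [eventually_ge_atTop (t₀ * 2 ^ n)] with t ht
  have hx : (2 : ℝ) ^ n ≤ t / t₀ := by rw [le_div_iff₀ ht0]; linarith
  obtain ⟨N, hN1, hN2⟩ := exists_nat_pow_near (le_trans (one_le_pow₀ one_le_two) hx) one_lt_two
  have hnN : n ≤ N := by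
    by_contra hlt
    have : (2 : ℝ) ^ (N + 1) ≤ 2 ^ n := pow_le_pow_right₀ one_le_two (by omega)
    linarith
  have h5 := hlow N (t / t₀) hN1 hN2.le
  rw [mul_div_cancel₀ _ ht0.ne'] at h5
  have h6 : c ^ n ≤ c ^ N := pow_le_pow_right₀ hc1.le hnN
  nlinarith

lemma log_le_two_mul_rpow_half {x : ℝ} (hx : 0 < x) : Real.log x ≤ 2 * x ^ (1 / 2 : ℝ) := by
  have := Real.log_le_rpow_div hx.le (half_pos one_pos : (0 : ℝ) < 1 / 2)
  linarith

/-- A Potter-type bound, uniform in `x ≥ 1`, for a locally uniform second order relation. -/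
lemma LocUnif.potter_bound {W a : ℝ → ℝ} {γ ρ : ℝ} (hρ : ρ ≤ 0) (ha : ∀ᶠ t in atTop, a t ≠ 0)
    (h : LocUnif (fun t x => (W (t * x) - W t - γ * Real.log x) / a t) (boxCox ρ))
    {ε : ℝ} (hε : 0 < ε) : ∀ᶠ t in atTop, ∀ x, 1 ≤ x →
      |(W (t * x) - W t - γ * Real.log x) / a t - boxCox ρ x| ≤ ε * x ^ (1 / 2 : ℝ) := by
  wlog hε1 : ε ≤ 1 generalizing ε
  · filter_upwards [this one_pos le_rfl] with t ht x hx
    exact (ht x hx).trans (mul_le_mul_of_nonneg_right (not_le.1 hε1).le (by positivity))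
  -- With `ε ≤ 1`, one doubling step multiplies the error by at most `1/10 + 2/10 + 1 + 1/10 = 1.4`,
  -- which is below `√2`, the growth of `x ^ (1/2)` under doubling. This closes the induction.
  have hη : 0 < ε / 10 := by positivity
  have hcont : ∀ x : ℝ, 0 < x → ContinuousAt (boxCox ρ) x := fun x hx => continuousAt_boxCox ρ hx
  have hr := (h.auxiliary_ratio hρ ha).tendsto_at two_pos
  obtain ⟨t₀, ht₀⟩ := eventually_atTop.1 (((ha.and (Metric.tendsto_nhds.1 hr _ hη)).and
    (h.eventually_Icc hcont (b := 1) (c := 2) one_pos hη)).and (eventually_gt_atTop 0))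
  have key : ∀ n : ℕ, ∀ t, t₀ ≤ t → ∀ x, 1 ≤ x → x ≤ 2 ^ (n + 1) →
      |(W (t * x) - W t - γ * Real.log x) / a t - boxCox ρ x| ≤ ε * x ^ (1 / 2 : ℝ) := by
    intro n
    induction n with
    | zero =>
      intro t ht x h1 h2
      have h3 := (ht₀ t ht).1.2 x ⟨h1, by simpa using h2⟩
      have h4 : (1 : ℝ) ≤ x ^ (1 / 2 : ℝ) := Real.one_le_rpow h1 (by norm_num)
      nlinarith
    | succ n ih =>
      intro t ht x h1 h2
      rcases le_total x 2 with hx2 | hx2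
      · exact ih t ht x h1 (hx2.trans (by
          calc (2 : ℝ) = 2 ^ 1 := (pow_one 2).symm
            _ ≤ 2 ^ (n + 1) := pow_le_pow_right₀ one_le_two (by omega)))
      have htpos : 0 < t := (ht₀ t ht).2
      obtain ⟨y, rfl⟩ : ∃ y, x = 2 * y := ⟨x / 2, by ring⟩
      have hy : 1 ≤ y := by linarith
      have hy0 : 0 < y := by linarith
      have hy' : y ≤ 2 ^ (n + 1) := by rw [pow_succ] at h2; linarith
      have h2t : t₀ ≤ t * 2 := by nlinarith
      have hat : a t ≠ 0 := (ht₀ t ht).1.1.1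
      have hat2 : a (t * 2) ≠ 0 := (ht₀ _ h2t).1.1.1
      have e1 := ih (t * 2) h2t y hy hy'
      have e2 := (ht₀ t ht).1.2 2 ⟨by norm_num, le_rfl⟩
      have e3 := (ht₀ t ht).1.1.2
      rw [Real.dist_eq] at e3
      set E := (W (t * 2 * y) - W (t * 2) - γ * Real.log y) / a (t * 2) - boxCox ρ y with hE
      set s := y ^ (1 / 2 : ℝ) with hs
      have hs1 : 1 ≤ s := Real.one_le_rpow hy (by norm_num)
      have hid : (W (t * (2 * y)) - W t - γ * Real.log (2 * y)) / a t - boxCox ρ (2 * y) =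
          ((W (t * 2) - W t - γ * Real.log 2) / a t - boxCox ρ 2) +
          (a (t * 2) / a t - 2 ^ ρ) * boxCox ρ y + (a (t * 2) / a t) * E := by
        rw [boxCox_mul ρ two_pos hy0, Real.log_mul two_ne_zero hy0.ne', ← mul_assoc, hE]
        field_simp
        ring
      have hb0 := boxCox_nonneg hρ hy
      have hb1 : boxCox ρ y ≤ 2 * s := (boxCox_le_log hρ hy).trans (log_le_two_mul_rpow_half hy0)
      have h2ρ : (2 : ℝ) ^ ρ ≤ 1 := Real.rpow_le_one_of_one_le_of_nonpos one_le_two hρ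
      have h2ρ' : (0 : ℝ) < 2 ^ ρ := by positivity
      have hq : |a (t * 2) / a t| ≤ 1 + ε / 10 := by
        rw [abs_le]; constructor <;> linarith [(abs_lt.1 e3).1, (abs_lt.1 e3).2]
      have hsq : (1.41 : ℝ) ≤ 2 ^ (1 / 2 : ℝ) := by
        rw [← Real.sqrt_eq_rpow]; exact Real.le_sqrt_of_sq_le (by norm_num)
      rw [hid, Real.mul_rpow two_pos.le hy0.le]
      calc |_| ≤ |(W (t * 2) - W t - γ * Real.log 2) / a t - boxCox ρ 2| +
            |(a (t * 2) / a t - 2 ^ ρ) * boxCox ρ y| + |(a (t * 2) / a t) * E| :=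
            (abs_add_le _ _).trans (add_le_add_left (abs_add_le _ _) _)
        _ ≤ ε / 10 + ε / 10 * (2 * s) + (1 + ε / 10) * (ε * s) := by
            rw [abs_mul, abs_mul, abs_of_nonneg hb0]
            gcongr
        _ ≤ ε * (1.41 * s) := by nlinarith [mul_pos hε (by linarith : 0 < s)]
        _ ≤ ε * (2 ^ (1 / 2 : ℝ) * s) := by gcongr
  filter_upwards [eventually_ge_atTop t₀] with t ht x hx
  obtain ⟨n, -, hn2⟩ := exists_nat_pow_near hx one_lt_two
  exact key n t ht x hx hn2.le

/-! ### From the Pareto to the Fréchet scale -/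

/-- The increasing map carrying a standard Pareto variable to a standard Fréchet variable. -/
def paretoToFrechet (p : ℝ) : ℝ := -1 / Real.log (1 - 1 / p)

lemma log_one_sub_inv_neg {p : ℝ} (hp : 1 < p) : Real.log (1 - 1 / p) < 0 := by
  have h1 : 1 / p < 1 := by rw [div_lt_one (by linarith)]; exact hp
  have h2 : 0 < 1 / p := by positivity
  exact Real.log_neg (by linarith) (by linarith)

lemma paretoToFrechet_pos {p : ℝ} (hp : 1 < p) : 0 < paretoToFrechet p :=
  div_pos_of_neg_of_neg (by norm_num) (log_one_sub_inv_neg hp)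

lemma paretoToFrechet_mono {p q : ℝ} (hp : 1 < p) (hpq : p ≤ q) :
    paretoToFrechet p ≤ paretoToFrechet q := by
  have hp' : 0 < 1 - 1 / p := by
    have : 1 / p < 1 := by rw [div_lt_one (by linarith)]; exact hp
    linarith
  have h1 : Real.log (1 - 1 / p) ≤ Real.log (1 - 1 / q) := by
    apply Real.log_le_log hp'
    have : 1 / q ≤ 1 / p := one_div_le_one_div_of_le (by linarith) hpq
    linarith
  have hq := log_one_sub_inv_neg (lt_of_lt_of_le hp hpq)
  unfold paretoToFrechet
  rw [neg_div, neg_div, neg_le_neg_iff]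
  exact one_div_le_one_div_of_neg_of_le hq h1

/-- With `u = 1/p`, the expansion `-log (1 - u) = u + u²/2 + O(u³)` gives the reciprocal `1/u - 1/2
+ O(u)`. This is the origin of the shift by one half. -/
lemma abs_paretoToFrechet_add_half_sub_le {p : ℝ} (hp : 2 ≤ p) :
    |paretoToFrechet p + 1 / 2 - p| ≤ 4 / p := by
  obtain ⟨u, hu⟩ : ∃ u, u = 1 / p := ⟨_, rfl⟩
  have hp0 : 0 < p := by linarith
  have hu0 : 0 < u := by rw [hu]; positivity
  have hu2 : u ≤ 1 / 2 := by rw [hu]; exact one_div_le_one_div_of_le two_pos hp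
  have hpu : p = 1 / u := by rw [hu]; simp
  obtain ⟨l, hl⟩ : ∃ l, l = -Real.log (1 - u) := ⟨_, rfl⟩
  have hlu : u ≤ l := by
    have := Real.log_le_sub_one_of_pos (by linarith : 0 < 1 - u)
    linarith
  have hl0 : 0 < l := by linarith
  have hr := Real.abs_log_sub_add_sum_range_le (x := u) (by rw [abs_of_pos hu0]; linarith) 2
  rw [abs_of_pos hu0] at hr
  have hr2 : u ^ (2 + 1) / (1 - u) ≤ 2 * u ^ 3 := by
    rw [div_le_iff₀ (by linarith)]
    have h3 := mul_nonneg (pow_pos hu0 3).le (sub_nonneg.2 hu2)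
    rw [show u ^ (2 + 1) = u ^ 3 from rfl]
    linarith
  have hr3 : |u + u ^ 2 / 2 - l| ≤ 2 * u ^ 3 := by
    refine le_trans (le_of_eq ?_) (hr.trans hr2)
    congr 1
    simp [Finset.sum_range_succ, hl]
    ring
  obtain ⟨h1, h2⟩ := abs_le.1 hr3
  have e : paretoToFrechet p = 1 / l := by
    rw [paretoToFrechet, ← hu, hl, neg_div, div_neg]
  rw [e, hpu]
  -- Substituting the expansion of `l`, the terms of order `u` and `u²` in the numerator cancel, so
  -- it is `O(u³)` over a denominator of order `u²`.
  have e2 : 1 / l + 1 / 2 - 1 / u = (2 * u + u * l - 2 * l) / (2 * u * l) := by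
    field_simp
  have e3 : 4 / (1 / u) = 4 * u := by field_simp
  have hd : 0 < 2 * u * l := by positivity
  have hdl : 8 * u ^ 3 ≤ 4 * u * (2 * u * l) := by
    nlinarith [mul_pos hu0 hu0]
  rw [e2, e3, abs_div, abs_of_pos hd, div_le_iff₀ hd]
  refine le_trans ?_ hdl
  have hu3 := pow_pos hu0 3
  rw [abs_le]
  constructor <;> nlinarith [mul_nonneg hu0.le hu0.le]

lemma abs_log_one_add_le {α : ℝ} (h : |α| ≤ 1 / 2) : |Real.log (1 + α)| ≤ 2 * |α| := by
  obtain ⟨h1, h2⟩ := abs_le.1 h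
  have hpos : 0 < 1 + α := by linarith
  have hu := Real.log_le_sub_one_of_pos hpos
  have hl := Real.one_sub_inv_le_log_of_pos hpos
  have hl2 : 1 - (1 + α)⁻¹ = α / (1 + α) := by field_simp; ring
  have hl3 : |α / (1 + α)| ≤ 2 * |α| := by
    rw [abs_div, abs_of_pos hpos, div_le_iff₀ hpos]
    nlinarith [abs_nonneg α]
  rw [abs_le]
  constructor
  · linarith [(abs_le.1 hl3).1]
  · linarith [le_abs_self α, abs_nonneg α]

lemma tendsto_paretoToFrechet_add_half_div :
    Tendsto (fun p => (paretoToFrechet p + 1 / 2) / p) atTop (𝓝 1) := by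
  rw [tendsto_iff_norm_sub_tendsto_zero]
  have h0 : Tendsto (fun p : ℝ => 4 / p) atTop (𝓝 0) := tendsto_const_nhds.div_atTop tendsto_id
  refine squeeze_zero' (Eventually.of_forall fun _ => norm_nonneg _) ?_ h0
  filter_upwards [eventually_ge_atTop 2] with p hp
  have hp0 : 0 < p := by linarith
  have h := abs_paretoToFrechet_add_half_sub_le hp
  have e : (paretoToFrechet p + 1 / 2) / p - 1 = (paretoToFrechet p + 1 / 2 - p) / p := by
    field_simp
  rw [e, Real.norm_eq_abs, abs_div, abs_of_pos hp0, div_le_iff₀ hp0]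
  refine h.trans ?_
  have : 0 < 4 / p := by positivity
  nlinarith

lemma tendsto_paretoToFrechet_add_half :
    Tendsto (fun p => paretoToFrechet p + 1 / 2) atTop atTop := by
  have h := tendsto_id.atTop_mul_pos one_pos tendsto_paretoToFrechet_add_half_div
  refine h.congr' ?_
  filter_upwards [eventually_gt_atTop 0] with p hp
  simp only [id]
  field_simp

/-- The auxiliary function of a second order relation with parameter `ρ ≥ -1` dominates `t⁻²`. -/
lemma LocUnif.sq_mul_abs_tendsto_atTop {W a : ℝ → ℝ} {γ ρ : ℝ} (hρ : ρ ≤ 0) (hρ1 : -1 ≤ ρ)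
    (ha : ∀ᶠ t in atTop, a t ≠ 0)
    (h : LocUnif (fun t x => (W (t * x) - W t - γ * Real.log x) / a t) (boxCox ρ)) :
    Tendsto (fun t => t ^ 2 * |a t|) atTop atTop := by
  -- The index `2 + ρ` is at least 1, hence positive.
  refine tendsto_atTop_of_regVar (α := 2 + ρ) (by linarith) ?_ ?_
  · filter_upwards [ha, eventually_gt_atTop 0] with t h1 h2
    have := abs_pos.2 h1
    positivity
  · intro x hx
    have h1 := (h.auxiliary_ratio hρ ha x hx).abs
    have h2 : Tendsto (fun p : ℝ × ℝ => p.2 ^ 2) (atTop ×ˢ 𝓝 x) (𝓝 (x ^ 2)) := tendsto_snd.pow 2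
    have h3 := h2.mul h1
    have e : x ^ 2 * |x ^ ρ| = x ^ (2 + ρ) := by
      rw [Real.rpow_add hx, abs_of_pos (by positivity)]; norm_num
    rw [e] at h3
    refine h3.congr' ?_
    filter_upwards [tendsto_fst.eventually ha, tendsto_fst.eventually (eventually_gt_atTop 0)]
      with p hp1 hp2
    have := abs_pos.2 hp1
    rw [abs_div]
    field_simp

/-- The map from Pareto to Fréchet scale is almost multiplicative at infinity. -/
lemma paretoToFrechet_ratio {t x : ℝ} (h8 : 4 ≤ t) (hx : 1 ≤ x) :
    ∃ w : ℝ, 0 < w ∧ 1 ≤ x * w ∧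
      (paretoToFrechet (t * x) + 1 / 2) / (paretoToFrechet t + 1 / 2) = x * w ∧
      |Real.log w| ≤ 16 / t ^ 2 ∧ |w - 1| ≤ 16 / t ^ 2 := by
  have ht0 : 0 < t := by linarith
  have hx0 : 0 < x := by linarith
  have htx : 4 ≤ t * x := by nlinarith
  set s := paretoToFrechet t + 1 / 2 with hs
  set v := paretoToFrechet (t * x) + 1 / 2 with hv
  have hs0 : 0 < s := by have := paretoToFrechet_pos (p := t) (by linarith); linarith
  have hv0 : 0 < v := by have := paretoToFrechet_pos (p := t * x) (by linarith); linarith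
  have hsv : s ≤ v := by
    have := paretoToFrechet_mono (p := t) (q := t * x) (by linarith) (by nlinarith)
    linarith
  -- the relative errors
  obtain ⟨α, hα⟩ : ∃ α, α = v / (t * x) - 1 := ⟨_, rfl⟩
  obtain ⟨β, hβ⟩ : ∃ β, β = s / t - 1 := ⟨_, rfl⟩
  have hβ1 : |β| ≤ 4 / t ^ 2 := by
    have e : β = (s - t) / t := by rw [hβ]; field_simp
    rw [e, abs_div, abs_of_pos ht0, div_le_iff₀ ht0]
    refine (abs_paretoToFrechet_add_half_sub_le (by linarith)).trans (le_of_eq ?_)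
    field_simp
  have hα1 : |α| ≤ 4 / t ^ 2 := by
    have e : α = (v - t * x) / (t * x) := by rw [hα]; field_simp
    rw [e, abs_div, abs_of_pos (by positivity : 0 < t * x), div_le_iff₀ (by positivity)]
    refine (abs_paretoToFrechet_add_half_sub_le (by linarith)).trans ?_
    rw [div_le_iff₀ (by positivity)]
    have e2 : 4 / t ^ 2 * (t * x) * (t * x) = 4 * x ^ 2 := by field_simp
    rw [e2]; nlinarith
  have e8 : 4 / t ^ 2 ≤ 1 / 2 := by
    rw [div_le_iff₀ (by positivity)]; nlinarith
  have hlα := abs_log_one_add_le (α := α) (by linarith)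
  have hlβ := abs_log_one_add_le (α := β) (by linarith)
  obtain ⟨w, hw⟩ : ∃ w, w = (1 + α) / (1 + β) := ⟨_, rfl⟩
  have hβpos : 0 < 1 + β := by have := (abs_le.1 hβ1).1; linarith
  have hαpos : 0 < 1 + α := by have := (abs_le.1 hα1).1; linarith
  have hw0 : 0 < w := by rw [hw]; positivity
  have hvs : v / s = x * w := by
    have e1 : 1 + α = v / (t * x) := by rw [hα]; ring
    have e2 : 1 + β = s / t := by rw [hβ]; ring
    rw [hw, e1, e2]; field_simp
  -- Monotonicity of the change of scale keeps the perturbed ratio in the range where the Potter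
  -- bound is available.
  have hy1 : 1 ≤ x * w := by rw [← hvs, one_le_div hs0]; exact hsv
  have hwlog : Real.log w = Real.log (1 + α) - Real.log (1 + β) := by
    rw [hw, Real.log_div hαpos.ne' hβpos.ne']
  have hlw : |Real.log w| ≤ 16 / t ^ 2 := by
    rw [hwlog]
    refine (abs_sub _ _).trans ?_
    have : 16 / t ^ 2 = 4 * (4 / t ^ 2) := by ring
    linarith
  have hw1 : |w - 1| ≤ 16 / t ^ 2 := by
    have e : w - 1 = (α - β) / (1 + β) := by rw [hw]; field_simp; ring
    rw [e, abs_div, abs_of_pos hβpos, div_le_iff₀ hβpos]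
    refine (abs_sub _ _).trans ?_
    have hb : 1 / 2 ≤ 1 + β := by have := (abs_le.1 hβ1).1; linarith
    have : 16 / t ^ 2 = 4 * (4 / t ^ 2) := by ring
    have : 0 ≤ 4 / t ^ 2 := by positivity
    nlinarith
  exact ⟨w, hw0, hy1, hvs, hlw, hw1⟩

/-- The Potter-type bound is preserved by the substitution carrying Pareto to Fréchet scale. -/
lemma LocUnif.potter_bound_pareto {W a : ℝ → ℝ} {γ ρ : ℝ} (hρ : ρ ≤ 0) (hρ1 : -1 ≤ ρ)
    (ha : ∀ᶠ t in atTop, a t ≠ 0)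
    (h : LocUnif (fun t x => (W (t * x) - W t - γ * Real.log x) / a t) (boxCox ρ))
    {ε : ℝ} (hε : 0 < ε) : ∀ᶠ t in atTop, ∀ x, 1 ≤ x →
      |W (paretoToFrechet (t * x) + 1 / 2) - W (paretoToFrechet t + 1 / 2) - γ * Real.log x
        - a t * boxCox ρ x| ≤ ε * |a t| * x ^ (1 / 2 : ℝ) := by
  -- The four error terms below add up to at most `9 η |a t|` times `x ^ (1/2)`; `η ≤ 1` serves to
  -- bound `|a s|` by `2 |a t|`.
  obtain ⟨η, hη⟩ : ∃ η, η = min (ε / 10) 1 := ⟨_, rfl⟩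
  have hη0 : 0 < η := by rw [hη]; positivity
  have hη1 : η ≤ 1 := hη ▸ min_le_right _ _
  have hηε : η ≤ ε / 10 := hη ▸ min_le_left _ _
  have hP := tendsto_paretoToFrechet_add_half.eventually (h.potter_bound hρ ha hη0)
  have hratio : Tendsto (fun t => a (t * ((paretoToFrechet t + 1 / 2) / t)) / a t) atTop
      (𝓝 ((1 : ℝ) ^ ρ)) :=
    (h.auxiliary_ratio hρ ha 1 one_pos).comp
      (tendsto_id.prodMk tendsto_paretoToFrechet_add_half_div)
  rw [Real.one_rpow] at hratio
  obtain ⟨δ, hδ0, hδ⟩ := Metric.continuousAt_iff.1 (continuousAt_boxCox ρ one_pos) η hη0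
  simp only [Real.dist_eq, boxCox_one, sub_zero] at hδ
  -- The change of scale costs `γ log w = O(t⁻²)`; this is absorbed by `η |a t|`, and it is here
  -- that `-1 ≤ ρ` enters.
  have hsq := (h.sq_mul_abs_tendsto_atTop hρ hρ1 ha).eventually
    (eventually_ge_atTop (16 * |γ| / η))
  have hsmall : Tendsto (fun t : ℝ => 32 / t ^ 2) atTop (𝓝 0) :=
    tendsto_const_nhds.div_atTop (tendsto_pow_atTop two_ne_zero)
  filter_upwards [hP, Metric.tendsto_nhds.1 hratio η hη0, hsq, hsmall.eventually (gt_mem_nhds hδ0),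
    hsmall.eventually (gt_mem_nhds one_pos), ha, tendsto_paretoToFrechet_add_half.eventually ha,
    eventually_ge_atTop 4] with t h1 h2 h3 h4 h5 h6 h7 h8 x hx
  have ht0 : 0 < t := by linarith
  have hx0 : 0 < x := by linarith
  obtain ⟨w, hw0, hy1, hvs, hlw, hw1⟩ := paretoToFrechet_ratio h8 hx
  have hs0 : 0 < paretoToFrechet t + 1 / 2 := by
    have := paretoToFrechet_pos (p := t) (by linarith)
    linarith
  generalize paretoToFrechet (t * x) + 1 / 2 = v at *
  generalize paretoToFrechet t + 1 / 2 = s at *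
  have hwδ : |boxCox ρ w| < η := hδ (lt_of_le_of_lt hw1 (by
    have : 16 / t ^ 2 = (32 / t ^ 2) / 2 := by ring
    linarith))
  have hw4 : w ≤ 4 := by
    have := (abs_le.1 hw1).2
    have : 16 / t ^ 2 = (32 / t ^ 2) / 2 := by ring
    linarith
  have hγ : |γ| * |Real.log w| ≤ η * |a t| := by
    have e1 : 16 * |γ| ≤ η * (t ^ 2 * |a t|) := by
      rw [div_le_iff₀ hη0] at h3; linarith
    calc |γ| * |Real.log w| ≤ |γ| * (16 / t ^ 2) := by gcongr
      _ = 16 * |γ| / t ^ 2 := by ring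
      _ ≤ η * |a t| := by rw [div_le_iff₀ (by positivity)]; linarith
  have hs1 := h1 (x * w) hy1
  rw [← hvs, mul_div_cancel₀ _ hs0.ne', hvs] at hs1
  rw [mul_div_cancel₀ _ ht0.ne', Real.dist_eq] at h2
  have hds : |a s - a t| ≤ η * |a t| := by
    have e : a s - a t = (a s / a t - 1) * a t := by field_simp
    rw [e, abs_mul]; gcongr
  have hs2 : |a s| ≤ 2 * |a t| := by
    have := abs_sub_abs_le_abs_sub (a s) (a t)
    have : η * |a t| ≤ |a t| := mul_le_of_le_one_left (abs_nonneg _) hη1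
    linarith
  obtain ⟨r, hr⟩ : ∃ r, r = x ^ (1 / 2 : ℝ) := ⟨_, rfl⟩
  have hr1 : 1 ≤ r := hr ▸ Real.one_le_rpow hx (by norm_num)
  have hxw : (x * w) ^ (1 / 2 : ℝ) ≤ 2 * r := by
    rw [Real.mul_rpow hx0.le hw0.le, ← hr]
    have : w ^ (1 / 2 : ℝ) ≤ 2 := by
      calc w ^ (1 / 2 : ℝ) ≤ 4 ^ (1 / 2 : ℝ) := by gcongr
        _ = 2 := by
          rw [← Real.sqrt_eq_rpow, show (4 : ℝ) = 2 ^ 2 by norm_num, Real.sqrt_sq two_pos.le]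
    rw [mul_comm]
    exact mul_le_mul_of_nonneg_right this (by linarith)
  have hM : |W v - W s - γ * Real.log (x * w) - a s * boxCox ρ (x * w)| ≤
      |a s| * (η * (2 * r)) := by
    have e : W v - W s - γ * Real.log (x * w) - a s * boxCox ρ (x * w) =
        a s * ((W v - W s - γ * Real.log (x * w)) / a s - boxCox ρ (x * w)) := by
      field_simp
    rw [e, abs_mul]
    gcongr
    exact hs1.trans (by gcongr)
  have hb0 := boxCox_nonneg hρ hx
  have hb1 : boxCox ρ x ≤ 2 * r :=
    (boxCox_le_log hρ hx).trans (hr ▸ log_le_two_mul_rpow_half hx0)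
  have hxρ : x ^ ρ ≤ 1 := Real.rpow_le_one_of_one_le_of_nonpos hx hρ
  have hxρ0 : 0 < x ^ ρ := by positivity
  -- The errors are, in order: the Potter remainder at the point `s` and ratio `x w`, the effect of
  -- `w` on `boxCox`, the change of auxiliary size from `t` to `s`, and the first order effect of
  -- `w`.
  have hid : W v - W s - γ * Real.log x - a t * boxCox ρ x =
      (W v - W s - γ * Real.log (x * w) - a s * boxCox ρ (x * w)) +
      a s * (x ^ ρ * boxCox ρ w) + (a s - a t) * boxCox ρ x + γ * Real.log w := by
    rw [boxCox_mul ρ hx0 hw0, Real.log_mul hx0.ne' hw0.ne']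
    ring
  rw [hid, ← hr]
  have hat := abs_pos.2 h6
  have t2 : |a s * (x ^ ρ * boxCox ρ w)| ≤ 2 * |a t| * η := by
    rw [abs_mul, abs_mul, abs_of_pos hxρ0]
    calc |a s| * (x ^ ρ * |boxCox ρ w|) ≤ (2 * |a t|) * (1 * η) := by gcongr
      _ = _ := by ring
  have t3 : |(a s - a t) * boxCox ρ x| ≤ η * |a t| * (2 * r) := by
    rw [abs_mul, abs_of_nonneg hb0]; gcongr
  have t4 : |γ * Real.log w| ≤ η * |a t| := by rw [abs_mul]; exact hγ
  have t1 : |a s| * (η * (2 * r)) ≤ 4 * (η * |a t|) * r := by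
    calc |a s| * (η * (2 * r)) ≤ (2 * |a t|) * (η * (2 * r)) := by gcongr
      _ = _ := by ring
  have hηa : 0 ≤ η * |a t| := by positivity
  calc |_| ≤ |W v - W s - γ * Real.log (x * w) - a s * boxCox ρ (x * w)| +
        |a s * (x ^ ρ * boxCox ρ w)| + |(a s - a t) * boxCox ρ x| + |γ * Real.log w| := by
          refine (abs_add_le _ _).trans (add_le_add_left ((abs_add_le _ _).trans
            (add_le_add_left (abs_add_le _ _) _)) _)
    _ ≤ 4 * (η * |a t|) * r + 2 * |a t| * η + η * |a t| * (2 * r) + η * |a t| := by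
        linarith
    _ ≤ 10 * (η * |a t|) * r := by
        have := mul_le_mul_of_nonneg_left hr1 hηa
        linarith
    _ ≤ ε * |a t| * r := by
        have : 10 * η ≤ ε := by linarith
        have h10 : 10 * (η * |a t|) ≤ ε * |a t| := by
          rw [← mul_assoc]; exact mul_le_mul_of_nonneg_right this hat.le
        gcongr

/-! ### A uniform convergence theorem for measurable functions -/

/-- Convergence of difference quotients on a compact interval, up to a small exceptional set. -/
lemma eventually_volume_bad_lt {f : ℕ → ℝ → ℝ} {φ : ℝ → ℝ} (hf : ∀ n, Measurable (f n))
    (h : ∀ w, Tendsto (fun n => f n w) atTop (𝓝 (φ w))) (K : ℝ) {ε : ℝ} (hε : 0 < ε) :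
    ∀ᶠ n in atTop, volume ({w | ε ≤ |f n w - φ w|} ∩ Set.Icc (-K) K) < 1 / 2 := by
  have h1 : TendstoInMeasure (volume.restrict (Set.Icc (-K) K)) f atTop φ :=
    tendstoInMeasure_of_tendsto_ae (fun n => (hf n).aestronglyMeasurable)
      (Eventually.of_forall h)
  have h2 := tendstoInMeasure_iff_norm.1 h1 ε hε
  have h3 := h2.eventually (gt_mem_nhds (show (0 : ENNReal) < 1 / 2 by norm_num))
  filter_upwards [h3] with n hn
  rwa [Measure.restrict_apply' measurableSet_Icc] at hn

/-- A uniform convergence theorem for measurable functions satisfying a generalised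
regular variation relation, in additive notation and along sequences. -/
lemma tendsto_increment_of_seq {h b φ : ℝ → ℝ} {ρ : ℝ} (hh : Measurable h) (hφc : Continuous φ)
    (hφ : ∀ u v, φ (u + v) = φ u + Real.exp (ρ * u) * φ v)
    (hb0 : ∀ᶠ s in atTop, b s ≠ 0)
    (hlim : ∀ u, Tendsto (fun s => (h (s + u) - h s) / b s) atTop (𝓝 (φ u)))
    {s u : ℕ → ℝ} {u₀ : ℝ} (hs : Tendsto s atTop atTop) (hu : Tendsto u atTop (𝓝 u₀))
    (hb : Tendsto (fun n => b (s n + u n) / b (s n)) atTop (𝓝 (Real.exp (ρ * u₀)))) :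
    Tendsto (fun n => (h (s n + u n) - h (s n)) / b (s n)) atTop (𝓝 (φ u₀)) := by
  have hsu : Tendsto (fun n => s n + u n) atTop atTop := hs.atTop_add hu
  -- Large enough that `[-K, K]` contains both `w` and `w - u n` for all `w` in `[0, 1]`, once `u n`
  -- is within 1 of `u₀`.
  set K := |u₀| + 2 with hK
  obtain ⟨M, hM⟩ := (isCompact_Icc (a := -K) (b := K)).exists_bound_of_continuousOn
    hφc.continuousOn
  have hφu : Tendsto (fun n => φ (u n)) atTop (𝓝 (φ u₀)) := (hφc.tendsto u₀).comp hu
  suffices hD : Tendsto (fun n => (h (s n + u n) - h (s n)) / b (s n) - φ (u n)) atTop (𝓝 0) by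
    simpa using hD.add hφu
  have hq : Tendsto (fun n => b (s n + u n) / b (s n) - Real.exp (ρ * u n)) atTop (𝓝 0) := by
    have : Tendsto (fun n => Real.exp (ρ * u n)) atTop (𝓝 (Real.exp (ρ * u₀))) :=
      (Real.continuous_exp.tendsto _).comp (hu.const_mul ρ)
    simpa using hb.sub this
  set C := Real.exp (ρ * u₀) + 1 with hC
  have hC0 : 0 < C := by positivity
  have hM0 : 0 ≤ M := (norm_nonneg _).trans (hM 0 (by
    constructor <;> linarith [abs_nonneg u₀]))
  rw [Metric.tendsto_nhds]
  intro ε hε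
  obtain ⟨δ, hδ0, hδ⟩ : ∃ δ, 0 < δ ∧ δ + C * δ + δ * M < ε := by
    refine ⟨ε / (2 * (1 + C + M)), by positivity, ?_⟩
    have e : ε / (2 * (1 + C + M)) + C * (ε / (2 * (1 + C + M))) + ε / (2 * (1 + C + M)) * M =
        ε / 2 := by field_simp
    rw [e]; linarith
  have hg := eventually_volume_bad_lt (f := fun n w => (h (s n + w) - h (s n)) / b (s n))
    (φ := φ) (fun n => by fun_prop) (fun w => (hlim w).comp hs) K hδ0
  have hk := eventually_volume_bad_lt
    (f := fun n w => (h (s n + u n + w) - h (s n + u n)) / b (s n + u n))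
    (φ := φ) (fun n => by fun_prop) (fun w => (hlim w).comp hsu) K hδ0
  have hcl : Tendsto (fun n => |b (s n + u n) / b (s n)|) atTop (𝓝 (Real.exp (ρ * u₀))) := by
    simpa using hb.abs
  filter_upwards [hg, hk, hcl.eventually (gt_mem_nhds (show Real.exp (ρ * u₀) < C by linarith)),
    Metric.tendsto_nhds.1 hq δ hδ0, Metric.tendsto_nhds.1 hu 1 one_pos, hs.eventually hb0,
    hsu.eventually hb0] with n h1 h2 h3 h4 h5 h6 h7
  have hun : |u n| ≤ |u₀| + 1 := by
    have := abs_sub_abs_le_abs_sub (u n) u₀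
    rw [Real.dist_eq] at h5
    linarith
  obtain ⟨hu1, hu2⟩ := abs_le.1 hun
  -- The exceptional sets for the base points `s n` and `s n + u n`, the second translated by `u n`,
  -- each have measure below `1/2` and cannot cover `[0, 1]`. Some `s n + w` is therefore well
  -- reached from both base points, and the increment between these is a difference of two
  -- controlled ones.
  obtain ⟨w, hw, hw1, hw2⟩ : ∃ w ∈ Set.Icc (0 : ℝ) 1,
      |(h (s n + w) - h (s n)) / b (s n) - φ w| < δ ∧
      |(h (s n + u n + (w - u n)) - h (s n + u n)) / b (s n + u n) - φ (w - u n)| < δ := by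
    by_contra! hcon
    set B1 := {w | δ ≤ |(h (s n + w) - h (s n)) / b (s n) - φ w|} ∩ Set.Icc (-K) K
    set B2 := {w | δ ≤ |(h (s n + u n + w) - h (s n + u n)) / b (s n + u n) - φ w|} ∩
      Set.Icc (-K) K
    have hsub : Set.Icc (0 : ℝ) 1 ⊆ B1 ∪ (fun w => w - u n) ⁻¹' B2 := by
      intro w hw
      by_cases hlt : |(h (s n + w) - h (s n)) / b (s n) - φ w| < δ
      · exact Or.inr ⟨hcon w hw hlt, by constructor <;> linarith [hw.1, hw.2]⟩
      · exact Or.inl ⟨not_lt.1 hlt, by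
          constructor <;> linarith [hw.1, hw.2, abs_nonneg u₀]⟩
    have hvol : volume ((fun w => w - u n) ⁻¹' B2) = volume B2 := by
      simp [sub_eq_add_neg]
    have h8 := (measure_mono hsub).trans (measure_union_le (μ := volume) _ _)
    rw [hvol, Real.volume_Icc] at h8
    have h9 := ENNReal.add_lt_add h1 h2
    have h10 : (1 / 2 : ENNReal) + 1 / 2 = 1 := by simp [ENNReal.inv_two_add_inv_two]
    rw [h10] at h9
    have h11 := h8.trans_lt h9
    norm_num at h11
  have hid : (h (s n + u n) - h (s n)) / b (s n) - φ (u n) =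
      ((h (s n + w) - h (s n)) / b (s n) - φ w) -
      b (s n + u n) / b (s n) *
        ((h (s n + u n + (w - u n)) - h (s n + u n)) / b (s n + u n) - φ (w - u n)) -
      (b (s n + u n) / b (s n) - Real.exp (ρ * u n)) * φ (w - u n) := by
    have e1 : φ w = φ (u n) + Real.exp (ρ * u n) * φ (w - u n) := by
      rw [← hφ]; congr 1; ring
    rw [e1, show s n + u n + (w - u n) = s n + w by ring]
    field_simp
    ring
  have hφM : |φ (w - u n)| ≤ M := hM _ (by constructor <;> linarith [hw.1, hw.2])
  rw [Real.dist_eq, sub_zero] at h4 ⊢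
  rw [hid]
  refine lt_of_le_of_lt ?_ hδ
  refine (abs_sub _ _).trans (add_le_add ((abs_sub _ _).trans (add_le_add hw1.le ?_)) ?_)
  · rw [abs_mul]
    exact mul_le_mul h3.le hw2.le (abs_nonneg _) hC0.le
  · rw [abs_mul]
    exact mul_le_mul h4.le hφM (abs_nonneg _) hδ0.le

/-- The slope `dslope Real.log 1` is continuous at 1 with value 1, so `log (1 + z)` is `z` times a
factor tending to 1, even where `z` vanishes. -/
lemma tendsto_log_one_add_div {ι : Type*} {l : Filter ι} {z d : ι → ℝ} {c : ℝ}
    (hz : Tendsto z l (𝓝 0)) (hc : Tendsto (fun i => z i / d i) l (𝓝 c)) :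
    Tendsto (fun i => Real.log (1 + z i) / d i) l (𝓝 c) := by
  have h1 : Tendsto (fun i => 1 + z i) l (𝓝 1) := by simpa using hz.const_add 1
  have hd : ContinuousAt (dslope Real.log 1) 1 :=
    continuousAt_dslope_same.2 (Real.differentiableAt_log one_ne_zero)
  have h2 : Tendsto (fun i => dslope Real.log 1 (1 + z i)) l (𝓝 1) := by
    have := hd.tendsto.comp h1
    simpa [dslope_same, Real.deriv_log, Function.comp_def] using this
  have h3 := h2.mul hc
  rw [one_mul] at h3
  refine h3.congr fun i => ?_
  have e := sub_smul_dslope Real.log 1 (1 + z i)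
  simp only [add_sub_cancel_left, smul_eq_mul, Real.log_one, sub_zero] at e
  rw [← e]; ring

/-- Ratios of the auxiliary function are reached through logarithms of absolute values; the constant
sign restores the lost signs. -/
lemma abs_ratio_eq_of_constantSign {A : ℝ → ℝ} (hA : UltimatelyConstantSign A) :
    ∃ t₀, ∀ s t, t₀ ≤ s → t₀ ≤ t → |A s| / |A t| = A s / A t := by
  rcases hA with h | h
  all_goals
    obtain ⟨t₀, ht₀⟩ := eventually_atTop.1 h
    refine ⟨t₀, fun s t hs ht => ?_⟩
  · rw [abs_of_pos (ht₀ s hs), abs_of_pos (ht₀ t ht)]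
  · rw [abs_of_neg (ht₀ s hs), abs_of_neg (ht₀ t ht), neg_div_neg_eq]

lemma UltimatelyConstantSign.eventually_ne {A : ℝ → ℝ} (hA : UltimatelyConstantSign A) :
    ∀ᶠ t in atTop, A t ≠ 0 := by
  rcases hA with h | h
  · exact h.mono fun t ht => ht.ne'
  · exact h.mono fun t ht => ht.ne

/-- A pointwise second order relation for a measurable function, in additive notation, holds
along arbitrary sequences. -/
lemma tendsto_second_order_of_seq {h b : ℝ → ℝ} {ρ : ℝ} (hρ : ρ ≤ 0) (hh : Measurable h)
    (hb : UltimatelyConstantSign b)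
    (hlim : ∀ u, Tendsto (fun s => (h (s + u) - h s) / b s) atTop (𝓝 (boxCox ρ (Real.exp u))))
    {s u : ℕ → ℝ} {u₀ : ℝ} (hs : Tendsto s atTop atTop) (hu : Tendsto u atTop (𝓝 u₀)) :
    Tendsto (fun n => (h (s n + u n) - h (s n)) / b (s n)) atTop
      (𝓝 (boxCox ρ (Real.exp u₀))) := by
  have hφ : ∀ u v, boxCox ρ (Real.exp (u + v)) =
      boxCox ρ (Real.exp u) + Real.exp (ρ * u) * boxCox ρ (Real.exp v) := fun u v => by
    rw [Real.exp_add, boxCox_mul ρ (Real.exp_pos u) (Real.exp_pos v), ← Real.exp_mul,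
      mul_comm ρ u]
  have hφc : Continuous fun u => boxCox ρ (Real.exp u) := continuous_iff_continuousAt.2 fun u =>
    (continuousAt_boxCox ρ (Real.exp_pos u)).comp Real.continuous_exp.continuousAt
  have hb0 := hb.eventually_ne
  set c := boxCox ρ (Real.exp 1) with hc
  have hc0 : c ≠ 0 := (boxCox_pos hρ (by simp)).ne'
  -- a measurable version of the auxiliary function
  set d : ℝ → ℝ := fun s => h (s + 1) - h s with hd
  have hdm : Measurable d := by fun_prop
  have hdb : Tendsto (fun s => d s / b s) atTop (𝓝 c) := hlim 1
  have hd0 : ∀ᶠ s in atTop, d s ≠ 0 := by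
    filter_upwards [hdb.eventually_ne hc0] with s hs h0
    simp [h0] at hs
  have hshift : ∀ u : ℝ, Tendsto (fun s : ℝ => s + u) atTop atTop := fun u =>
    tendsto_atTop_add_const_right _ u tendsto_id
  have hbd : ∀ u, Tendsto (fun s => d (s + u) / b s) atTop (𝓝 (Real.exp (ρ * u) * c)) := by
    intro u
    have h1 := (hlim (u + 1)).sub (hlim u)
    rw [hφ u 1, add_sub_cancel_left] at h1
    refine h1.congr fun s => ?_
    rw [← sub_div]; congr 1
    simp only [hd]; ring_nf
  have hdd : ∀ u, Tendsto (fun s => d (s + u) / d s) atTop (𝓝 (Real.exp (ρ * u))) := by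
    intro u
    have h1 := (hbd u).div hdb hc0
    rw [mul_div_assoc, div_self hc0, mul_one] at h1
    refine h1.congr' ?_
    filter_upwards [hb0] with s hs
    simp only [Pi.div_apply]
    field_simp
  have hlog : ∀ u, Tendsto (fun s => (Real.log |d (s + u)| - Real.log |d s|) / 1) atTop
      (𝓝 (ρ * u)) := by
    intro u
    have h1 := ((hdd u).abs.log (by positivity))
    rw [abs_of_pos (Real.exp_pos _), Real.log_exp] at h1
    refine h1.congr' ?_
    filter_upwards [hd0, (hshift u).eventually hd0] with s h2 h3
    rw [div_one, abs_div, Real.log_div (abs_pos.2 h3).ne' (abs_pos.2 h2).ne']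
  -- The auxiliary function `b` need not be measurable, but `d` is asymptotic to a multiple of it.
  -- Applied to `log |d|` with constant denominator, the uniform convergence theorem gives regular
  -- variation of `d`, and so of `b`, along sequences; a second application then treats `h` itself.
  have hseq := tendsto_increment_of_seq (h := fun s => Real.log |d s|) (b := fun _ => 1)
    (φ := fun u => ρ * u) (ρ := 0) (by fun_prop) (by fun_prop)
    (fun u v => by simp [mul_add]) (by simp) hlog hs hu (by simp)
  have hsu : Tendsto (fun n => s n + u n) atTop atTop := hs.atTop_add hu
  obtain ⟨t₀, ht₀⟩ := abs_ratio_eq_of_constantSign hb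
  have hbseq : Tendsto (fun n => b (s n + u n) / b (s n)) atTop (𝓝 (Real.exp (ρ * u₀))) := by
    have h1 := (Real.continuous_exp.tendsto _).comp hseq
    have h2 := ((hdb.comp hs).abs.div (hdb.comp hsu).abs (abs_pos.2 hc0).ne').mul h1
    rw [div_self (abs_pos.2 hc0).ne', one_mul] at h2
    refine h2.congr' ?_
    filter_upwards [hs.eventually hd0, hsu.eventually hd0, hs.eventually hb0, hsu.eventually hb0,
      hs.eventually (eventually_ge_atTop t₀), hsu.eventually (eventually_ge_atTop t₀)]
      with n h3 h4 h5 h6 h7 h8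
    have h3' := abs_pos.2 h3
    have h4' := abs_pos.2 h4
    have h5' := abs_pos.2 h5
    have h6' := abs_pos.2 h6
    rw [← ht₀ _ _ h8 h7]
    simp only [Function.comp_apply, div_one, Pi.div_apply]
    rw [← Real.log_div h4'.ne' h3'.ne', Real.exp_log (by positivity), abs_div, abs_div]
    field_simp
  exact tendsto_increment_of_seq (φ := fun u => boxCox ρ (Real.exp u)) hh hφc hφ hb0 hlim hs hu
    hbseq

/-! ### The second order relation for `log V` -/

/-- The second order condition on a monotone `V` gives, locally uniformly, the second order
relation for `log V`. -/
lemma ConditionA2.log_locUnif {V A : ℝ → ℝ} {γ ρ : ℝ} (hρ : ρ ≤ 0) (hA2 : ConditionA2 V γ ρ A)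
    (hVm : MonotoneOn V (Set.Ioi 0)) (hVpos : ∀ᶠ t in atTop, 0 < V t) :
    LocUnif (fun t x => (Real.log (V (t * x)) - Real.log (V t) - γ * Real.log x) / A t)
      (boxCox ρ) := by
  have hA0 := hA2.const_sign.eventually_ne
  have hpt : ∀ x, 0 < x → Tendsto (fun t =>
      (Real.log (V (t * x)) - Real.log (V t) - γ * Real.log x) / A t) atTop
      (𝓝 (boxCox ρ x)) := by
    intro x hx
    have hxγ : 0 < x ^ γ := by positivity
    have h1 : Tendsto (fun t => (V (t * x) / V t / x ^ γ - 1) / A t) atTop (𝓝 (boxCox ρ x)) := by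
      have := (hA2.second_order x hx).div_const (x ^ γ)
      rw [mul_div_cancel_left₀ _ hxγ.ne'] at this
      refine this.congr fun t => ?_
      field_simp
    have h2 : Tendsto (fun t => V (t * x) / V t / x ^ γ - 1) atTop (𝓝 0) := by
      -- As `A` tends to 0, the normalised ratio tends to 1, so passing to the logarithm leaves the
      -- second order limit unchanged.
      have := h1.mul hA2.tendsto_zero
      rw [mul_zero] at this
      refine this.congr' ?_
      filter_upwards [hA0] with t ht
      field_simp
    refine (tendsto_log_one_add_div h2 h1).congr' ?_
    filter_upwards [hVpos, (tendsto_id.atTop_mul_const hx).eventually hVpos] with t h3 h4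
    simp only [id] at h4
    rw [add_sub_cancel, Real.log_div (by positivity) hxγ.ne', Real.log_div h4.ne' h3.ne',
      Real.log_rpow hx]
  have hexp : Tendsto Real.exp atTop atTop := Real.tendsto_exp_atTop
  set h : ℝ → ℝ := fun s => Real.log (V (Real.exp s)) - γ * s with hh
  have hhm : Measurable h := by
    have : Monotone fun s => V (Real.exp s) := fun a b hab =>
      hVm (Real.exp_pos a) (Real.exp_pos b) (Real.exp_le_exp.2 hab)
    exact (Real.measurable_log.comp this.measurable).sub (by fun_prop)
  have hbs : UltimatelyConstantSign fun s => A (Real.exp s) :=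
    hA2.const_sign.imp (fun h => hexp.eventually h) (fun h => hexp.eventually h)
  have hlim : ∀ u, Tendsto (fun s => (h (s + u) - h s) / A (Real.exp s)) atTop
      (𝓝 (boxCox ρ (Real.exp u))) := by
    intro u
    refine ((hpt _ (Real.exp_pos u)).comp hexp).congr fun s => ?_
    simp only [Function.comp_apply, hh, Real.exp_add, Real.log_exp]
    congr 1; ring
  intro x hx
  refine tendsto_of_seq_tendsto fun p hp => ?_
  have h1 : Tendsto (fun n => (p n).1) atTop atTop := tendsto_fst.comp hp
  have h2 : Tendsto (fun n => (p n).2) atTop (𝓝 x) := tendsto_snd.comp hp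
  have h3 := tendsto_second_order_of_seq hρ hhm hbs hlim (Real.tendsto_log_atTop.comp h1)
    (h2.log hx.ne')
  rw [Real.exp_log hx] at h3
  refine h3.congr' ?_
  filter_upwards [h1.eventually (eventually_gt_atTop 0), h2.eventually (lt_mem_nhds hx)]
    with n h4 h5
  simp only [Function.comp_apply, hh, Real.exp_add, Real.exp_log h4, Real.exp_log h5]
  congr 1; ring

/-- If `V` were never positive it would be eventually negative and nondecreasing, so `|V|` would be
nonincreasing. As `Real.log` only sees `|V|`, this contradicts the positive limit `γ log 2` of the
logarithmic increments. -/
lemma ConditionA1.eventually_pos {V : ℝ → ℝ} {γ : ℝ} (hγ : 0 < γ) (h : ConditionA1 V γ)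
    (hVm : MonotoneOn V (Set.Ioi 0)) : ∀ᶠ t in atTop, 0 < V t := by
  obtain ⟨t₀, ht₀⟩ := h.uniform_bound (1 / 2) 1 (by norm_num) one_pos
  -- At `x = 1` a zero of `V` would make the quotient `0 / 0 = 0`, at distance 1 from `x ^ γ`, above
  -- the allowed `1/2`.
  have hne : ∀ t, t₀ ≤ t → V t ≠ 0 := fun t ht h0 => by
    have := ht₀ t 1 ht le_rfl
    norm_num [h0] at this
  by_cases hex : ∃ t, 0 < t ∧ 0 < V t
  · obtain ⟨t₁, h1, h2⟩ := hex
    filter_upwards [eventually_ge_atTop t₁] with t ht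
    exact h2.trans_le (hVm h1 (h1.trans_le ht) ht)
  · exfalso
    push Not at hex
    have h1 := (h.log_tendsto 2 two_pos).eventually
      (lt_mem_nhds (mul_pos hγ (Real.log_pos one_lt_two)))
    obtain ⟨t, h2, h3, h4⟩ := (h1.and ((eventually_ge_atTop t₀).and (eventually_gt_atTop 0))).exists
    have h5 : V (t * 2) < 0 := lt_of_le_of_ne (hex _ (by positivity)) (hne _ (by linarith))
    have h6 : V t ≤ V (t * 2) := hVm h4 (by simpa using h4) (by linarith)
    have h7 : Real.log (V (t * 2)) ≤ Real.log (V t) := by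
      rw [← Real.log_neg_eq_log (V (t * 2)), ← Real.log_neg_eq_log (V t)]
      exact Real.log_le_log (by linarith) (by linarith)
    linarith

lemma boxCox_neg_one {x : ℝ} : boxCox (-1) x = 1 - 1 / x := by
  rw [boxCox, if_neg (by norm_num), Real.rpow_neg_one]
  ring

/-! ### The shift by one half and existence of the auxiliary function -/

/-- The shift by one half turns a second order relation for `f` into one with an additional term of
order `1 / t`. -/
lemma LocUnif.shift {f A : ℝ → ℝ} {γ ρ : ℝ} (hρ : ρ ≤ 0) (hA : ∀ᶠ t in atTop, A t ≠ 0)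
    (h : LocUnif (fun t x => (f (t * x) - f t - γ * Real.log x) / A t) (boxCox ρ))
    {m : ℝ} (hm : 0 < m) :
    ∃ P Q : ℝ → ℝ → ℝ, LocUnif P (boxCox ρ) ∧ LocUnif Q (boxCox (-1)) ∧
      ∀ᶠ t in atTop, ∀ x, 1 ≤ t * x → 0 < x →
        f (m * shiftHalf (t * x)) - f (m * shiftHalf t) - γ * Real.log x =
          A (m * t) * P t x + m * γ / 2 / (m * t) * Q t x := by
  have hshift : Tendsto (fun t : ℝ => m * shiftHalf t) atTop atTop := by
    refine Tendsto.const_mul_atTop hm ?_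
    have := tendsto_atTop_add_const_right atTop (-(1 / 2) : ℝ) tendsto_id
    exact this.congr fun t => by simp [shiftHalf, sub_eq_add_neg]
  have hmt : Tendsto (fun t : ℝ => m * t) atTop atTop := tendsto_id.const_mul_atTop hm
  have hsd : Tendsto (fun t : ℝ => shiftHalf t / t) atTop (𝓝 1) := by
    have : Tendsto (fun t : ℝ => 1 - (1 / 2) / t) atTop (𝓝 (1 - 0)) :=
      tendsto_const_nhds.sub (tendsto_const_nhds.div_atTop tendsto_id)
    rw [sub_zero] at this
    refine this.congr' ?_
    filter_upwards [eventually_gt_atTop 0] with t ht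
    rw [shiftHalf]; field_simp
  have hAr : Tendsto (fun t => A (m * shiftHalf t) / A (m * t)) atTop (𝓝 1) := by
    have := (h.auxiliary_ratio hρ hA 1 one_pos).comp (hmt.prodMk hsd)
    simp only [Real.one_rpow] at this
    refine this.congr' ?_
    filter_upwards [eventually_gt_atTop 0] with t ht
    simp only [Function.comp_apply]
    rw [mul_assoc, mul_div_cancel₀ _ ht.ne']
  set y : ℝ → ℝ → ℝ := fun t x => shiftHalf (t * x) / shiftHalf t with hy
  set z : ℝ → ℝ → ℝ := fun t x => (1 - 1 / x) / (2 * t - 1) with hz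
  have hyz : ∀ t x : ℝ, 1 ≤ t → 0 < x → y t x = x * (1 + z t x) := by
    intro t x ht hx
    obtain ⟨d, rfl⟩ : ∃ d, t = (d + 1) / 2 := ⟨2 * t - 1, by ring⟩
    have hd : d ≠ 0 := by rintro rfl; norm_num at ht
    have e1 : 2 * ((d + 1) / 2) - 1 = d := by ring
    have e2 : (d + 1) / 2 - 1 / 2 = d / 2 := by ring
    simp only [hy, hz, shiftHalf, e1, e2]
    field_simp
    ring
  have hz0 : ∀ x, 0 < x → Tendsto (fun p : ℝ × ℝ => z p.1 p.2) (atTop ×ˢ 𝓝 x) (𝓝 0) ∧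
      Tendsto (fun p : ℝ × ℝ => z p.1 p.2 / (1 / (2 * p.1))) (atTop ×ˢ 𝓝 x)
        (𝓝 (boxCox (-1) x)) := by
    intro x hx
    have h1 : Tendsto (fun p : ℝ × ℝ => 1 - 1 / p.2) (atTop ×ˢ 𝓝 x) (𝓝 (1 - 1 / x)) :=
      tendsto_const_nhds.sub (tendsto_const_nhds.div tendsto_snd hx.ne')
    have h2 : Tendsto (fun t : ℝ => 2 * t - 1) atTop atTop := by
      simpa [sub_eq_add_neg] using
        tendsto_atTop_add_const_right atTop (-1 : ℝ) (tendsto_id.const_mul_atTop two_pos)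
    have h3 : Tendsto (fun t : ℝ => 2 * t / (2 * t - 1)) atTop (𝓝 1) := by
      have : Tendsto (fun t : ℝ => 1 + 1 / (2 * t - 1)) atTop (𝓝 (1 + 0)) :=
        tendsto_const_nhds.add (tendsto_const_nhds.div_atTop h2)
      rw [add_zero] at this
      refine this.congr' ?_
      filter_upwards [h2.eventually_gt_atTop 0] with t ht
      field_simp; ring
    refine ⟨h1.div_atTop (h2.comp tendsto_fst), ?_⟩
    have h4 := h1.mul (h3.comp tendsto_fst)
    rw [mul_one, ← boxCox_neg_one] at h4
    refine h4.congr fun p => ?_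
    simp only [hz, Function.comp_apply, one_div, div_inv_eq_mul]
    ring
  -- `P` is the relation for `f` at the shifted point, rescaled to `A (m t)`. `Q` carries the first
  -- order effect `γ log (1 + z)` of the shift in units of `1 / (2 t)`, whose coefficient `γ / (2
  -- t)` equals `(m γ / 2) / (m t)`.
  refine ⟨fun t x => A (m * shiftHalf t) / A (m * t) *
      ((f (m * shiftHalf t * y t x) - f (m * shiftHalf t) - γ * Real.log (y t x)) /
        A (m * shiftHalf t)), fun t x => Real.log (1 + z t x) / (1 / (2 * t)), ?_, ?_, ?_⟩
  · intro x hx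
    have hyx : Tendsto (fun p : ℝ × ℝ => y p.1 p.2) (atTop ×ˢ 𝓝 x) (𝓝 x) := by
      have h1 : Tendsto (fun p : ℝ × ℝ => p.2 * (1 + z p.1 p.2)) (atTop ×ˢ 𝓝 x)
          (𝓝 (x * (1 + 0))) := tendsto_snd.mul ((hz0 x hx).1.const_add 1)
      rw [add_zero, mul_one] at h1
      refine h1.congr' ?_
      filter_upwards [eventually_snd_pos hx, tendsto_fst.eventually (eventually_ge_atTop 1)]
        with p h2 h3
      exact (hyz _ _ h3 h2).symm
    have h2 := (hAr.comp tendsto_fst).mul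
      ((h x hx).comp ((hshift.comp tendsto_fst).prodMk hyx))
    rw [one_mul] at h2
    exact h2
  · intro x hx
    exact tendsto_log_one_add_div (hz0 x hx).1 (hz0 x hx).2
  · filter_upwards [hmt.eventually hA, hshift.eventually hA, eventually_ge_atTop 1]
      with t h1 h2 h3 x htx hx
    have hs0 : 0 < shiftHalf t := by rw [shiftHalf]; linarith
    have hsx : 0 < shiftHalf (t * x) := by rw [shiftHalf]; linarith
    have hy0 : 0 < y t x := by simp only [hy]; positivity
    have hpos : 0 < 1 + z t x := by
      have := hyz t x h3 hx
      rw [this] at hy0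
      exact pos_of_mul_pos_right hy0 hx.le
    have e1 : m * shiftHalf t * y t x = m * shiftHalf (t * x) := by
      simp only [hy]; field_simp
    have e2 : Real.log (y t x) = Real.log x + Real.log (1 + z t x) := by
      rw [hyz t x h3 hx, Real.log_mul hx.ne' hpos.ne']
    rw [e1, e2]
    field_simp
    ring

/-- The shifted second order relation, given its combination of the two error terms. -/
lemma shiftedSecondOrder_of_combination {V A A' : ℝ → ℝ} {γ ρ ρ' : ℝ} {m : ℕ} (hm : 1 ≤ m)
    (hA' : UltimatelyConstantSign A') (hA'0 : Tendsto A' atTop (𝓝 0)) (hρ : ρ ≤ 0)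
    (hA : ∀ᶠ t in atTop, A t ≠ 0)
    (h : LocUnif (fun t x =>
      (Real.log (V (t * x)) - Real.log (V t) - γ * Real.log x) / A t) (boxCox ρ))
    (hcomb : ∀ x, 0 < x → ∀ P Q : ℝ × ℝ → ℝ,
      Tendsto P (atTop ×ˢ 𝓝 x) (𝓝 (boxCox ρ x)) → Tendsto Q (atTop ×ˢ 𝓝 x) (𝓝 (boxCox (-1) x)) →
      Tendsto (fun p : ℝ × ℝ => (A (m * p.1) * P p + m * γ / 2 / (m * p.1) * Q p) / A' (m * p.1))
        (atTop ×ˢ 𝓝 x) (𝓝 (boxCox ρ' x))) :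
    ShiftedSecondOrder V γ ρ' m A' where
  const_sign := hA'
  tendsto_zero := hA'0
  second_order := by
    rw [locUnif_iff fun x hx => continuousAt_boxCox ρ' hx]
    have hm0 : (0 : ℝ) < m := by exact_mod_cast hm
    obtain ⟨P, Q, hP, hQ, hPQ⟩ := LocUnif.shift (f := fun t => Real.log (V t)) hρ hA h hm0
    intro x hx
    refine (hcomb x hx _ _ (hP x hx) (hQ x hx)).congr' ?_
    filter_upwards [tendsto_fst.eventually hPQ, eventually_snd_pos hx,
      (tendsto_fst_mul_snd_atTop hx).eventually_ge_atTop 1] with p h1 h2 h3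
    rw [← h1 p.2 h3 h2]

lemma ShiftedSecondOrder.locUnif {V A' : ℝ → ℝ} {γ ρ : ℝ} {m : ℕ}
    (h : ShiftedSecondOrder V γ ρ m A') :
    LocUnif (fun t x => (Real.log (V (m * shiftHalf (t * x))) - Real.log (V (m * shiftHalf t))
        - γ * Real.log x) / A' (m * t)) (boxCox ρ) :=
  (locUnif_iff fun _ hx => continuousAt_boxCox ρ hx).1 h.second_order

lemma ShiftedSecondOrder.eventually_ne {V A' : ℝ → ℝ} {γ ρ : ℝ} {m : ℕ} (hm : 1 ≤ m)
    (h : ShiftedSecondOrder V γ ρ m A') : ∀ᶠ t : ℝ in atTop, A' (m * t) ≠ 0 :=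
  (tendsto_id.const_mul_atTop (by exact_mod_cast hm : (0 : ℝ) < m)).eventually
    h.const_sign.eventually_ne

lemma ShiftedSecondOrder.regVar {V A' : ℝ → ℝ} {γ ρ : ℝ} {m : ℕ} (hm : 1 ≤ m) (hρ : ρ ≤ 0)
    (h : ShiftedSecondOrder V γ ρ m A') : RegVar (fun t => |A' t|) ρ := by
  intro x hx
  have hm0 : (0 : ℝ) < m := by exact_mod_cast hm
  have h1 := (LocUnif.auxiliary_ratio (W := fun t => Real.log (V (m * shiftHalf t)))
    (a := fun t => A' (m * t)) hρ (h.eventually_ne hm) h.locUnif).tendsto_at hx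
  have h2 := (h1.comp (tendsto_id.atTop_div_const hm0)).abs
  rw [abs_of_pos (by positivity)] at h2
  refine h2.congr fun t => ?_
  simp only [Function.comp_apply, id, abs_div]
  rw [mul_div_cancel₀ _ hm0.ne', ← mul_assoc, mul_div_cancel₀ _ hm0.ne']

lemma LocUnif.id_mul_abs {A : ℝ → ℝ} {ρ : ℝ} (hA : ∀ᶠ t in atTop, A t ≠ 0)
    (h : LocUnif (fun t x => A (t * x) / A t) (fun x => x ^ ρ)) :
    LocUnif (fun t x => (t * x * |A (t * x)|) / (t * |A t|)) (fun x => x ^ (1 + ρ)) := by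
  intro x hx
  have h1 := (tendsto_snd (f := atTop (α := ℝ)) (g := 𝓝 x)).mul (h x hx).abs
  have e : x * |x ^ ρ| = x ^ (1 + ρ) := by
    rw [Real.rpow_add hx, Real.rpow_one, abs_of_pos (by positivity)]
  rw [e] at h1
  refine h1.congr' ?_
  filter_upwards [tendsto_fst.eventually (eventually_gt_atTop 0), tendsto_fst.eventually hA]
    with p h2 h3
  have := abs_pos.2 h3
  rw [abs_div]
  field_simp

lemma LocUnif.id_mul_abs_tendsto_atTop {A : ℝ → ℝ} {ρ : ℝ} (hρ : -1 < ρ)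
    (hA : ∀ᶠ t in atTop, A t ≠ 0)
    (h : LocUnif (fun t x => A (t * x) / A t) (fun x => x ^ ρ)) :
    Tendsto (fun t => t * |A t|) atTop atTop := by
  refine tendsto_atTop_of_regVar (α := 1 + ρ) (by linarith) ?_ (h.id_mul_abs hA)
  filter_upwards [hA, eventually_gt_atTop 0] with t h1 h2
  have := abs_pos.2 h1
  positivity

lemma LocUnif.id_mul_tendsto_zero {A : ℝ → ℝ} {ρ : ℝ} (hρ : ρ < -1)
    (hA : ∀ᶠ t in atTop, A t ≠ 0)
    (h : LocUnif (fun t x => A (t * x) / A t) (fun x => x ^ ρ)) :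
    Tendsto (fun t => t * A t) atTop (𝓝 0) := by
  -- The reciprocal has the positive index `-(1 + ρ)`.
  have h1 : Tendsto (fun t => (t * |A t|)⁻¹) atTop atTop := by
    refine tendsto_atTop_of_regVar (α := -(1 + ρ)) (by linarith) ?_ ?_
    · filter_upwards [hA, eventually_gt_atTop 0] with t h1 h2
      have := abs_pos.2 h1
      positivity
    · intro x hx
      have h2 := (h.id_mul_abs hA x hx).inv₀ (by positivity)
      simp only [Real.rpow_neg hx.le]
      refine h2.congr fun p => ?_
      rw [inv_div, inv_div_inv]
  have h2 := h1.inv_tendsto_atTop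
  refine (tendsto_zero_iff_abs_tendsto_zero _).2 (h2.congr' ?_)
  filter_upwards [eventually_gt_atTop 0] with t ht
  simp [abs_mul, abs_of_pos ht]

/-- A slowly varying perturbation that stays away from zero has ultimately constant sign. -/
lemma ultimatelyConstantSign_add_div {A : ℝ → ℝ} {c c₀ : ℝ} (hc : 0 < c) (hc₀ : 0 < c₀)
    (hA : UltimatelyConstantSign A)
    (h : LocUnif (fun t x => A (t * x) / A t) (fun x => x ^ (-1 : ℝ)))
    (hlow : ∀ᶠ t in atTop, c ≤ |t * A t + c₀|) :
    UltimatelyConstantSign fun t => A t + c₀ / t := by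
  have hred : UltimatelyConstantSign (fun t => t * A t + c₀) →
      UltimatelyConstantSign fun t => A t + c₀ / t := by
    have e : ∀ t : ℝ, 0 < t → A t + c₀ / t = (t * A t + c₀) / t := fun t ht => by
      field_simp
    refine Or.imp (fun h1 => ?_) (fun h1 => ?_)
    · filter_upwards [h1, eventually_gt_atTop 0] with t h2 h3
      rw [e t h3]; positivity
    · filter_upwards [h1, eventually_gt_atTop 0] with t h2 h3
      rw [e t h3]; exact div_neg_of_neg_of_pos h2 h3
  refine hred ?_
  have hsv : LocUnif (fun t x => (t * x * A (t * x)) / (t * A t)) (fun _ => 1) := by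
    intro x hx
    have h1 := (tendsto_snd (f := atTop (α := ℝ)) (g := 𝓝 x)).mul (h x hx)
    simp only [Real.rpow_neg_one, mul_inv_cancel₀ hx.ne'] at h1
    refine h1.congr' ?_
    filter_upwards [tendsto_fst.eventually (eventually_gt_atTop 0)] with p h2
    rw [mul_assoc, mul_div_mul_left _ _ h2.ne', mul_div_assoc]
  rcases hA with hA | hA
  · left
    filter_upwards [hA, eventually_gt_atTop 0] with t h1 h2
    positivity
  obtain ⟨t₀, ht₀⟩ := eventually_atTop.1 (((hA.and (eventually_gt_atTop 0)).and hlow).and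
    (hsv.eventually_Icc (fun _ _ => continuousAt_const) (b := 1) (c := 2) one_pos
      (div_pos hc hc₀)))
  have hneg : ∀ t, t₀ ≤ t → t * A t < 0 := fun t ht =>
    mul_neg_of_pos_of_neg (ht₀ t ht).1.1.2 (ht₀ t ht).1.1.1
  by_cases hex : ∃ t₁, t₀ ≤ t₁ ∧ c ≤ t₁ * A t₁ + c₀
  · obtain ⟨t₁, ht₁, hct₁⟩ := hex
    -- When the sum is at least `c`, the negative number `t A t` is smaller than `c₀` in modulus.
    -- Within a factor 2 it moves by a relative amount below `c / c₀`, so it decreases by less than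
    -- `c`. The sum stays positive, and being bounded away from 0 it is again at least `c`.
    have hstep : ∀ t, t₀ ≤ t → c ≤ t * A t + c₀ → ∀ x, 1 ≤ x → x ≤ 2 →
        c ≤ t * x * A (t * x) + c₀ := by
      intro t ht hct x h1 h2
      have h3 := (ht₀ t ht).2 x ⟨h1, h2⟩
      have ht0 := (ht₀ t ht).1.1.2
      have h4 := (ht₀ (t * x) (by nlinarith)).1.2
      have h5 := hneg t ht
      have h6 : t * x * A (t * x) / (t * A t) < 1 + c / c₀ := by linarith [(abs_lt.1 h3).2]
      rw [div_lt_iff_of_neg h5] at h6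
      have h7 : -c < c / c₀ * (t * A t) := by
        have : c / c₀ * (-c₀) < c / c₀ * (t * A t) :=
          mul_lt_mul_of_pos_left (by linarith) (by positivity)
        have e : c / c₀ * (-c₀) = -c := by field_simp
        linarith
      rcases le_abs'.1 h4 with h8 | h8
      · linarith
      · exact h8
    have hall : ∀ n : ℕ, ∀ x, 1 ≤ x → x ≤ 2 ^ n → c ≤ t₁ * x * A (t₁ * x) + c₀ := by
      intro n
      induction n with
      | zero =>
        intro x h1 h2
        obtain rfl : x = 1 := le_antisymm (by simpa using h2) h1
        simpa using hct₁
      | succ n ih =>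
        intro x h1 h2
        rcases le_total x 2 with h3 | h3
        · exact hstep t₁ ht₁ hct₁ x h1 h3
        · have h4 := ih (x / 2) (by linarith) (by rw [pow_succ] at h2; linarith)
          have ht0 := (ht₀ t₁ ht₁).1.1.2
          have h5 := hstep (t₁ * (x / 2)) (by nlinarith) h4 2 one_le_two le_rfl
          rwa [show t₁ * (x / 2) * 2 = t₁ * x by ring] at h5
    left
    filter_upwards [eventually_ge_atTop t₁] with t ht
    have ht0 := (ht₀ t₁ ht₁).1.1.2
    have h1 : 1 ≤ t / t₁ := by rwa [one_le_div ht0]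
    obtain ⟨n, -, hn⟩ := exists_nat_pow_near h1 one_lt_two
    have h2 := hall (n + 1) (t / t₁) h1 hn.le
    rw [mul_div_cancel₀ _ ht0.ne'] at h2
    linarith
  · push Not at hex
    right
    filter_upwards [eventually_ge_atTop t₀] with t ht
    rcases le_abs'.1 (ht₀ t ht).1.2 with h8 | h8
    · linarith
    · linarith [hex t ht]

/-- Existence of the second order relation for `t ↦ log V (m (t - 1 / 2))`. -/
lemma ConditionA2.exists_shiftedSecondOrder {V A : ℝ → ℝ} {γ ρ : ℝ} (hγ : 0 < γ) (hρ : ρ ≤ 0)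
    (hA2 : ConditionA2 V γ ρ A) (hVm : MonotoneOn V (Set.Ioi 0)) (hVpos : ∀ᶠ t in atTop, 0 < V t)
    {m : ℕ} (hm : 1 ≤ m)
    (hlow : ρ = -1 → ∃ c : ℝ, 0 < c ∧ ∀ᶠ t in atTop, c ≤ |t * A t + m * γ / 2|) :
    ∃ A' : ℝ → ℝ, ShiftedSecondOrder V γ (max ρ (-1)) m A' := by
  have hA := hA2.const_sign.eventually_ne
  have hL := hA2.log_locUnif hρ hVm hVpos
  have hr := hL.auxiliary_ratio (W := fun t => Real.log (V t)) hρ hA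
  have hm0 : (0 : ℝ) < m := by exact_mod_cast hm
  have hmt : ∀ x : ℝ, Tendsto (fun p : ℝ × ℝ => (m : ℝ) * p.1) (atTop ×ˢ 𝓝 x) atTop := fun x =>
    (tendsto_id.const_mul_atTop hm0).comp tendsto_fst
  obtain ⟨c₀, hc₀⟩ : ∃ c₀ : ℝ, c₀ = m * γ / 2 := ⟨_, rfl⟩
  have hc₀0 : 0 < c₀ := by rw [hc₀]; positivity
  have hdiv : Tendsto (fun t : ℝ => c₀ / t) atTop (𝓝 0) := tendsto_const_nhds.div_atTop tendsto_id
  -- The product `t A t` tends to 0 for `ρ < -1` and to infinity in modulus for `ρ > -1`, which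
  -- decides which of `A t` and `c₀ / t` dominates.
  rcases lt_trichotomy ρ (-1) with h | h | h
  · rw [max_eq_right h.le]
    refine ⟨fun t => c₀ / t, shiftedSecondOrder_of_combination hm (Or.inl ?_) hdiv hρ hA hL ?_⟩
    · filter_upwards [eventually_gt_atTop 0] with t ht
      positivity
    · intro x hx P Q hP hQ
      have h1 := ((((hr.id_mul_tendsto_zero h hA).comp (hmt x)).div_const c₀).mul hP).add hQ
      rw [zero_div, zero_mul, zero_add] at h1
      refine h1.congr' ?_
      filter_upwards [(hmt x).eventually_gt_atTop 0] with p hp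
      rw [← hc₀]
      simp only [Function.comp_apply]
      generalize (m : ℝ) * p.1 = τ at *
      field_simp
  · subst h
    rw [max_self]
    obtain ⟨c, hc, hcA⟩ := hlow rfl
    rw [← hc₀] at hcA
    have hcs := ultimatelyConstantSign_add_div hc hc₀0 hA2.const_sign hr hcA
    refine ⟨fun t => A t + c₀ / t, shiftedSecondOrder_of_combination hm hcs ?_ hρ hA hL ?_⟩
    · simpa using hA2.tendsto_zero.add hdiv
    · intro x hx P Q hP hQ
      have hP0 := hP.sub_const (boxCox (-1) x)
      have hQ0 := hQ.sub_const (boxCox (-1) x)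
      rw [sub_self] at hP0 hQ0
      -- both weights are bounded
      have hb : Tendsto (fun p : ℝ × ℝ => (1 + c₀ / c) * |P p - boxCox (-1) x| +
          c₀ / c * |Q p - boxCox (-1) x|) (atTop ×ˢ 𝓝 x) (𝓝 0) := by
        simpa using (hP0.abs.const_mul (1 + c₀ / c)).add (hQ0.abs.const_mul (c₀ / c))
      rw [tendsto_iff_norm_sub_tendsto_zero]
      refine squeeze_zero' (Eventually.of_forall fun _ => norm_nonneg _) ?_ hb
      filter_upwards [(hmt x).eventually hcA, (hmt x).eventually_gt_atTop 0] with p h1 h2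
      rw [← hc₀]
      generalize (m : ℝ) * p.1 = τ at *
      have e0 : A τ + c₀ / τ = (τ * A τ + c₀) / τ := by field_simp
      have hd0 : 0 < |τ * A τ + c₀| := hc.trans_le h1
      have hd : τ * A τ + c₀ ≠ 0 := abs_pos.1 hd0
      -- The weights sum to 1 and `P` and `Q` have the same limit. The first weight may be negative,
      -- so boundedness is needed rather than convexity.
      have e : (A τ * P p + c₀ / τ * Q p) / (A τ + c₀ / τ) - boxCox (-1) x =
          (1 - c₀ / (τ * A τ + c₀)) * (P p - boxCox (-1) x) +
          c₀ / (τ * A τ + c₀) * (Q p - boxCox (-1) x) := by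
        rw [e0]
        obtain ⟨d, hdd⟩ : ∃ d, d = τ * A τ + c₀ := ⟨_, rfl⟩
        have hAτ : A τ = (d - c₀) / τ := by rw [hdd]; field_simp; ring
        rw [← hdd] at hd ⊢
        rw [hAτ]; field_simp; ring
      have hw : |c₀ / (τ * A τ + c₀)| ≤ c₀ / c := by
        rw [abs_div, abs_of_pos hc₀0]
        exact div_le_div_of_nonneg_left hc₀0.le hc h1
      have hw' : |1 - c₀ / (τ * A τ + c₀)| ≤ 1 + c₀ / c := by
        refine (abs_sub _ _).trans ?_
        rw [abs_one]; linarith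
      rw [e, Real.norm_eq_abs]
      refine (abs_add_le _ _).trans ?_
      rw [abs_mul, abs_mul]
      gcongr
  · rw [max_eq_left h.le]
    refine ⟨A, shiftedSecondOrder_of_combination hm hA2.const_sign hA2.tendsto_zero hρ hA hL ?_⟩
    intro x hx P Q hP hQ
    have h0 : Tendsto (fun t => c₀ / (t * A t)) atTop (𝓝 0) := by
      have := (tendsto_const_nhds (x := c₀)).div_atTop (hr.id_mul_abs_tendsto_atTop h hA)
      refine (tendsto_zero_iff_abs_tendsto_zero _).2 (this.congr' ?_)
      filter_upwards [eventually_gt_atTop 0] with t ht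
      simp [abs_div, abs_mul, abs_of_pos ht, abs_of_pos hc₀0]
    have h1 := hP.add ((h0.comp (hmt x)).mul hQ)
    rw [zero_mul, add_zero] at h1
    refine h1.congr' ?_
    filter_upwards [(hmt x).eventually_gt_atTop 0, (hmt x).eventually hA] with p hp hp2
    rw [← hc₀]
    simp only [Function.comp_apply]
    field_simp

/-! ### Generalised inverses of distribution functions -/

lemma cdf_nonempty_bddBelow {ν : Measure ℝ} [IsProbabilityMeasure ν] {u : ℝ} (h0 : 0 < u)
    (h1 : u < 1) : {x | u ≤ cdf ν x}.Nonempty ∧ BddBelow {x | u ≤ cdf ν x} := by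
  constructor
  · obtain ⟨x, hx⟩ := ((tendsto_cdf_atTop ν).eventually (lt_mem_nhds h1)).exists
    exact ⟨x, hx.le⟩
  · obtain ⟨x, hx⟩ := ((tendsto_cdf_atBot ν).eventually (gt_mem_nhds h0)).exists
    refine ⟨x, fun y hy => ?_⟩
    by_contra! hlt
    exact absurd (monotone_cdf ν hlt.le) (not_le.2 (hx.trans_le hy))

/-- The Galois connection between a distribution function and its generalised inverse. -/
lemma genInv_cdf_le_iff {ν : Measure ℝ} [IsProbabilityMeasure ν] {u : ℝ} (h0 : 0 < u)
    (h1 : u < 1) (x : ℝ) : genInv (cdf ν) u ≤ x ↔ u ≤ cdf ν x := by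
  obtain ⟨hne, hbd⟩ := cdf_nonempty_bddBelow (ν := ν) h0 h1
  constructor
  · intro h
    have hright : Tendsto (cdf ν) (𝓝[>] x) (𝓝 (cdf ν x)) :=
      ((cdf ν).right_continuous x).tendsto.mono_left (nhdsWithin_mono _ Set.Ioi_subset_Ici_self)
    refine ge_of_tendsto hright ?_
    filter_upwards [self_mem_nhdsWithin] with y hy
    obtain ⟨z, hz, hzy⟩ := exists_lt_of_csInf_lt hne (lt_of_le_of_lt h hy)
    exact le_trans hz (monotone_cdf ν hzy.le)
  · exact fun h => csInf_le hbd h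

lemma exp_neg_one_div_mem {t : ℝ} (ht : 0 < t) :
    0 < Real.exp (-1 / t) ∧ Real.exp (-1 / t) < 1 :=
  ⟨Real.exp_pos _, Real.exp_lt_one_iff.2 (div_neg_of_neg_of_pos (by norm_num) ht)⟩

lemma monotoneOn_quantileV (ν : Measure ℝ) [IsProbabilityMeasure ν] :
    MonotoneOn (quantileV (cdf ν)) (Set.Ioi 0) := by
  intro s hs t ht hst
  have hs' := exp_neg_one_div_mem hs
  have ht' := exp_neg_one_div_mem ht
  refine csInf_le_csInf (cdf_nonempty_bddBelow hs'.1 hs'.2).2 (cdf_nonempty_bddBelow ht'.1 ht'.2).1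
    fun x hx => ?_
  refine le_trans (Real.exp_le_exp.2 ?_) hx
  rw [neg_div, neg_div]
  exact neg_le_neg (one_div_le_one_div_of_le hs hst)

/-! ### Conditioning uniform variables on an order statistic -/

/-- The `i`-th entry of `U` exceeds exactly the entries with smaller index. -/
def IsPivot {n : ℕ} {α : Type*} [LinearOrder α] (U : Fin n → α) (i : Fin n) : Prop :=
  (∀ j, j < i → U j < U i) ∧ ∀ j, i < j → U i < U j

lemma isPivot_comp_strictMono {n : ℕ} {α β : Type*} [LinearOrder α] [LinearOrder β] {g : α → β}
    (hg : StrictMono g) (U : Fin n → α) (i : Fin n) :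
    IsPivot (fun j => g (U j)) i ↔ IsPivot U i := by
  simp [IsPivot, hg.lt_iff_lt]

lemma strictMono_comp_sort {n : ℕ} {α : Type*} [LinearOrder α] {U : Fin n → α}
    (hU : Function.Injective U) : StrictMono (U ∘ Tuple.sort U) :=
  (Tuple.monotone_sort U).strictMono_of_injective (hU.comp (Tuple.sort U).injective)

open Classical in
/-- The number of rearrangements of a vector without ties that have a pivot at `i` does not
depend on the vector. -/
lemma card_isPivot_perm {n : ℕ} {α : Type*} [LinearOrder α] {U : Fin n → α}
    (hU : Function.Injective U) (i : Fin n) :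
    (Finset.univ.filter fun σ : Equiv.Perm (Fin n) => IsPivot (U ∘ σ) i).card =
      (Finset.univ.filter fun σ : Equiv.Perm (Fin n) => IsPivot σ i).card := by
  -- `U ∘ σ` is the strictly increasing vector `U ∘ sort U` composed with `(sort U)⁻¹ * σ`, and
  -- strictly increasing maps preserve pivots.
  refine Finset.card_equiv (Equiv.mulLeft (Tuple.sort U)⁻¹) fun σ => ?_
  simp only [Finset.mem_filter, Finset.mem_univ, true_and, Equiv.coe_mulLeft]
  rw [← isPivot_comp_strictMono (strictMono_comp_sort hU)]
  simp [Function.comp_def]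

/-- The uniform distribution on the unit interval. -/
def unif : Measure ℝ := volume.restrict (Set.Ioo 0 1)

instance : IsProbabilityMeasure unif := ⟨by simp [unif]⟩

lemma ae_unif_mem : ∀ᵐ x ∂unif, x ∈ Set.Ioo (0 : ℝ) 1 := ae_restrict_mem measurableSet_Ioo

/-- The uniform distribution on the unit cube. -/
def unifPi (n : ℕ) : Measure (Fin n → ℝ) := Measure.pi fun _ => unif

instance (n : ℕ) : IsProbabilityMeasure (unifPi n) := by unfold unifPi; infer_instance

lemma ae_unifPi_mem (n : ℕ) : ∀ᵐ U ∂unifPi n, ∀ i, U i ∈ Set.Ioo (0 : ℝ) 1 :=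
  ae_all_iff.2 fun i => (Measure.quasiMeasurePreserving_eval (fun _ => unif) i).ae ae_unif_mem

/-- Ties lie in finitely many hyperplanes, which are Lebesgue null. -/
lemma ae_unifPi_injective (n : ℕ) : ∀ᵐ U ∂unifPi n, Function.Injective U := by
  have hne : ∀ i j : Fin n, i ≠ j → ∀ᵐ U ∂unifPi n, U i ≠ U j := by
    intro i j hij
    have e : unifPi n = volume.restrict (Set.pi Set.univ fun _ : Fin n => Set.Ioo (0 : ℝ) 1) := by
      rw [unifPi, volume_pi, Measure.restrict_pi_pi]; rfl
    rw [e]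
    refine ae_restrict_of_ae ?_
    set S : Submodule ℝ (Fin n → ℝ) :=
      LinearMap.ker (LinearMap.proj (R := ℝ) (φ := fun _ : Fin n => ℝ) i - LinearMap.proj j)
    have hS : S ≠ ⊤ := by
      intro h
      have : Pi.single i (1 : ℝ) ∈ S := by rw [h]; trivial
      simp [S, LinearMap.mem_ker, hij.symm] at this
    have h0 := Measure.addHaar_submodule (volume : Measure (Fin n → ℝ)) S hS
    rw [ae_iff]
    refine measure_mono_null (fun U hU => ?_) h0
    simp only [ne_eq, not_not, Set.mem_ofPred_eq] at hU
    simp [S, LinearMap.mem_ker, hU]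
  have h : ∀ᵐ U ∂unifPi n, ∀ i j : Fin n, i ≠ j → U i ≠ U j :=
    ae_all_iff.2 fun i => ae_all_iff.2 fun j => by
      by_cases hij : i = j
      · simp [hij]
      · filter_upwards [hne i j hij] with U hU _ using hU
  filter_upwards [h] with U hU i j hij
  by_contra hne
  exact hU i j hne hij

lemma measurableSet_isPivot {n : ℕ} (i : Fin n) : MeasurableSet {U : Fin n → ℝ | IsPivot U i} := by
  have e : {U : Fin n → ℝ | IsPivot U i} =
      (⋂ j, ⋂ _ : j < i, {U | U j < U i}) ∩ ⋂ j, ⋂ _ : i < j, {U | U i < U j} := by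
    ext U; simp [IsPivot]
  rw [e]
  exact (MeasurableSet.iInter fun j => MeasurableSet.iInter fun _ =>
    measurableSet_lt (measurable_pi_apply j) (measurable_pi_apply i)).inter
    (MeasurableSet.iInter fun j => MeasurableSet.iInter fun _ =>
      measurableSet_lt (measurable_pi_apply i) (measurable_pi_apply j))

/-- The integral of a symmetric function may be restricted to the vectors with a pivot at `i`. -/
lemma exists_lintegral_symm_eq {n : ℕ} (i : Fin n) : ∃ C : ℝ≥0∞, C ≠ ∞ ∧
    ∀ h : (Fin n → ℝ) → ℝ≥0∞, Measurable h → (∀ U (σ : Equiv.Perm (Fin n)), h (U ∘ σ) = h U) →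
      ∫⁻ U, h U ∂unifPi n = C * ∫⁻ U in {U | IsPivot U i}, h U ∂unifPi n := by
  classical
  set c := (Finset.univ.filter fun σ : Equiv.Perm (Fin n) => IsPivot σ i).card with hc
  have hc0 : c ≠ 0 := by
    exact (Finset.card_pos.2 ⟨1, Finset.mem_filter.2 ⟨Finset.mem_univ _, fun _ hj => hj,
      fun _ hj => hj⟩⟩).ne'
  have hc0' : (c : ℝ≥0∞) ≠ 0 := by exact_mod_cast hc0
  refine ⟨(c : ℝ≥0∞)⁻¹ * Fintype.card (Equiv.Perm (Fin n)),
    ENNReal.mul_ne_top (ENNReal.inv_ne_top.2 hc0') (ENNReal.natCast_ne_top _),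
    fun h hm hsym => ?_⟩
  set B := {U : Fin n → ℝ | IsPivot U i} with hB
  have hBm : MeasurableSet B := measurableSet_isPivot i
  have hmp : ∀ σ : Equiv.Perm (Fin n), MeasurePreserving (fun U : Fin n → ℝ => U ∘ σ)
      (unifPi n) (unifPi n) := by
    intro σ
    have := measurePreserving_piCongrLeft (α := fun _ : Fin n => ℝ) (fun _ => unif) σ.symm
    have e : (fun U : Fin n → ℝ => U ∘ σ) =
        MeasurableEquiv.piCongrLeft (fun _ : Fin n => ℝ) σ.symm := by
      funext U j
      have := Equiv.piCongrLeft_apply (P := fun _ : Fin n => ℝ) (e := σ.symm) U j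
      simpa [MeasurableEquiv.coe_piCongrLeft] using this.symm
    rw [e]
    exact this
  -- Almost surely exactly `c` of the rearrangements of `U` have their pivot at `i`. By symmetry of
  -- `h` and invariance of the measure, every rearrangement contributes the same integral, whence `C
  -- = n! / c`.
  have hsum : ∫⁻ U, h U * c ∂unifPi n =
      ∑ σ : Equiv.Perm (Fin n), ∫⁻ U, h U * B.indicator 1 (U ∘ σ) ∂unifPi n := by
    rw [← lintegral_finsetSum]
    · refine lintegral_congr_ae ?_
      filter_upwards [ae_unifPi_injective n] with U hU
      rw [← Finset.mul_sum, hc, ← card_isPivot_perm hU i]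
      congr 1
      rw [Finset.card_filter]
      push_cast
      exact Finset.sum_congr rfl fun σ _ => by simp [Set.indicator, hB]
    · intro σ _
      exact hm.mul ((measurable_one.indicator hBm).comp (hmp σ).measurable)
  have hterm : ∀ σ : Equiv.Perm (Fin n), ∫⁻ U, h U * B.indicator 1 (U ∘ σ) ∂unifPi n =
      ∫⁻ U in B, h U ∂unifPi n := by
    intro σ
    have h1 := (hmp σ).lintegral_comp (hm.mul (measurable_one.indicator hBm))
    simp only [Pi.mul_apply, hsym] at h1
    rw [h1, ← lintegral_indicator hBm]
    refine lintegral_congr fun U => ?_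
    by_cases hU : U ∈ B <;> simp [hU]
  simp_rw [hterm] at hsum
  rw [lintegral_mul_const _ hm, Finset.sum_const, Finset.card_univ, nsmul_eq_mul] at hsum
  rw [mul_assoc, ← hsum, mul_comm, mul_assoc, ENNReal.mul_inv_cancel hc0'
    (ENNReal.natCast_ne_top _), mul_one]

lemma unif_restrict_eq_map_affine {a b : ℝ} (ha : 0 < a) {I : Set ℝ} (hI : MeasurableSet I)
    (hab : Set.Ioo 0 1 ∩ I = Set.Ioo b (b + a)) :
    unif.restrict I = ENNReal.ofReal a • unif.map fun u => b + a * u := by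
  have hm : Measurable fun u : ℝ => b + a * u := by fun_prop
  ext s hs
  rw [Measure.restrict_apply hs, unif, Measure.restrict_apply (hs.inter hI), Measure.smul_apply,
    Measure.map_apply hm hs, Measure.restrict_apply (hm hs), smul_eq_mul]
  have e1 : s ∩ I ∩ Set.Ioo 0 1 = s ∩ Set.Ioo b (b + a) := by
    rw [← hab, Set.inter_assoc, Set.inter_comm I]
  have e2 : (fun u : ℝ => b + a * u) ⁻¹' s ∩ Set.Ioo 0 1 =
      (fun u => a * u) ⁻¹' ((fun u => b + u) ⁻¹' (s ∩ Set.Ioo b (b + a))) := by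
    ext u
    simp only [Set.mem_inter_iff, Set.mem_preimage, Set.mem_Ioo]
    refine and_congr_right fun _ => and_congr ?_ ?_
    · rw [lt_add_iff_pos_right, mul_pos_iff_of_pos_left ha]
    · rw [add_lt_add_iff_left, mul_lt_iff_lt_one_right ha]
  rw [e1, e2, Real.volume_preimage_mul_left ha.ne', measure_preimage_add, ← mul_assoc,
    ← ENNReal.ofReal_mul ha.le, abs_of_pos (inv_pos.2 ha), mul_inv_cancel₀ ha.ne',
    ENNReal.ofReal_one, one_mul]

/-- The affine maps carrying the unit interval onto `(0, t)` for `j < k₀` and onto `(t, 1)`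
otherwise. -/
def splitAffine (k₀ : ℕ) (t : ℝ) {n : ℕ} (u : Fin n → ℝ) (j : Fin n) : ℝ :=
  if (j : ℕ) < k₀ then t * u j else t + (1 - t) * u j

/-- Restricted to a box the coordinates remain independent, and each is a rescaled uniform variable
weighted by the length of its interval. -/
lemma lintegral_unifPi_split {n : ℕ} (k₀ : ℕ) {t : ℝ} (ht : t ∈ Set.Ioo (0 : ℝ) 1)
    {h : (Fin n → ℝ) → ℝ≥0∞} (hm : Measurable h) :
    ∫⁻ y in Set.pi Set.univ fun j : Fin n => if (j : ℕ) < k₀ then Set.Iio t else Set.Ioi t,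
        h y ∂unifPi n =
      (∏ j : Fin n, ENNReal.ofReal (if (j : ℕ) < k₀ then t else 1 - t)) *
        ∫⁻ u, h (splitAffine k₀ t u) ∂unifPi n := by
  set I : Fin n → Set ℝ := fun j => if (j : ℕ) < k₀ then Set.Iio t else Set.Ioi t with hI
  set f : Fin n → ℝ → ℝ := fun j u => if (j : ℕ) < k₀ then t * u else t + (1 - t) * u with hf
  set c : Fin n → ℝ≥0∞ := fun j => ENNReal.ofReal (if (j : ℕ) < k₀ then t else 1 - t) with hc
  have hfm : ∀ j, Measurable (f j) := fun j => by
    simp only [hf]; split_ifs <;> fun_prop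
  have hres : ∀ j, unif.restrict (I j) = c j • unif.map (f j) := by
    intro j
    simp only [hI, hf, hc]
    split_ifs with hj
    · have := unif_restrict_eq_map_affine (b := 0) ht.1 (measurableSet_Iio (a := t)) (by
        ext x; simp only [Set.mem_inter_iff, Set.mem_Ioo, Set.mem_Iio, zero_add]
        exact ⟨fun h => ⟨h.1.1, h.2⟩, fun h => ⟨⟨h.1, h.2.trans ht.2⟩, h.2⟩⟩)
      simpa using this
    · exact unif_restrict_eq_map_affine (b := t) (sub_pos.2 ht.2) (measurableSet_Ioi (a := t)) (by
        ext x; simp only [Set.mem_inter_iff, Set.mem_Ioo, Set.mem_Ioi, add_sub_cancel]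
        exact ⟨fun h => ⟨h.2, h.1.2⟩, fun h => ⟨⟨ht.1.trans h.1, h.2⟩, h.1⟩⟩)
  have hsplit : Measurable fun u : Fin n → ℝ => splitAffine k₀ t u :=
    measurable_pi_lambda _ fun j => (hfm j).comp (measurable_pi_apply j)
  have hpi : (unifPi n).restrict (Set.pi Set.univ I) =
      (∏ j, c j) • (unifPi n).map (splitAffine k₀ t) := by
    rw [unifPi, Measure.restrict_pi_pi]
    refine Measure.pi_eq fun s hs => ?_
    rw [Measure.smul_apply, Measure.map_apply hsplit (MeasurableSet.univ_pi hs), smul_eq_mul]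
    have e : splitAffine k₀ t ⁻¹' Set.pi Set.univ s = Set.pi Set.univ fun j => f j ⁻¹' s j := rfl
    rw [e, Measure.pi_pi, ← Finset.prod_mul_distrib]
    refine Finset.prod_congr rfl fun j _ => ?_
    rw [hres j, Measure.smul_apply, Measure.map_apply (hfm j) (hs j), smul_eq_mul]
  rw [hpi, lintegral_smul_measure, lintegral_map hm hsplit, smul_eq_mul]

/-- The vector with entry `t` in position `k₀`, smaller entries before and larger ones after. -/
def pivotVector (k₀ r : ℕ) (t : ℝ) (u : Fin (k₀ + r) → ℝ) : Fin (k₀ + r + 1) → ℝ :=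
  Fin.insertNth (α := fun _ => ℝ) ⟨k₀, by omega⟩ t (splitAffine k₀ t u)

lemma measurable_splitAffine (k₀ n : ℕ) :
    Measurable fun p : ℝ × (Fin n → ℝ) => splitAffine k₀ p.1 p.2 := by
  refine measurable_pi_lambda _ fun j => ?_
  unfold splitAffine
  split_ifs <;> fun_prop

lemma measurable_insertNth {n : ℕ} (i : Fin (n + 1)) :
    Measurable fun p : ℝ × (Fin n → ℝ) => Fin.insertNth (α := fun _ => ℝ) i p.1 p.2 :=
  (MeasurableEquiv.piFinSuccAbove (fun _ => ℝ) i).symm.measurable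

lemma measurable_pivotVector (k₀ r : ℕ) :
    Measurable fun p : ℝ × (Fin (k₀ + r) → ℝ) => pivotVector k₀ r p.1 p.2 :=
  (measurable_insertNth _).comp (measurable_fst.prodMk (measurable_splitAffine k₀ (k₀ + r)))

lemma isPivot_insertNth_iff {k₀ r : ℕ} (t : ℝ) (y : Fin (k₀ + r) → ℝ) :
    IsPivot (Fin.insertNth (α := fun _ => ℝ) ⟨k₀, by omega⟩ t y) ⟨k₀, by omega⟩ ↔
      y ∈ Set.pi Set.univ fun j : Fin (k₀ + r) =>
        if (j : ℕ) < k₀ then Set.Iio t else Set.Ioi t := by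
  set i : Fin (k₀ + r + 1) := ⟨k₀, by omega⟩ with hi
  have h1 : ∀ j : Fin (k₀ + r), i.succAbove j < i ↔ (j : ℕ) < k₀ := fun j => by
    rw [Fin.succAbove_lt_iff_castSucc_lt]; simp [hi, Fin.lt_def]
  have h2 : ∀ j : Fin (k₀ + r), i < i.succAbove j ↔ ¬ (j : ℕ) < k₀ := fun j => by
    rw [Fin.lt_succAbove_iff_le_castSucc]; simp [hi, Fin.le_def]
  simp only [IsPivot, Fin.forall_iff_succAbove i, Fin.insertNth_apply_same, lt_irrefl,
    Fin.insertNth_apply_succAbove, h1, h2, Set.mem_pi, Set.mem_univ, true_imp_iff, false_imp_iff,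
    true_and, ← forall_and]
  refine forall_congr' fun j => ?_
  split_ifs with hj <;> simp [hj]

/-- Integrating over the pivot coordinate last leaves, for each value `t`, an integral over a box of
volume `t ^ k₀ (1 - t) ^ r`: an unnormalised beta density. -/
lemma lintegral_isPivot_eq (k₀ r : ℕ) {h : (Fin (k₀ + r + 1) → ℝ) → ℝ≥0∞} (hm : Measurable h) :
    ∫⁻ U in {U | IsPivot U ⟨k₀, by omega⟩}, h U ∂unifPi (k₀ + r + 1) =
      ∫⁻ t, ENNReal.ofReal t ^ k₀ * ENNReal.ofReal (1 - t) ^ r *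
        ∫⁻ u, h (pivotVector k₀ r t u) ∂unifPi (k₀ + r) ∂unif := by
  set i : Fin (k₀ + r + 1) := ⟨k₀, by omega⟩ with hi
  set B := {U : Fin (k₀ + r + 1) → ℝ | IsPivot U i} with hB
  have hBm : MeasurableSet B := measurableSet_isPivot i
  have hmp := (measurePreserving_piFinSuccAbove (fun _ : Fin (k₀ + r + 1) => unif) i).symm
  have hhm : Measurable (B.indicator h) := hm.indicator hBm
  rw [← lintegral_indicator hBm]
  have h1 := hmp.lintegral_comp hhm
  rw [unifPi, ← h1]
  refine (lintegral_prod _ (hhm.comp hmp.measurable).aemeasurable).trans (lintegral_congr_ae ?_)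
  filter_upwards [ae_unif_mem] with t ht
  have hit : Measurable fun y : Fin (k₀ + r) → ℝ => Fin.insertNth (α := fun _ => ℝ) i t y :=
    (measurable_insertNth i).comp (measurable_prodMk_left (x := t))
  have h2 := lintegral_unifPi_split (n := k₀ + r) k₀ ht (hm.comp hit)
  have hprod : (∏ j : Fin (k₀ + r), ENNReal.ofReal (if (j : ℕ) < k₀ then t else 1 - t)) =
      ENNReal.ofReal t ^ k₀ * ENNReal.ofReal (1 - t) ^ r := by
    rw [Fin.prod_univ_add]; simp
  rw [hprod] at h2
  refine Eq.trans ?_ h2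
  rw [← lintegral_indicator (MeasurableSet.univ_pi fun j => by
    split_ifs
    · exact measurableSet_Iio
    · exact measurableSet_Ioi)]
  refine lintegral_congr fun y => ?_
  have h3 := isPivot_insertNth_iff t y
  have e : (MeasurableEquiv.piFinSuccAbove (fun _ => ℝ) i).symm (t, y) =
    Fin.insertNth (α := fun _ => ℝ) i t y := rfl
  rw [Function.comp_apply, e]
  by_cases hy : IsPivot (Fin.insertNth (α := fun _ => ℝ) i t y) i
  · rw [Set.indicator_of_mem (by exact hy), Set.indicator_of_mem (h3.1 hy)]; rfl
  · rw [Set.indicator_of_notMem (by exact hy), Set.indicator_of_notMem fun h => hy (h3.2 h)]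

lemma lintegral_betaMeasure_eq (k₀ r : ℕ) (g : ℝ → ℝ≥0∞) (hg : Measurable g) :
    ∫⁻ t, g t ∂betaMeasure (k₀ + 1) (r + 1) =
      ENNReal.ofReal (1 / ProbabilityTheory.beta (k₀ + 1) (r + 1)) *
        ∫⁻ t, ENNReal.ofReal t ^ k₀ * ENNReal.ofReal (1 - t) ^ r * g t ∂unif := by
  have hpm : Measurable (betaPDF (k₀ + 1) (r + 1)) := by
    unfold betaPDF; fun_prop
  rw [betaMeasure, lintegral_withDensity_eq_lintegral_mul _ hpm hg, unif,
    ← lintegral_const_mul _ (by fun_prop), ← lintegral_indicator measurableSet_Ioo]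
  refine lintegral_congr fun t => ?_
  by_cases ht : t ∈ Set.Ioo (0 : ℝ) 1
  · have hb := beta_pos (α := (k₀ : ℝ) + 1) (β := (r : ℝ) + 1) (by positivity) (by positivity)
    have h1 : 0 ≤ 1 - t := by linarith [ht.2]
    rw [Set.indicator_of_mem ht, Pi.mul_apply, betaPDF_of_pos_lt_one ht.1 ht.2,
      add_sub_cancel_right, add_sub_cancel_right, Real.rpow_natCast, Real.rpow_natCast,
      ENNReal.ofReal_mul (by have := ht.1; positivity), ENNReal.ofReal_mul (by positivity),
      ENNReal.ofReal_pow ht.1.le, ENNReal.ofReal_pow h1]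
    ring
  · rw [Set.indicator_of_notMem ht, Pi.mul_apply]
    rcases le_or_gt t 0 with h0 | h0
    · rw [betaPDF_eq_zero_of_nonpos h0, zero_mul]
    · rw [betaPDF_eq_zero_of_one_le (not_lt.1 fun h1 => ht ⟨h0, h1⟩), zero_mul]

instance (k₀ r : ℕ) : IsProbabilityMeasure (betaMeasure (k₀ + 1) (r + 1)) :=
  isProbabilityMeasureBeta (by positivity) (by positivity)

/-- A symmetric function of `k₀ + r + 1` independent uniform variables can be evaluated by first
drawing the `(k₀ + 1)`-th smallest one from a beta distribution, and then the smaller and the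
larger ones independently and uniformly. -/
theorem lintegral_unifPi_symm_eq (k₀ r : ℕ) {h : (Fin (k₀ + r + 1) → ℝ) → ℝ≥0∞}
    (hm : Measurable h) (hsym : ∀ U (σ : Equiv.Perm (Fin (k₀ + r + 1))), h (U ∘ σ) = h U) :
    ∫⁻ U, h U ∂unifPi (k₀ + r + 1) =
      ∫⁻ t, ∫⁻ u, h (pivotVector k₀ r t u) ∂unifPi (k₀ + r) ∂betaMeasure (k₀ + 1) (r + 1) := by
  obtain ⟨C, hC, hCh⟩ := exists_lintegral_symm_eq (⟨k₀, by omega⟩ : Fin (k₀ + r + 1))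
  -- Testing with the constant 1 identifies `C` as the normalising constant of the beta density, so
  -- no permutations have to be counted.
  have hone := hCh (fun _ => 1) measurable_const fun _ _ => rfl
  rw [lintegral_isPivot_eq k₀ r measurable_const] at hone
  have hbeta := lintegral_betaMeasure_eq k₀ r (fun _ => 1) measurable_const
  simp only [lintegral_one, measure_univ, mul_one] at hone hbeta
  set J := ∫⁻ t, ENNReal.ofReal t ^ k₀ * ENNReal.ofReal (1 - t) ^ r ∂unif with hJ
  have hCeq : C = ENNReal.ofReal (1 / ProbabilityTheory.beta (k₀ + 1) (r + 1)) := by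
    rw [ENNReal.eq_inv_of_mul_eq_one_left hone.symm, ENNReal.eq_inv_of_mul_eq_one_left hbeta.symm]
  rw [hCh h hm hsym, lintegral_isPivot_eq k₀ r hm, lintegral_betaMeasure_eq k₀ r, hCeq]
  exact (hm.comp (measurable_pivotVector k₀ r)).lintegral_prod_right'

/-! ### The law of the block maxima -/

/-- The quantile transform for block maxima: decreasing in the uniform argument. -/
def blockQuantile (F : ℝ → ℝ) (m : ℕ) (u : ℝ) : ℝ := quantileV F (m * paretoToFrechet (1 / u))

lemma paretoToFrechet_one_div_pos {u : ℝ} (hu : u ∈ Set.Ioo (0 : ℝ) 1) :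
    0 < paretoToFrechet (1 / u) :=
  paretoToFrechet_pos (by rw [one_lt_div hu.1]; exact hu.2)

/-- The level of the quantile is the `m`-th root of `1 - u`, so the Galois connection can be raised
to the power `m`. -/
lemma blockQuantile_le_iff (ν : Measure ℝ) [IsProbabilityMeasure ν] {m : ℕ} (hm : 1 ≤ m) {u : ℝ}
    (hu : u ∈ Set.Ioo (0 : ℝ) 1) (x : ℝ) :
    blockQuantile (cdf ν) m u ≤ x ↔ 1 - u ≤ cdf ν x ^ m := by
  have hm0 : (0 : ℝ) < m := by exact_mod_cast hm
  have ht : 0 < m * paretoToFrechet (1 / u) := mul_pos hm0 (paretoToFrechet_one_div_pos hu)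
  have hmem := exp_neg_one_div_mem ht
  have h1u : 0 < 1 - u := by linarith [hu.2]
  have hpow : Real.exp (-1 / (m * paretoToFrechet (1 / u))) ^ m = 1 - u := by
    rw [← Real.exp_nat_mul]
    have hl : Real.log (1 - u) ≠ 0 := (Real.log_neg h1u (by linarith [hu.1])).ne
    have e : (m : ℝ) * (-1 / (m * paretoToFrechet (1 / u))) = Real.log (1 - u) := by
      rw [paretoToFrechet, one_div_one_div]
      field_simp
    rw [e, Real.exp_log h1u]
  rw [blockQuantile, quantileV, genInv_cdf_le_iff hmem.1 hmem.2, ← hpow,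
    pow_le_pow_iff_left₀ hmem.1.le (cdf_nonneg ν x) (by omega)]

lemma antitoneOn_blockQuantile (ν : Measure ℝ) [IsProbabilityMeasure ν] {m : ℕ} (hm : 1 ≤ m) :
    AntitoneOn (blockQuantile (cdf ν) m) (Set.Ioo 0 1) := by
  intro u hu v hv huv
  have hm0 : (0 : ℝ) < m := by exact_mod_cast hm
  refine monotoneOn_quantileV ν (mul_pos hm0 (paretoToFrechet_one_div_pos hv))
    (mul_pos hm0 (paretoToFrechet_one_div_pos hu)) ?_
  refine mul_le_mul_of_nonneg_left (paretoToFrechet_mono ?_ ?_) hm0.le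
  · rw [one_lt_div hv.1]; exact hv.2
  · exact one_div_le_one_div_of_le hu.1 huv

/-- A function that is antitone on the unit interval agrees there with a measurable function. -/
lemma exists_measurable_eqOn_Ioo {g : ℝ → ℝ} (hg : AntitoneOn g (Set.Ioo 0 1)) :
    ∃ g' : ℝ → ℝ, Measurable g' ∧ Set.EqOn g' g (Set.Ioo 0 1) := by
  refine ⟨(Set.Ioo 0 1).indicator g, ?_, fun u hu => Set.indicator_of_mem hu g⟩
  refine measurable_of_restrict_of_restrict_compl (measurableSet_Ioo (a := (0 : ℝ)) (b := 1)) ?_ ?_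
  · have : Antitone fun u : Set.Ioo (0 : ℝ) 1 => g u := fun u v huv => hg u.2 v.2 huv
    have e : (Set.Ioo (0 : ℝ) 1).domRestrict ((Set.Ioo 0 1).indicator g) =
        fun u : Set.Ioo (0 : ℝ) 1 => g u :=
      funext fun u => Set.indicator_of_mem u.2 g
    rw [e]
    exact this.measurable
  · have e : (Set.Ioo (0 : ℝ) 1)ᶜ.domRestrict ((Set.Ioo 0 1).indicator g) = fun _ => 0 :=
      funext fun u => Set.indicator_of_notMem u.2 g
    rw [e]
    exact measurable_const

lemma unif_map_Iic {ν : Measure ℝ} [IsProbabilityMeasure ν] {m : ℕ} (hm : 1 ≤ m) {g : ℝ → ℝ}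
    (hgm : Measurable g) (hg : Set.EqOn g (blockQuantile (cdf ν) m) (Set.Ioo 0 1)) (x : ℝ) :
    unif.map g (Set.Iic x) = ENNReal.ofReal (cdf ν x ^ m) := by
  rw [Measure.map_apply hgm measurableSet_Iic]
  have h0 := pow_nonneg (cdf_nonneg ν x) m
  have e : (g ⁻¹' Set.Iic x : Set ℝ) =ᵐ[unif] Set.Ici (1 - cdf ν x ^ m) := by
    filter_upwards [ae_unif_mem] with u hu
    refine propext ?_
    change g u ≤ x ↔ 1 - cdf ν x ^ m ≤ u
    rw [hg hu, blockQuantile_le_iff ν hm hu]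
    constructor <;> intro h <;> linarith
  have h1 : cdf ν x ^ m ≤ 1 := pow_le_one₀ (cdf_nonneg ν x) (cdf_le_one ν x)
  rw [measure_congr e, unif, Measure.restrict_congr_set Ioo_ae_eq_Ico,
    Measure.restrict_apply measurableSet_Ici]
  have e2 : Set.Ici (1 - cdf ν x ^ m) ∩ Set.Ico 0 1 = Set.Ico (1 - cdf ν x ^ m) 1 := by
    ext u
    simp only [Set.mem_inter_iff, Set.mem_Ici, Set.mem_Ico]
    exact ⟨fun h => ⟨h.1, h.2.2⟩, fun h => ⟨h.1, by linarith [h.1], h.2⟩⟩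
  rw [e2, Real.volume_Ico, sub_sub_cancel]

lemma aemeasurable_blockMax {Ω : Type*} [MeasurableSpace Ω] {μ : Measure Ω} {X : ℕ → Ω → ℝ}
    (hX : ∀ j, AEMeasurable (X j) μ) (m i : ℕ) : AEMeasurable (blockMax X m i) μ :=
  AEMeasurable.iSup fun _ => hX _

/-- The law of the vector of block maxima. -/
lemma map_blockMax_eq {Ω : Type*} [MeasurableSpace Ω] {μ : Measure Ω} [IsProbabilityMeasure μ]
    {X : ℕ → Ω → ℝ} (hindep : iIndepFun X μ) (hident : ∀ j, IdentDistrib (X j) (X 0) μ μ)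
    [IsProbabilityMeasure (μ.map (X 0))]
    {m : ℕ} (hm : 1 ≤ m) {g : ℝ → ℝ} (hgm : Measurable g)
    (hg : Set.EqOn g (blockQuantile (cdf (μ.map (X 0))) m) (Set.Ioo 0 1)) (k : ℕ) :
    μ.map (fun ω (l : Fin k) => blockMax X m l ω) = (unifPi k).map fun U l => g (U l) := by
  have hX : ∀ j, AEMeasurable (X j) μ := fun j => (hident j).aemeasurable_fst
  have hBm : AEMeasurable (fun ω (l : Fin k) => blockMax X m l ω) μ :=
    aemeasurable_pi_lambda _ fun l => aemeasurable_blockMax hX m l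
  have hprob : IsProbabilityMeasure (unif.map g) :=
    Measure.isProbabilityMeasure_map hgm.aemeasurable
  -- Blocks are nonempty, so the supremum over `Fin m` is a genuine maximum.
  have : NeZero m := ⟨by omega⟩
  rw [unifPi, Measure.pi_map_pi fun _ => hgm.aemeasurable]
  symm
  have hspan : (unif.map g).FiniteSpanningSetsIn (Set.range Set.Iic) :=
    { set := fun n => Set.Iic (n : ℝ)
      set_mem := fun n => ⟨n, rfl⟩
      finite := fun n => measure_lt_top _ _
      spanning := by
        refine Set.eq_univ_of_forall fun x => Set.mem_iUnion.2 ?_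
        obtain ⟨n, hn⟩ := exists_nat_ge x
        exact ⟨n, hn⟩ }
  refine Measure.pi_eq_generateFrom (C := fun _ => Set.range Set.Iic)
    (fun _ => (borel_eq_generateFrom_Iic ℝ).symm.trans (BorelSpace.measurable_eq (α := ℝ)).symm)
    (fun _ => isPiSystem_Iic) (fun _ => hspan) fun s hs => ?_
  choose x hx using hs
  obtain rfl : (fun l => Set.Iic (x l)) = s := funext hx
  -- Distinct pairs of block and position name distinct observations, so independence passes to the
  -- doubly indexed family.
  have hinj : Function.Injective fun p : Fin k × Fin m => (p.1 : ℕ) * m + p.2 := by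
    rintro ⟨a, b⟩ ⟨c, d⟩ h
    have h' : (a : ℕ) * m + b = c * m + d := h
    have h1 : ∀ (y : ℕ) (z : Fin m), (y * m + z) / m = y := fun y z => by
      rw [Nat.add_comm, Nat.add_mul_div_right _ _ (by omega), Nat.div_eq_of_lt z.2, Nat.zero_add]
    have h2 : (a : ℕ) = c := by rw [← h1 a b, ← h1 c d, h']
    rw [h2] at h'
    exact Prod.ext (Fin.ext h2) (Fin.ext (Nat.add_left_cancel h'))
  have hind := (hindep.precomp hinj).meas_iInter (s := fun p => X (p.1 * m + p.2) ⁻¹' Set.Iic (x p.1))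
    fun p => ⟨_, measurableSet_Iic, rfl⟩
  rw [Measure.map_apply_of_aemeasurable hBm
    (MeasurableSet.univ_pi fun _ => measurableSet_Iic)]
  have e : (fun ω (l : Fin k) => blockMax X m l ω) ⁻¹' Set.pi Set.univ (fun l => Set.Iic (x l)) =
      ⋂ p : Fin k × Fin m, X (p.1 * m + p.2) ⁻¹' Set.Iic (x p.1) := by
    ext ω
    simp only [Set.mem_preimage, Set.mem_pi, Set.mem_univ, true_imp_iff, Set.mem_Iic, blockMax,
      Set.mem_iInter, Prod.forall]
    exact forall_congr' fun l => ciSup_le_iff (Set.finite_range _).bddAbove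
  rw [e]
  refine hind.trans ?_
  rw [Fintype.prod_prod_type]
  refine Finset.prod_congr rfl fun l _ => ?_
  have hlaw : ∀ j, μ (X j ⁻¹' Set.Iic (x l)) = ENNReal.ofReal (cdf (μ.map (X 0)) (x l)) := by
    intro j
    rw [← Measure.map_apply_of_aemeasurable (hX j) measurableSet_Iic, (hident j).map_eq,
      ofReal_cdf]
  simp only [hlaw]
  rw [unif_map_Iic hm hgm hg, Finset.prod_const, Finset.card_univ, Fintype.card_fin,
    ENNReal.ofReal_pow (cdf_nonneg _ _)]

/-! ### The Hill statistic in terms of a pivot -/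

/-- The hybrid-Hill estimator as a function of the vector of block maxima. -/
def hillStat {k : ℕ} (k₀ : ℕ) (v : Fin k → ℝ) : ℝ :=
  (1 / (k₀ : ℝ)) * ∑ i ∈ Finset.range k₀, Real.log (orderStat v (k - i))
    - Real.log (orderStat v (k - k₀))

/-- The sorting permutation is avoided: the `j`-th smallest entry is at most `a` exactly when at
least `j` entries are, and counting is measurable. -/
lemma measurable_orderStat {k : ℕ} (j : ℕ) : Measurable fun v : Fin k → ℝ => orderStat v j := by
  unfold orderStat
  split_ifs with h
  · refine measurable_of_Iic fun a => ?_
    have e : (fun v : Fin k → ℝ => v (Tuple.sort v ⟨j - 1, by omega⟩)) ⁻¹' Set.Iic a =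
        {v | j - 1 < ∑ i : Fin k, if v i ≤ a then 1 else 0} := by
      ext v
      have h1 := Tuple.lt_card_le_iff_apply_le_of_monotone (j := ⟨j - 1, by omega⟩) (a := a)
        (Tuple.monotone_sort v)
      have h2 : (Finset.univ.filter fun i => (v ∘ Tuple.sort v) i ≤ a).card =
          (Finset.univ.filter fun i => v i ≤ a).card :=
        Finset.card_equiv (Tuple.sort v) fun i => by simp
      rw [h2, Finset.card_filter] at h1
      exact h1.symm
    rw [e]
    refine measurableSet_lt measurable_const (Finset.measurable_sum _ fun i _ => ?_)
    exact Measurable.ite (measurableSet_le (measurable_pi_apply i) measurable_const)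
      measurable_const measurable_const
  · exact measurable_const

lemma measurable_hillStat (k k₀ : ℕ) : Measurable fun v : Fin k → ℝ => hillStat k₀ v := by
  unfold hillStat
  refine Measurable.sub (Measurable.const_mul (Finset.measurable_sum _ fun i _ => ?_) _) ?_
  · exact Real.measurable_log.comp (measurable_orderStat _)
  · exact Real.measurable_log.comp (measurable_orderStat _)

lemma orderStat_comp_perm {k : ℕ} (v : Fin k → ℝ) (σ : Equiv.Perm (Fin k)) (j : ℕ) :
    orderStat (v ∘ σ) j = orderStat v j := by
  unfold orderStat
  split_ifs with h
  · exact congrFun (Tuple.comp_perm_comp_sort_eq_comp_sort (f := v) (σ := σ)) _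
  · rfl

lemma hillStat_comp_perm {k : ℕ} (k₀ : ℕ) (v : Fin k → ℝ) (σ : Equiv.Perm (Fin k)) :
    hillStat k₀ (v ∘ σ) = hillStat k₀ v := by
  simp only [hillStat, orderStat_comp_perm]

/-- Order statistics of an antitone image. -/
lemma orderStat_antitoneOn_comp {k : ℕ} {g : ℝ → ℝ} {s : Set ℝ} (hg : AntitoneOn g s)
    {U : Fin k → ℝ} (hU : ∀ i, U i ∈ s) (i : Fin k) :
    orderStat (fun l => g (U l)) (k - i) = g (U (Tuple.sort U i)) := by
  have hi := i.2
  have hmono : Monotone ((fun l => g (U l)) ∘ (Fin.revPerm.trans (Tuple.sort U))) := by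
    intro a b hab
    exact hg (hU _) (hU _) (Tuple.monotone_sort U (Fin.rev_le_rev.2 hab))
  -- With ties in `g ∘ U` the two sorting permutations may differ, but the sorted vectors agree.
  have h := Tuple.unique_monotone hmono (Tuple.monotone_sort _)
  rw [orderStat, dif_pos ⟨by omega, by omega⟩]
  refine (congrFun h _).symm.trans ?_
  simp only [Function.comp_apply, Equiv.trans_apply, Fin.revPerm_apply]
  congr 3
  ext
  simp [Fin.val_rev]
  omega

/-- The hybrid-Hill statistic of an antitone image of a vector with a pivot. -/
lemma hillStat_of_isPivot {k k₀ : ℕ} (hk : k₀ < k) {g : ℝ → ℝ} {s : Set ℝ} (hg : AntitoneOn g s)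
    {U : Fin k → ℝ} (hU : ∀ i, U i ∈ s) (hp : IsPivot U ⟨k₀, hk⟩) :
    hillStat k₀ (fun l => g (U l)) =
      (1 / (k₀ : ℝ)) * ∑ i : Fin k₀, Real.log (g (U (Fin.castLE hk.le i)))
        - Real.log (g (U ⟨k₀, hk⟩)) := by
  set p : Fin k := ⟨k₀, hk⟩ with hpdef
  set τ := Tuple.sort U with hτ
  have hlt : ∀ l, U l < U p ↔ l < p := fun l =>
    ⟨fun h => by
      by_contra hn
      rcases (not_lt.1 hn).eq_or_lt with h' | h'
      · rw [h'] at h; exact lt_irrefl _ h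
      · exact lt_asymm h (hp.2 l h'), hp.1 l⟩
  have hle : ∀ l, U l ≤ U p ↔ l ≤ p := fun l =>
    ⟨fun h => by
      by_contra hn
      exact absurd (hp.2 l (not_le.1 hn)) (not_lt.2 h), fun h => by
      rcases h.eq_or_lt with rfl | h'
      · exact le_rfl
      · exact (hp.1 l h').le⟩
  have hτlt : ∀ j, j < p ↔ τ j < p := by
    intro j
    have h1 := Tuple.lt_card_lt_iff_apply_lt_of_monotone (j := j) (a := U p)
      (Tuple.monotone_sort U)
    have h2 : (Finset.univ.filter fun i => (U ∘ Tuple.sort U) i < U p).card =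
        (Finset.univ.filter fun i => i < p).card :=
      Finset.card_equiv τ fun i => by simp [hlt, hτ]
    rw [h2, Finset.filter_gt_eq_Iio, Fin.card_Iio] at h1
    rw [← hlt (τ j), Fin.lt_def]
    exact h1
  have hτle : ∀ j, j ≤ p ↔ τ j ≤ p := by
    intro j
    have h1 := Tuple.lt_card_le_iff_apply_le_of_monotone (j := j) (a := U p)
      (Tuple.monotone_sort U)
    have h2 : (Finset.univ.filter fun i => (U ∘ Tuple.sort U) i ≤ U p).card =
        (Finset.univ.filter fun i => i ≤ p).card :=
      Finset.card_equiv τ fun i => by simp [hle, hτ]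
    rw [h2, Finset.filter_ge_eq_Iic, Fin.card_Iic] at h1
    rw [← hle (τ j), Fin.le_def, ← Nat.lt_succ_iff]
    exact h1
  have hτp : τ p = p :=
    le_antisymm ((hτle p).1 le_rfl) (not_lt.1 fun h => lt_irrefl _ ((hτlt p).2 h))
  have hlast : orderStat (fun l => g (U l)) (k - k₀) = g (U p) := by
    rw [← hτp]
    exact orderStat_antitoneOn_comp hg hU p
  have hsum : ∑ i ∈ Finset.range k₀, Real.log (orderStat (fun l => g (U l)) (k - i)) =
      ∑ i : Fin k₀, Real.log (g (U (Fin.castLE hk.le i))) := by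
    rw [Finset.sum_range]
    have h1 : ∀ i : Fin k₀, orderStat (fun l => g (U l)) (k - i) =
        g (U (τ (Fin.castLE hk.le i))) := fun i =>
      orderStat_antitoneOn_comp hg hU (Fin.castLE hk.le i)
    simp only [h1]
    have hf : ∀ f : Fin k → ℝ, ∑ i : Fin k₀, f (Fin.castLE hk.le i) =
        ∑ l ∈ Finset.univ.filter (fun l => l < p), f l := by
      intro f
      refine Finset.sum_bij (fun i _ => Fin.castLE hk.le i) ?_ ?_ ?_ ?_
      · intro i _
        simp [hpdef, Fin.lt_def]
      · intro a _ b _ h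
        exact Fin.castLE_injective hk.le h
      · intro l hl
        have : (l : ℕ) < k₀ := by simpa [hpdef, Fin.lt_def] using hl
        exact ⟨⟨l, this⟩, Finset.mem_univ _, rfl⟩
      · intro i _; rfl
    rw [hf fun l => Real.log (g (U (τ l))), hf fun l => Real.log (g (U l))]
    exact Finset.sum_equiv τ (fun l => by simp [← hτlt]) fun l _ => rfl
  rw [hillStat, hlast, hsum]

/-- The hybrid-Hill statistic in terms of the pivot `t` and of uniform variables `u`. -/
def hillPivot (g : ℝ → ℝ) (k₀ : ℕ) (t : ℝ) {n : ℕ} (u : Fin n → ℝ) : ℝ :=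
  (1 / (k₀ : ℝ)) * ∑ i : Fin n, (if (i : ℕ) < k₀ then Real.log (g (t * u i)) else 0)
    - Real.log (g t)

lemma measurable_hillPivot {g : ℝ → ℝ} (hg : Measurable g) (k₀ n : ℕ) :
    Measurable fun p : ℝ × (Fin n → ℝ) => hillPivot g k₀ p.1 p.2 := by
  unfold hillPivot
  refine Measurable.sub (Measurable.const_mul (Finset.measurable_sum _ fun i _ => ?_) _) ?_
  · split_ifs <;> fun_prop
  · fun_prop

lemma hillStat_pivotVector {g : ℝ → ℝ} (hg : AntitoneOn g (Set.Ioo 0 1)) (k₀ r : ℕ) {t : ℝ}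
    (ht : t ∈ Set.Ioo (0 : ℝ) 1) {u : Fin (k₀ + r) → ℝ} (hu : ∀ i, u i ∈ Set.Ioo (0 : ℝ) 1) :
    hillStat k₀ (fun l => g (pivotVector k₀ r t u l)) = hillPivot g k₀ t u := by
  have hsplit : ∀ j, splitAffine k₀ t u j ∈ Set.Ioo (0 : ℝ) 1 ∧
      (if (j : ℕ) < k₀ then splitAffine k₀ t u j < t else t < splitAffine k₀ t u j) := by
    intro j
    obtain ⟨h1, h2⟩ := hu j
    obtain ⟨h3, h4⟩ := ht
    unfold splitAffine
    split_ifs with hj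
    · have : t * u j < t := mul_lt_of_lt_one_right h3 h2
      exact ⟨⟨mul_pos h3 h1, this.trans h4⟩, this⟩
    · have h5 : 0 < (1 - t) * u j := mul_pos (sub_pos.2 h4) h1
      have h6 : (1 - t) * u j < 1 - t := mul_lt_of_lt_one_right (sub_pos.2 h4) h2
      exact ⟨⟨by linarith, by linarith⟩, by linarith⟩
  have hmem : ∀ l, pivotVector k₀ r t u l ∈ Set.Ioo (0 : ℝ) 1 := by
    unfold pivotVector
    rw [Fin.forall_iff_succAbove ⟨k₀, by omega⟩]
    simp only [Fin.insertNth_apply_same, Fin.insertNth_apply_succAbove]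
    exact ⟨ht, fun j => (hsplit j).1⟩
  have hp : IsPivot (pivotVector k₀ r t u) ⟨k₀, by omega⟩ := by
    refine (isPivot_insertNth_iff t _).2 fun j _ => ?_
    have := (hsplit j).2
    change splitAffine k₀ t u j ∈ if (j : ℕ) < k₀ then Set.Iio t else Set.Ioi t
    split_ifs at this ⊢ <;> exact this
  rw [hillStat_of_isPivot (by omega) hg hmem hp, hillPivot, Fin.sum_univ_add]
  have h0 : pivotVector k₀ r t u ⟨k₀, by omega⟩ = t := by
    unfold pivotVector
    rw [Fin.insertNth_apply_same]
  have h1 : ∀ i : Fin k₀, pivotVector k₀ r t u (Fin.castLE (by omega) i) =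
      t * u (Fin.castAdd r i) := by
    intro i
    have e : (Fin.castLE (by omega) i : Fin (k₀ + r + 1)) =
        Fin.succAbove ⟨k₀, by omega⟩ (Fin.castAdd r i) := by
      rw [Fin.succAbove_of_castSucc_lt]
      · ext; simp
      · simp [Fin.lt_def]
    rw [e, pivotVector, Fin.insertNth_apply_succAbove, splitAffine, if_pos (by simp)]
  rw [h0]
  congr 2
  simp [h1]

lemma ae_betaMeasure_mem (k₀ r : ℕ) :
    ∀ᵐ t ∂betaMeasure (k₀ + 1 : ℝ) (r + 1), t ∈ Set.Ioo (0 : ℝ) 1 := by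
  have h1 := lintegral_betaMeasure_eq k₀ r ((Set.Ioo (0 : ℝ) 1)ᶜ.indicator 1)
    (measurable_one.indicator measurableSet_Ioo.compl)
  rw [lintegral_indicator_one measurableSet_Ioo.compl] at h1
  rw [ae_iff]
  refine h1.trans ?_
  rw [lintegral_congr_ae (g := fun _ => 0), lintegral_zero, mul_zero]
  filter_upwards [ae_unif_mem] with t ht
  rw [Set.indicator_of_notMem (Set.notMem_compl_iff.2 ht), mul_zero]

/-- The law of the hybrid-Hill estimator. -/
theorem map_hybridHill_eq {Ω : Type*} [MeasurableSpace Ω] {μ : Measure Ω} [IsProbabilityMeasure μ]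
    {X : ℕ → Ω → ℝ} (hindep : iIndepFun X μ) (hident : ∀ j, IdentDistrib (X j) (X 0) μ μ)
    [IsProbabilityMeasure (μ.map (X 0))]
    {m : ℕ} (hm : 1 ≤ m) {g : ℝ → ℝ} (hgm : Measurable g)
    (hg : Set.EqOn g (blockQuantile (cdf (μ.map (X 0))) m) (Set.Ioo 0 1)) (k₀ r : ℕ) :
    μ.map (hybridHill X m (k₀ + r + 1) k₀) =
      ((betaMeasure (k₀ + 1) (r + 1)).prod (unifPi (k₀ + r))).map
        fun p => hillPivot g k₀ p.1 p.2 := by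
  have hX : ∀ j, AEMeasurable (X j) μ := fun j => (hident j).aemeasurable_fst
  have hBm : AEMeasurable (fun ω (l : Fin (k₀ + r + 1)) => blockMax X m l ω) μ :=
    aemeasurable_pi_lambda _ fun l => aemeasurable_blockMax hX m l
  have hgpi : Measurable fun (U : Fin (k₀ + r + 1) → ℝ) l => g (U l) := by fun_prop
  have hanti : AntitoneOn g (Set.Ioo 0 1) := fun u hu v hv huv => by
    rw [hg hu, hg hv]
    exact antitoneOn_blockQuantile _ hm hu hv huv
  have e : hybridHill X m (k₀ + r + 1) k₀ =
      hillStat k₀ ∘ fun ω (l : Fin (k₀ + r + 1)) => blockMax X m l ω := rfl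
  have hbeta := ae_betaMeasure_mem k₀ r
  rw [e, ← AEMeasurable.map_map_of_aemeasurable (measurable_hillStat _ _).aemeasurable hBm,
    map_blockMax_eq hindep hident hm hgm hg, Measure.map_map (measurable_hillStat _ _) hgpi]
  ext S hS
  have hmeas := (measurable_hillStat (k₀ + r + 1) k₀).comp hgpi
  -- The indicator of the event that the statistic lies in `S` is a symmetric function of the
  -- uniform variables, so the beta decomposition applies to it.
  rw [Measure.map_apply hmeas hS, Measure.map_apply (measurable_hillPivot hgm _ _) hS,
    Measure.prod_apply (measurable_hillPivot hgm _ _ hS), ← lintegral_indicator_one (hmeas hS),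
    lintegral_unifPi_symm_eq k₀ r (measurable_one.indicator (hmeas hS)) fun U σ => ?_]
  · refine lintegral_congr_ae ?_
    filter_upwards [hbeta] with t ht
    have hmt : MeasurableSet (Prod.mk t ⁻¹' ((fun p : ℝ × (Fin (k₀ + r) → ℝ) =>
      hillPivot g k₀ p.1 p.2) ⁻¹' S)) :=
      measurable_prodMk_left (measurable_hillPivot hgm _ _ hS)
    rw [← lintegral_indicator_one hmt]
    refine lintegral_congr_ae ?_
    filter_upwards [ae_unifPi_mem (k₀ + r)] with u hu
    have h1 : hillStat k₀ (fun l => g (pivotVector k₀ r t u l)) ∈ S ↔ hillPivot g k₀ t u ∈ S := by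
      rw [hillStat_pivotVector hanti k₀ r ht hu]
    classical exact if_congr h1 rfl rfl
  · have h1 : hillStat k₀ ((fun l => g (U l)) ∘ σ) ∈ S ↔ hillStat k₀ (fun l => g (U l)) ∈ S := by
      rw [hillStat_comp_perm]
    classical exact if_congr h1 rfl rfl

/-! ### Moments of the uniform and beta distributions -/

lemma integral_unif_eq (f : ℝ → ℝ) : ∫ u, f u ∂unif = ∫ u in (0 : ℝ)..1, f u := by
  rw [unif, intervalIntegral.integral_of_le zero_le_one, integral_Ioc_eq_integral_Ioo]

lemma integrable_unif_iff (f : ℝ → ℝ) :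
    Integrable f unif ↔ IntervalIntegrable f volume 0 1 := by
  rw [unif, intervalIntegrable_iff_integrableOn_Ioo_of_le zero_le_one, IntegrableOn]

lemma integrable_log_unif : Integrable Real.log unif :=
  (integrable_unif_iff _).2 intervalIntegral.intervalIntegrable_log'

lemma integral_log_unif : ∫ u, Real.log u ∂unif = -1 := by
  rw [integral_unif_eq, integral_log]
  simp

lemma integrable_rpow_unif {s : ℝ} (hs : -1 < s) : Integrable (fun u : ℝ => u ^ s) unif :=
  (integrable_unif_iff _).2 (intervalIntegral.intervalIntegrable_rpow' hs)

lemma integral_rpow_unif {s : ℝ} (hs : -1 < s) : ∫ u, u ^ s ∂unif = 1 / (s + 1) := by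
  rw [integral_unif_eq, integral_rpow (Or.inl hs), Real.one_rpow,
    Real.zero_rpow (by linarith), sub_zero]

lemma continuous_mul_log_sq : Continuous fun u : ℝ => u * Real.log u ^ 2 := by
  refine continuous_iff_continuousAt.2 fun u => ?_
  rcases eq_or_ne u 0 with rfl | hu
  -- Halving the logarithm through a square root reduces the behaviour at 0 to the continuity of `x
  -- log x`.
  · have h1 : Continuous fun u : ℝ => 4 * (Real.sqrt |u| * Real.log (Real.sqrt |u|)) ^ 2 :=
      continuous_const.mul
        ((Real.continuous_mul_log.comp (Real.continuous_sqrt.comp continuous_abs)).pow 2)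
    have h2 : ∀ u : ℝ, 4 * (Real.sqrt |u| * Real.log (Real.sqrt |u|)) ^ 2 =
        |u * Real.log u ^ 2| := fun u => by
      rw [Real.log_sqrt (abs_nonneg u), Real.log_abs, mul_pow, Real.sq_sqrt (abs_nonneg u),
        abs_mul, abs_of_nonneg (sq_nonneg (Real.log u))]
      ring
    simp_rw [h2] at h1
    have h3 := h1.tendsto 0
    simp only [zero_mul, abs_zero] at h3
    rw [ContinuousAt, zero_mul]
    exact squeeze_zero_norm (fun u => le_rfl) h3
  · exact continuousAt_id.mul ((Real.continuousAt_log hu).pow 2)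

lemma hasDerivAt_mul_log_sq {u : ℝ} (hu : u ≠ 0) :
    HasDerivAt (fun u : ℝ => u * Real.log u ^ 2 - 2 * (u * Real.log u) + 2 * u)
      (Real.log u ^ 2) u := by
  have h1 := Real.hasDerivAt_log hu
  have h2 := ((((hasDerivAt_id u).mul (h1.pow 2)).sub
    (((hasDerivAt_id u).mul h1).const_mul 2)).add ((hasDerivAt_id u).const_mul 2))
  refine h2.congr_deriv ?_
  simp only [id, Pi.pow_apply]
  field_simp
  ring

lemma continuous_mul_log_sq_primitive :
    Continuous fun u : ℝ => u * Real.log u ^ 2 - 2 * (u * Real.log u) + 2 * u :=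
  (continuous_mul_log_sq.sub (continuous_const.mul Real.continuous_mul_log)).add
    (continuous_const.mul continuous_id)

/-- A nonnegative derivative of a function continuous up to the endpoints is integrable, so the
singularity at 0 needs no estimate. -/
lemma integrable_log_sq_unif : Integrable (fun u => Real.log u ^ 2) unif :=
  (integrable_unif_iff _).2 <| intervalIntegral.intervalIntegrable_deriv_of_nonneg
    continuous_mul_log_sq_primitive.continuousOn
    (fun u hu => hasDerivAt_mul_log_sq (by simp at hu; exact hu.1.ne')) fun _ _ => sq_nonneg _

lemma integral_log_sq_unif : ∫ u, Real.log u ^ 2 ∂unif = 2 := by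
  rw [integral_unif_eq, intervalIntegral.integral_eq_sub_of_hasDerivAt_of_le zero_le_one
    continuous_mul_log_sq_primitive.continuousOn (fun u hu => hasDerivAt_mul_log_sq hu.1.ne')
    ((integrable_unif_iff _).1 integrable_log_sq_unif)]
  simp

lemma memLp_log_unif : MemLp Real.log 2 unif :=
  (memLp_two_iff_integrable_sq Real.measurable_log.aestronglyMeasurable).2 integrable_log_sq_unif

lemma variance_neg_log_unif : Var[fun u => -Real.log u; unif] = 1 := by
  rw [variance_eq_sub (X := fun u => -Real.log u) memLp_log_unif.neg]
  simp only [Pi.pow_apply, even_two.neg_pow, integral_log_sq_unif, integral_neg, integral_log_unif]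
  norm_num

lemma boxCox_one_div_ae (ρ : ℝ) (hρ : ρ ≠ 0) :
    (fun u : ℝ => boxCox ρ (1 / u)) =ᵐ[unif] fun u => (u ^ (-ρ) - 1) / ρ := by
  filter_upwards [ae_unif_mem] with u hu
  rw [boxCox, if_neg hρ, one_div, Real.inv_rpow hu.1.le, Real.rpow_neg hu.1.le]

lemma integrable_boxCox_one_div_unif {ρ : ℝ} (hρ : ρ ≤ 0) :
    Integrable (fun u : ℝ => boxCox ρ (1 / u)) unif := by
  rcases eq_or_ne ρ 0 with rfl | h0
  · simpa [boxCox] using integrable_log_unif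
  · exact (((integrable_rpow_unif (by linarith)).sub (integrable_const 1)).div_const ρ).congr
      (boxCox_one_div_ae ρ h0).symm

/-- This mean is the factor multiplying `λ` in the asymptotic bias. -/
lemma integral_boxCox_one_div_unif {ρ : ℝ} (hρ : ρ ≤ 0) :
    ∫ u, boxCox ρ (1 / u) ∂unif = 1 / (1 - ρ) := by
  rcases eq_or_ne ρ 0 with rfl | h0
  · simp [boxCox, integral_neg, integral_log_unif]
  · rw [integral_congr_ae (boxCox_one_div_ae ρ h0), integral_div,
      integral_sub (integrable_rpow_unif (by linarith)) (integrable_const 1),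
      integral_rpow_unif (by linarith)]
    have : 1 - ρ ≠ 0 := by linarith
    have : -ρ + 1 ≠ 0 := by linarith
    simp
    field_simp
    ring

/-- The Potter remainder grows like `x ^ (1/2)`, which has finite mean under the standard Pareto
law; hence its averages stay bounded. -/
lemma integrable_one_div_rpow_half_unif :
    Integrable (fun u : ℝ => (1 / u) ^ (1 / 2 : ℝ)) unif := by
  refine (integrable_rpow_unif (s := -(1 / 2)) (by norm_num)).congr ?_
  filter_upwards [ae_unif_mem] with u hu
  rw [one_div u, Real.inv_rpow hu.1.le, Real.rpow_neg hu.1.le]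

/-- Moments of the beta distribution: raising the first parameter. -/
lemma integral_pow_betaMeasure (k₀ r j : ℕ) :
    Integrable (fun t => t ^ j) (betaMeasure (k₀ + 1) (r + 1)) ∧
    ∫ t, t ^ j ∂betaMeasure (k₀ + 1) (r + 1) =
      ProbabilityTheory.beta (k₀ + j + 1) (r + 1) / ProbabilityTheory.beta (k₀ + 1) (r + 1) := by
  have hb := beta_pos (α := (k₀ : ℝ) + 1) (β := (r : ℝ) + 1) (by positivity) (by positivity)
  have hb' := beta_pos (α := (k₀ : ℝ) + j + 1) (β := (r : ℝ) + 1) (by positivity) (by positivity)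
  have h1 := lintegral_betaMeasure_eq k₀ r (fun t => ENNReal.ofReal t ^ j) (by fun_prop)
  have h2 := lintegral_betaMeasure_eq (k₀ + j) r (fun _ => 1) measurable_const
  have hcast : ((k₀ + j : ℕ) : ℝ) = k₀ + j := by push_cast; ring
  have hpm : IsProbabilityMeasure (betaMeasure ((k₀ : ℝ) + j + 1) (r + 1)) :=
    isProbabilityMeasureBeta (by positivity) (by positivity)
  simp only [hcast, lintegral_one, measure_univ, mul_one] at h2
  have e : ∀ t : ℝ, ENNReal.ofReal t ^ k₀ * ENNReal.ofReal (1 - t) ^ r * ENNReal.ofReal t ^ j =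
      ENNReal.ofReal t ^ (k₀ + j) * ENNReal.ofReal (1 - t) ^ r := fun t => by ring
  simp only [e] at h1
  rw [one_div, ENNReal.ofReal_inv_of_pos hb'] at h2
  rw [one_div, ENNReal.ofReal_inv_of_pos hb] at h1
  have h3 : ∫⁻ t, ENNReal.ofReal t ^ j ∂betaMeasure (k₀ + 1 : ℝ) (r + 1) =
      ENNReal.ofReal (ProbabilityTheory.beta (k₀ + j + 1) (r + 1) /
        ProbabilityTheory.beta (k₀ + 1) (r + 1)) := by
    have h4 := ENNReal.eq_inv_of_mul_eq_one_left ((mul_comm _ _).trans h2.symm)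
    rw [inv_inv] at h4
    rw [h1, h4, div_eq_mul_inv, mul_comm, ENNReal.ofReal_mul hb'.le, ENNReal.ofReal_inv_of_pos hb]
  have hmem := ae_betaMeasure_mem k₀ r
  have hint : Integrable (fun t : ℝ => t ^ j) (betaMeasure (k₀ + 1) (r + 1)) := by
    refine (integrable_const (1 : ℝ)).mono' (by fun_prop) ?_
    filter_upwards [hmem] with t ht
    rw [Real.norm_of_nonneg (pow_nonneg ht.1.le j)]
    exact pow_le_one₀ ht.1.le ht.2.le
  refine ⟨hint, ?_⟩
  have hnn : 0 ≤ᵐ[betaMeasure (k₀ + 1) (r + 1)] fun t : ℝ => t ^ j := by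
    filter_upwards [hmem] with t ht using pow_nonneg ht.1.le j
  rw [integral_eq_lintegral_of_nonneg_ae hnn hint.aestronglyMeasurable,
    ← ENNReal.toReal_ofReal (div_pos hb' hb).le, ← h3]
  congr 1
  refine lintegral_congr_ae ?_
  filter_upwards [hmem] with t ht
  rw [ENNReal.ofReal_pow ht.1.le]

lemma beta_add_one_left {a b : ℝ} (ha : 0 < a) (hb : 0 < b) :
    ProbabilityTheory.beta (a + 1) b = a / (a + b) * ProbabilityTheory.beta a b := by
  have h1 := (Real.Gamma_pos_of_pos (add_pos ha hb)).ne'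
  have h2 := (add_pos ha hb).ne'
  rw [ProbabilityTheory.beta, ProbabilityTheory.beta, Real.Gamma_add_one ha.ne', add_right_comm,
    Real.Gamma_add_one h2]
  field_simp

lemma integral_id_betaMeasure (k₀ r : ℕ) :
    ∫ t, t ∂betaMeasure (k₀ + 1) (r + 1) = (k₀ + 1) / (k₀ + r + 2) := by
  have h := (integral_pow_betaMeasure k₀ r 1).2
  simp only [pow_one, Nat.cast_one] at h
  have hb := beta_pos (α := (k₀ : ℝ) + 1) (β := (r : ℝ) + 1) (by positivity) (by positivity)
  rw [h, beta_add_one_left (by positivity) (by positivity), mul_div_assoc, div_self hb.ne', mul_one]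
  congr 1
  ring

lemma integral_sq_betaMeasure (k₀ r : ℕ) :
    ∫ t, t ^ 2 ∂betaMeasure (k₀ + 1) (r + 1) =
      (k₀ + 1) / (k₀ + r + 2) * ((k₀ + 2) / (k₀ + r + 3)) := by
  have h := (integral_pow_betaMeasure k₀ r 2).2
  have hb := beta_pos (α := (k₀ : ℝ) + 1) (β := (r : ℝ) + 1) (by positivity) (by positivity)
  have e : (k₀ : ℝ) + (2 : ℕ) + 1 = (k₀ + 1 + 1) + 1 := by push_cast; ring
  rw [h, e, beta_add_one_left (by positivity) (by positivity),
    beta_add_one_left (by positivity) (by positivity), ← mul_assoc, mul_div_assoc,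
    div_self hb.ne', mul_one, mul_comm]
  congr 2 <;> ring

/-! ### Limit theorems for Hill averages over a random threshold -/

/-- Average of the remainders in the second order expansion. -/
lemma tendsto_avg_second_order {L a : ℝ → ℝ} {γ ρ lam c d : ℝ}
    (hP : ∀ ε : ℝ, 0 < ε → ∀ᶠ t in atTop, ∀ x, 1 ≤ x →
      |L (t * x) - L t - γ * Real.log x - a t * boxCox ρ x| ≤ ε * |a t| * x ^ (1 / 2 : ℝ))
    {N : ℕ → ℕ} {t : ℕ → ℝ} {x : ℕ → ℝ} (ht : Tendsto t atTop atTop)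
    (hx : ∀ i, 1 ≤ x i)
    (ha : Tendsto (fun j => Real.sqrt (N j) * a (t j)) atTop (𝓝 lam))
    (hc : Tendsto (fun j => (∑ i ∈ Finset.range (N j), boxCox ρ (x i)) / N j) atTop (𝓝 c))
    (hd : Tendsto (fun j => (∑ i ∈ Finset.range (N j), x i ^ (1 / 2 : ℝ)) / N j) atTop (𝓝 d)) :
    Tendsto (fun j => Real.sqrt (N j) * ((∑ i ∈ Finset.range (N j),
      (L (t j * x i) - L (t j) - γ * Real.log (x i))) / N j)) atTop (𝓝 (lam * c)) := by
  have h1 := ha.mul hc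
  refine tendsto_of_tendsto_of_dist h1 ?_
  have hd0 : 0 ≤ d := ge_of_tendsto' hd fun j => div_nonneg
    (Finset.sum_nonneg fun i _ => Real.rpow_nonneg (by linarith [hx i]) _) (Nat.cast_nonneg _)
  have hlim := (ha.abs.mul hd)
  rw [Metric.tendsto_nhds]
  intro η hη
  obtain ⟨ε, hε, hεη⟩ : ∃ ε : ℝ, 0 < ε ∧ ε * (|lam| * d) < η := by
    have hnn : 0 ≤ |lam| * d := by positivity
    refine ⟨η / (|lam| * d + 1), by positivity, ?_⟩
    rw [div_mul_eq_mul_div, div_lt_iff₀ (by positivity)]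
    nlinarith
  filter_upwards [ht.eventually (hP ε hε), (hlim.const_mul ε).eventually (gt_mem_nhds hεη)]
    with j hj hj2
  rw [Real.dist_0_eq_abs, abs_of_nonneg dist_nonneg, dist_comm, Real.dist_eq]
  refine lt_of_le_of_lt ?_ hj2
  have e : Real.sqrt (N j) * ((∑ i ∈ Finset.range (N j),
      (L (t j * x i) - L (t j) - γ * Real.log (x i))) / N j) -
      Real.sqrt (N j) * a (t j) * ((∑ i ∈ Finset.range (N j), boxCox ρ (x i)) / N j) =
      Real.sqrt (N j) / N j * ∑ i ∈ Finset.range (N j),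
        (L (t j * x i) - L (t j) - γ * Real.log (x i) - a (t j) * boxCox ρ (x i)) := by
    have h0 : ∀ f g : ℕ → ℝ, ∑ i ∈ Finset.range (N j), (f i - a (t j) * g i) =
        ∑ i ∈ Finset.range (N j), f i - a (t j) * ∑ i ∈ Finset.range (N j), g i := fun f g => by
      rw [Finset.sum_sub_distrib, ← Finset.mul_sum]
    rw [h0]
    ring
  rw [e, abs_mul, abs_of_nonneg (by positivity : 0 ≤ Real.sqrt (N j) / N j)]
  have h2 : |∑ i ∈ Finset.range (N j),
        (L (t j * x i) - L (t j) - γ * Real.log (x i) - a (t j) * boxCox ρ (x i))| ≤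
      ε * |a (t j)| * ∑ i ∈ Finset.range (N j), x i ^ (1 / 2 : ℝ) := by
    rw [Finset.mul_sum]
    exact (Finset.abs_sum_le_sum_abs _ _).trans (Finset.sum_le_sum fun i _ => hj _ (hx i))
  refine (mul_le_mul_of_nonneg_left h2 (by positivity)).trans (le_of_eq ?_)
  rw [abs_mul, abs_of_nonneg (Real.sqrt_nonneg _)]
  ring

/-- Substituting a random threshold that is asymptotic to a deterministic one. -/
lemma tendsto_auxiliary_comp {a : ℝ → ℝ} {ρ lam : ℝ}
    (hr : LocUnif (fun t x => a (t * x) / a t) (fun x => x ^ ρ)) (ha : ∀ᶠ t in atTop, a t ≠ 0)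
    {b s t : ℕ → ℝ} (hs : Tendsto s atTop atTop)
    (hst : Tendsto (fun j => t j / s j) atTop (𝓝 1))
    (hb : Tendsto (fun j => b j * a (s j)) atTop (𝓝 lam)) :
    Tendsto (fun j => b j * a (t j)) atTop (𝓝 lam) := by
  have h1 := (hr 1 one_pos).comp (hs.prodMk hst)
  simp only [Real.one_rpow] at h1
  have h2 := hb.mul h1
  rw [mul_one] at h2
  refine h2.congr' ?_
  filter_upwards [hs.eventually ha, hs.eventually_gt_atTop 0] with j h3 h4
  simp only [Function.comp_apply]
  rw [mul_div_cancel₀ _ h4.ne']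
  field_simp

/-- The beta distributed pivots concentrate. -/
lemma tendstoInMeasure_beta {Ω : Type*} [MeasurableSpace Ω] {P : Measure Ω}
    [IsProbabilityMeasure P] {T : ℕ → Ω → ℝ} (hT : ∀ k, Measurable (T k)) {k₀ : ℕ → ℕ}
    (hlaw : ∀ k, P.map (T k) = betaMeasure (k₀ k + 1) ((k - 1 - k₀ k : ℕ) + 1))
    (hk₀ : Tendsto k₀ atTop atTop) (hk : ∀ᶠ k in atTop, k₀ k < k) :
    TendstoInMeasure P (fun k ω => T k ω * (k / k₀ k)) atTop fun _ => 1 := by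
  rw [tendstoInMeasure_iff_measureReal_norm]
  intro ε hε
  have hkr : Tendsto (fun k : ℕ => (k : ℝ)) atTop atTop := tendsto_natCast_atTop_atTop
  have hk₀r : Tendsto (fun k => (k₀ k : ℝ)) atTop atTop := hkr.comp hk₀
  have hfrac : ∀ c : ℝ, Tendsto (fun y : ℝ => (y + c) / y) atTop (𝓝 1) := fun c => by
    have h1 : Tendsto (fun y : ℝ => 1 + c / y) atTop (𝓝 (1 + 0)) :=
      tendsto_const_nhds.add (tendsto_const_nhds.div_atTop tendsto_id)
    rw [add_zero] at h1
    refine h1.congr' ?_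
    filter_upwards [eventually_ne_atTop 0] with y hy
    field_simp
  have h1 := ((hfrac 1).comp hk₀r).div ((hfrac 1).comp hkr) one_ne_zero
  have h2 := ((hfrac 2).comp hk₀r).div ((hfrac 2).comp hkr) one_ne_zero
  -- This is the Chebyshev bound `E (T k/k₀ - 1)² / ε²` expanded through the first two beta moments;
  -- its limit is `(1 - 2 + 1) / ε² = 0`.
  have hlim := (((h1.mul h2).sub (h1.const_mul 2)).add_const 1).div_const (ε ^ 2)
  norm_num at hlim
  refine squeeze_zero' (Eventually.of_forall fun _ => measureReal_nonneg) ?_ hlim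
  filter_upwards [hk, hk₀.eventually_gt_atTop 0] with k hlt hpos
  obtain ⟨r, hr⟩ : ∃ r, k = k₀ k + r + 1 := ⟨k - 1 - k₀ k, by omega⟩
  set n := k₀ k with hn
  have hr' : k - 1 - n = r := by omega
  have hlawk := hlaw k
  rw [← hn, hr'] at hlawk
  set q : ℝ := k / n with hq
  have hi1 := (integral_pow_betaMeasure n r 1).1
  have hi2 := (integral_pow_betaMeasure n r 2).1
  simp only [pow_one] at hi1
  have hTi1 : Integrable (T k) P := by
    rw [← hlawk, integrable_map_measure (by fun_prop) (hT k).aemeasurable] at hi1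
    exact hi1
  have hTi2 : Integrable (fun ω => T k ω ^ 2) P := by
    rw [← hlawk, integrable_map_measure (by fun_prop) (hT k).aemeasurable] at hi2
    exact hi2
  have hE1 : ∫ ω, T k ω ∂P = (n + 1) / (n + r + 2) := by
    rw [← integral_id_betaMeasure, ← hlawk, integral_map (hT k).aemeasurable (by fun_prop)]
  have hE2 : ∫ ω, T k ω ^ 2 ∂P = (n + 1) / (n + r + 2) * ((n + 2) / (n + r + 3)) := by
    rw [← integral_sq_betaMeasure, ← hlawk, integral_map (hT k).aemeasurable (by fun_prop)]
  have hexp : ∀ ω, (T k ω * q - 1) ^ 2 = q ^ 2 * T k ω ^ 2 - 2 * q * T k ω + 1 := fun ω => by ring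
  have hint : Integrable (fun ω => (T k ω * q - 1) ^ 2) P := by
    simp_rw [hexp]
    exact ((hTi2.const_mul _).sub (hTi1.const_mul _)).add (integrable_const 1)
  have hmarkov := mul_meas_ge_le_integral_of_nonneg
    (ae_of_all P fun ω => sq_nonneg (T k ω * q - 1)) hint (ε ^ 2)
  have hval : ∫ ω, (T k ω * q - 1) ^ 2 ∂P =
      q ^ 2 * ((n + 1) / (n + r + 2) * ((n + 2) / (n + r + 3))) -
        2 * q * ((n + 1) / (n + r + 2)) + 1 := by
    simp_rw [hexp]
    rw [integral_add (f := fun ω => q ^ 2 * T k ω ^ 2 - 2 * q * T k ω)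
      ((hTi2.const_mul _).sub (hTi1.const_mul _)) (integrable_const 1),
      integral_sub (f := fun ω => q ^ 2 * T k ω ^ 2) (hTi2.const_mul _) (hTi1.const_mul _), integral_const_mul, integral_const_mul,
      hE1, hE2]
    simp
  have hset : {ω | ε ≤ ‖T k ω * q - 1‖} = {ω | ε ^ 2 ≤ (T k ω * q - 1) ^ 2} := by
    ext ω
    simp only [Set.mem_ofPred_eq, Real.norm_eq_abs]
    rw [← sq_abs (T k ω * q - 1), pow_le_pow_iff_left₀ hε.le (abs_nonneg _) two_ne_zero]
  rw [hset, le_div_iff₀ (by positivity), mul_comm]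
  refine hmarkov.trans (le_of_eq ?_)
  have hn0 : (0 : ℝ) < n := by exact_mod_cast hpos
  have hkc : (k : ℝ) = n + r + 1 := by exact_mod_cast hr
  rw [hval, hq]
  simp only [hkc]
  have h3 : (n : ℝ) + r + 1 ≠ 0 := by positivity
  have h4 : (n : ℝ) + r + 2 ≠ 0 := by positivity
  have h5 : (n : ℝ) + r + 3 ≠ 0 := by positivity
  have h6 : (n : ℝ) + r + 1 + 1 = n + r + 2 := by ring
  have h7 : (n : ℝ) + r + 1 + 2 = n + r + 3 := by ring
  rw [h6, h7]
  field_simp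

/-- Convergence in distribution only depends on the laws. -/
lemma tendstoInDistribution_congr_map {ι : Type*} {l : Filter ι} {Ω Ω' : ι → Type*}
    [∀ i, MeasurableSpace (Ω i)] [∀ i, MeasurableSpace (Ω' i)] {Λ Λ' : Type*} [MeasurableSpace Λ]
    [MeasurableSpace Λ'] {μ : ∀ i, Measure (Ω i)} [∀ i, IsProbabilityMeasure (μ i)]
    {ν : ∀ i, Measure (Ω' i)} [∀ i, IsProbabilityMeasure (ν i)] {μ' : Measure Λ}
    [IsProbabilityMeasure μ'] {ν' : Measure Λ'} [IsProbabilityMeasure ν']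
    {X : ∀ i, Ω i → ℝ} {Y : ∀ i, Ω' i → ℝ} {Z : Λ → ℝ} {W : Λ' → ℝ}
    (h : TendstoInDistribution X l Z μ μ') (hY : ∀ i, AEMeasurable (Y i) (ν i))
    (hW : AEMeasurable W ν') (hXY : ∀ᶠ i in l, (μ i).map (X i) = (ν i).map (Y i))
    (hZW : μ'.map Z = ν'.map W) : TendstoInDistribution Y l W ν ν' := by
  refine ⟨hY, hW, ?_⟩
  have h1 := h.tendsto
  have e : (⟨μ'.map Z, Measure.isProbabilityMeasure_map h.aemeasurable_limit⟩ :
      ProbabilityMeasure ℝ) = ⟨ν'.map W, Measure.isProbabilityMeasure_map hW⟩ := Subtype.ext hZW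
  rw [e] at h1
  refine h1.congr' ?_
  filter_upwards [hXY] with i hi
  exact Subtype.ext hi

section Limit

variable {Ω : Type*} [MeasurableSpace Ω] {P : Measure Ω} {U : ℕ → Ω → ℝ}

lemma identDistrib_comp_unif (hU : ∀ i, Measurable (U i)) (hlaw : ∀ i, P.map (U i) = unif)
    {f : ℝ → ℝ} (hf : Measurable f) (i : ℕ) :
    IdentDistrib (fun ω => f (U i ω)) (fun ω => f (U 0 ω)) P P :=
  IdentDistrib.comp ⟨(hU i).aemeasurable, (hU 0).aemeasurable, by rw [hlaw, hlaw]⟩ hf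

lemma integral_comp_unif (hU : ∀ i, Measurable (U i)) (hlaw : ∀ i, P.map (U i) = unif)
    {f : ℝ → ℝ} (hf : Measurable f) (i : ℕ) : ∫ ω, f (U i ω) ∂P = ∫ u, f u ∂unif := by
  rw [← hlaw i, integral_map (hU i).aemeasurable hf.aestronglyMeasurable]

lemma ae_tendsto_avg_unif (hU : ∀ i, Measurable (U i)) (hindep : iIndepFun U P)
    (hlaw : ∀ i, P.map (U i) = unif) {f : ℝ → ℝ} (hf : Measurable f) (hint : Integrable f unif) :
    ∀ᵐ ω ∂P, Tendsto (fun n : ℕ => (∑ i ∈ Finset.range n, f (U i ω)) / n) atTop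
      (𝓝 (∫ u, f u ∂unif)) := by
  have h1 : Integrable (fun ω => f (U 0 ω)) P := by
    rw [← hlaw 0, integrable_map_measure hf.aestronglyMeasurable (hU 0).aemeasurable] at hint
    exact hint
  have h2 := strong_law_ae_real (fun i ω => f (U i ω)) h1
    (fun i j hij => (hindep.indepFun hij).comp hf hf) (identDistrib_comp_unif hU hlaw hf)
  rw [integral_comp_unif hU hlaw hf] at h2
  exact h2

variable [IsProbabilityMeasure P]

/-- The central limit theorem for Hill averages of standard Pareto variables. -/
lemma tendstoInDistribution_log_unif (hU : ∀ i, Measurable (U i)) (hindep : iIndepFun U P)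
    (hlaw : ∀ i, P.map (U i) = unif) {N : ℕ → ℕ} (hN : Tendsto N atTop atTop) :
    TendstoInDistribution (fun k ω => (Real.sqrt (N k))⁻¹ *
      (∑ i ∈ Finset.range (N k), -Real.log (U i ω) - N k)) atTop id (fun _ => P)
      (gaussianReal 0 1) := by
  have hf : Measurable fun u : ℝ => -Real.log u := Real.measurable_log.neg
  have hmean : ∫ ω, -Real.log (U 0 ω) ∂P = 1 := by
    rw [integral_comp_unif hU hlaw hf, integral_neg, integral_log_unif, neg_neg]
  have hvar : Var[fun ω => -Real.log (U 0 ω); P] = 1 := by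
    rw [← variance_neg_log_unif, ← hlaw 0, variance_map hf.aemeasurable (hU 0).aemeasurable]
    rfl
  have hLp : MemLp (fun ω => -Real.log (U 0 ω)) 2 P := by
    have : MemLp (fun u => -Real.log u) 2 unif := memLp_log_unif.neg
    rw [← hlaw 0, memLp_map_measure_iff hf.aestronglyMeasurable (hU 0).aemeasurable] at this
    exact this
  have hid : HasLaw id (gaussianReal 0 Var[fun ω => -Real.log (U 0 ω); P].toNNReal)
      (gaussianReal 0 1) := by
    rw [hvar, Real.toNNReal_one]
    exact ⟨aemeasurable_id, Measure.map_id⟩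
  have h := tendstoInDistribution_inv_sqrt_mul_sum_sub (X := fun i ω => -Real.log (U i ω)) hid hLp
    (hindep.comp (fun _ u => -Real.log u) fun _ => hf) (identDistrib_comp_unif hU hlaw hf)
  simp only [hmean, mul_one] at h
  exact ⟨fun k => h.forall_aemeasurable (N k), h.aemeasurable_limit, h.tendsto.comp hN⟩

/-- Asymptotic normality of Hill averages over a random threshold. -/
theorem tendstoInDistribution_hill (hU : ∀ i, Measurable (U i)) (hindep : iIndepFun U P)
    (hlaw : ∀ i, P.map (U i) = unif) {T : ℕ → Ω → ℝ} (hT : ∀ k, Measurable (T k)) {N : ℕ → ℕ}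
    (hN : Tendsto N atTop atTop) {s : ℕ → ℝ} (hs : Tendsto s atTop atTop)
    (hTs : TendstoInMeasure P (fun k ω => T k ω * s k) atTop fun _ => 1)
    {L a : ℝ → ℝ} {γ ρ lam : ℝ} (hL : Measurable L) (hρ : ρ ≤ 0)
    (ha : ∀ᶠ t in atTop, a t ≠ 0) (hr : LocUnif (fun t x => a (t * x) / a t) (fun x => x ^ ρ))
    (hP : ∀ ε : ℝ, 0 < ε → ∀ᶠ t in atTop, ∀ x, 1 ≤ x →
      |L (t * x) - L t - γ * Real.log x - a t * boxCox ρ x| ≤ ε * |a t| * x ^ (1 / 2 : ℝ))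
    (hlam : Tendsto (fun k => Real.sqrt (N k) * a (s k)) atTop (𝓝 lam)) :
    TendstoInDistribution (fun k ω => Real.sqrt (N k) *
      ((∑ i ∈ Finset.range (N k), L (1 / T k ω * (1 / U i ω))) / N k - L (1 / T k ω) - γ))
      atTop id (fun _ => P) (gaussianReal (lam / (1 - ρ)) (Real.toNNReal (γ ^ 2))) := by
  set R : ℕ → Ω → ℝ := fun k ω => Real.sqrt (N k) * ((∑ i ∈ Finset.range (N k),
      (L (1 / T k ω * (1 / U i ω)) - L (1 / T k ω) - γ * Real.log (1 / U i ω))) / N k) with hR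
  have hRm : ∀ k, Measurable (R k) := fun k => by
    have h1 : ∀ i, Measurable fun ω => L (1 / T k ω * (1 / U i ω)) - L (1 / T k ω) -
        γ * Real.log (1 / U i ω) := fun i => by
      have := hU i
      have := hT k
      fun_prop
    exact ((Finset.measurable_sum _ fun i _ => h1 i).div_const _).const_mul _
  have hae : ∀ᵐ ω ∂P, ∀ i, U i ω ∈ Set.Ioo (0 : ℝ) 1 := ae_all_iff.2 fun i => by
    have := ae_unif_mem
    rw [← hlaw i] at this
    exact ae_of_ae_map (hU i).aemeasurable this
  have hRlim : TendstoInMeasure P R atTop fun _ => lam / (1 - ρ) := by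
    -- Along a subsequence the thresholds converge almost surely, and the averages of the `U i`
    -- converge almost surely by the strong law, so the bias limit can be taken for each `ω`
    -- separately. The joint law of `T` and `U` plays no role.
    rw [exists_seq_tendstoInMeasure_atTop_iff fun k => (hRm k).aestronglyMeasurable]
    intro ns hns
    obtain ⟨ns', hns', hconv⟩ := (hTs.comp hns.tendsto_atTop).exists_seq_tendsto_ae
    refine ⟨ns', hns', ?_⟩
    have hsub := hns.tendsto_atTop.comp hns'.tendsto_atTop
    have hb := ae_tendsto_avg_unif hU hindep hlaw (f := fun u => boxCox ρ (1 / u))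
      ((measurable_boxCox ρ).comp (by fun_prop)) (integrable_boxCox_one_div_unif hρ)
    have hd := ae_tendsto_avg_unif hU hindep hlaw (f := fun u => (1 / u) ^ (1 / 2 : ℝ))
      (by fun_prop) integrable_one_div_rpow_half_unif
    rw [integral_boxCox_one_div_unif hρ] at hb
    filter_upwards [hconv, hae, hb, hd] with ω h1 h2 h3 h4
    have hNs := hN.comp hsub
    have hss := hs.comp hsub
    have h5 : Tendsto (fun j => 1 / T (ns (ns' j)) ω / s (ns (ns' j))) atTop (𝓝 1) := by
      have := h1.inv₀ one_ne_zero
      rw [inv_one] at this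
      refine this.congr fun j => ?_
      simp only [Function.comp_apply]
      rw [mul_inv, one_div, div_eq_mul_inv]
    have h6 : Tendsto (fun j => 1 / T (ns (ns' j)) ω) atTop atTop := by
      refine (hss.atTop_mul_pos one_pos h5).congr' ?_
      filter_upwards [hss.eventually_gt_atTop 0] with j hj
      exact mul_div_cancel₀ _ hj.ne'
    have h7 := tendsto_auxiliary_comp hr ha hss h5 (hlam.comp hsub)
    have h8 := tendsto_avg_second_order hP h6 (x := fun i => 1 / U i ω)
      (fun i => by rw [one_le_div (h2 i).1]; exact (h2 i).2.le) h7 (h3.comp hNs) (h4.comp hNs)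
    rw [mul_one_div] at h8
    exact h8
  have hg : Continuous fun p : ℝ × ℝ => γ * p.1 + p.2 := by fun_prop
  -- Slutsky's lemma: the Gaussian part and the remainder with deterministic limit are added.
  have h := (tendstoInDistribution_log_unif hU hindep hlaw hN
    ).continuous_comp_prodMk_of_tendstoInMeasure_const hg hRlim fun k => (hRm k).aemeasurable
  have hZ : ∀ k ω, γ * ((Real.sqrt (N k))⁻¹ *
      (∑ i ∈ Finset.range (N k), -Real.log (U i ω) - N k)) + R k ω = Real.sqrt (N k) *
      ((∑ i ∈ Finset.range (N k), L (1 / T k ω * (1 / U i ω))) / N k - L (1 / T k ω) - γ) := by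
    intro k ω
    rcases Nat.eq_zero_or_pos (N k) with h0 | h0
    · simp [hR, h0]
    · have h1 : (0 : ℝ) < N k := by exact_mod_cast h0
      have h2 := Real.sqrt_pos.2 h1
      have h3 : Real.sqrt (N k) * Real.sqrt (N k) = N k := Real.mul_self_sqrt h1.le
      simp only [hR, one_div, Real.log_inv, Finset.sum_sub_distrib, Finset.sum_const,
        Finset.card_range, nsmul_eq_mul, ← Finset.mul_sum, Finset.sum_neg_distrib]
      generalize (∑ i ∈ Finset.range (N k), L ((T k ω)⁻¹ * (U i ω)⁻¹)) = A
      generalize (∑ i ∈ Finset.range (N k), Real.log (U i ω)) = B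
      generalize Real.sqrt (N k) = S at h2 h3
      rw [← h3]
      field_simp
      ring
  refine tendstoInDistribution_congr_map h (fun k => ?_) aemeasurable_id
    (Eventually.of_forall fun k => by simp only [hZ]) ?_
  · have := (h.forall_aemeasurable k)
    simp only [hZ] at this
    exact this
  · have e : (fun ω : ℝ => γ * id ω + lam / (1 - ρ)) =
        (fun x => x + lam / (1 - ρ)) ∘ fun x => γ * x := rfl
    simp only [e]
    rw [← Measure.map_map (by fun_prop) (by fun_prop), gaussianReal_map_const_mul,
      gaussianReal_map_add_const, Measure.map_id, mul_zero, zero_add, mul_one]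
    congr 1
    ext
    simp [sq_nonneg]

end Limit

/-! ### A common probability space and asymptotic normality -/

/-- The laws of the pivots: the `(k₀ + 1)`-th smallest of `k` uniform variables. -/
def pivotLaw (k₀ : ℕ → ℕ) (k : ℕ) : Measure ℝ :=
  betaMeasure (k₀ k + 1) ((k - 1 - k₀ k : ℕ) + 1)

instance (k₀ : ℕ → ℕ) (k : ℕ) : IsProbabilityMeasure (pivotLaw k₀ k) := by
  unfold pivotLaw; infer_instance

/-- The joint law of a sequence of pivots and a sequence of uniform variables. -/
def pivotSpace (k₀ : ℕ → ℕ) : Measure ((ℕ → ℝ) × (ℕ → ℝ)) :=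
  (Measure.infinitePi (pivotLaw k₀)).prod (Measure.infinitePi fun _ => unif)

instance (k₀ : ℕ → ℕ) : IsProbabilityMeasure (pivotSpace k₀) := by
  unfold pivotSpace; infer_instance

/-- Convergence in distribution only sees the law for each single `k`, so one sequence of uniform
variables may serve all `k` at once; this is what makes the strong law applicable. -/
lemma measurePreserving_pivotSpace (k₀ : ℕ → ℕ) (k n : ℕ) :
    MeasurePreserving (fun ω : (ℕ → ℝ) × (ℕ → ℝ) => (ω.1 k, fun i : Fin n => ω.2 i))
      (pivotSpace k₀) ((pivotLaw k₀ k).prod (unifPi n)) := by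
  have h2 : MeasurePreserving (fun (u : ℕ → ℝ) (i : Fin n) => u i)
      (Measure.infinitePi fun _ => unif) (unifPi n) := by
    refine ⟨by fun_prop, ?_⟩
    have := Measure.map_infinitePi_infinitePi_of_inj (P := fun _ : ℕ => unif)
      (Fin.val_injective (n := n))
    rw [unifPi, ← Measure.infinitePi_eq_pi]
    exact this
  exact (measurePreserving_eval_infinitePi (pivotLaw k₀) k).prod h2

lemma pivotSpace_map_fst (k₀ : ℕ → ℕ) (k : ℕ) :
    (pivotSpace k₀).map (fun ω => ω.1 k) = pivotLaw k₀ k :=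
  (measurePreserving_fst.comp (measurePreserving_pivotSpace k₀ k 0)).map_eq

lemma pivotSpace_map_snd (k₀ : ℕ → ℕ) (i : ℕ) :
    (pivotSpace k₀).map (fun ω => ω.2 i) = unif :=
  ((measurePreserving_eval_infinitePi (fun _ : ℕ => unif) i).comp
    (measurePreserving_snd (μ := Measure.infinitePi (pivotLaw k₀)))).map_eq

lemma iIndepFun_pivotSpace (k₀ : ℕ → ℕ) :
    iIndepFun (fun i (ω : (ℕ → ℝ) × (ℕ → ℝ)) => ω.2 i) (pivotSpace k₀) := by
  rw [iIndepFun_iff_map_fun_eq_infinitePi_map (by fun_prop)]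
  simp only [pivotSpace_map_snd]
  exact (measurePreserving_snd (μ := Measure.infinitePi (pivotLaw k₀))).map_eq

/-- Asymptotic normality of the hybrid-Hill estimator under a second order condition. -/
theorem tendstoInDistribution_hybridHill {Ω : Type*} [MeasurableSpace Ω] {μ : Measure Ω}
    [IsProbabilityMeasure μ] {X : ℕ → Ω → ℝ} (hindep : iIndepFun X μ)
    (hident : ∀ j, IdentDistrib (X j) (X 0) μ μ) {γ ρ : ℝ} (hρ : ρ ≤ 0) (hρ1 : -1 ≤ ρ)
    {m : ℕ} (hm : 1 ≤ m) {A' : ℝ → ℝ}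
    (hA : ShiftedSecondOrder (quantileV (cdf (μ.map (X 0)))) γ ρ m A') {k₀ : ℕ → ℕ} {lam : ℝ}
    (hk₀ : Tendsto k₀ atTop atTop) (hk : Tendsto (fun k : ℕ => (k₀ k : ℝ) / k) atTop (𝓝 0))
    (hlam : Tendsto (fun k : ℕ => Real.sqrt (k₀ k) * A' (((m * k : ℕ) : ℝ) / k₀ k))
      atTop (𝓝 lam)) :
    TendstoInDistribution (fun (k : ℕ) ω => Real.sqrt (k₀ k) * (hybridHill X m k (k₀ k) ω - γ))
      atTop id (fun _ => μ) (gaussianReal (lam / (1 - ρ)) (Real.toNNReal (γ ^ 2))) := by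
  have hX : ∀ j, AEMeasurable (X j) μ := fun j => (hident j).aemeasurable_fst
  have hprob : IsProbabilityMeasure (μ.map (X 0)) := Measure.isProbabilityMeasure_map (hX 0)
  set V := quantileV (cdf (μ.map (X 0))) with hV
  obtain ⟨g, hgm, hg⟩ := exists_measurable_eqOn_Ioo (antitoneOn_blockQuantile (μ.map (X 0)) hm)
  -- `L` is the log quantile of block maxima on the Pareto scale; beyond 1 it equals `W` after the
  -- change of scale, the two halves cancelling.
  set L : ℝ → ℝ := fun t => Real.log (g (1 / t)) with hL
  set W : ℝ → ℝ := fun t => Real.log (V (m * shiftHalf t)) with hW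
  have hLW : ∀ t, 1 < t → L t = W (paretoToFrechet t + 1 / 2) := fun t ht => by
    have h1 : 1 / t ∈ Set.Ioo (0 : ℝ) 1 :=
      ⟨by positivity, by rw [div_lt_one (by linarith)]; exact ht⟩
    simp only [hL, hW, hg h1, blockQuantile, one_div_one_div, shiftHalf, add_sub_cancel_right, hV]
  have hane := hA.eventually_ne hm
  have hloc : LocUnif (fun t x => (W (t * x) - W t - γ * Real.log x) / A' (m * t)) (boxCox ρ) :=
    hA.locUnif
  have hP : ∀ ε : ℝ, 0 < ε → ∀ᶠ t in atTop, ∀ x, 1 ≤ x →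
      |L (t * x) - L t - γ * Real.log x - A' (m * t) * boxCox ρ x| ≤
        ε * |A' (m * t)| * x ^ (1 / 2 : ℝ) := by
    intro ε hε
    filter_upwards [hloc.potter_bound_pareto (a := fun t => A' (m * t)) hρ hρ1 hane hε,
      eventually_gt_atTop 1] with t h1 ht x hx
    rw [hLW t ht, hLW (t * x) (by nlinarith)]
    exact h1 x hx
  have hlt : ∀ᶠ k in atTop, k₀ k < k := by
    filter_upwards [hk.eventually (gt_mem_nhds one_pos), eventually_gt_atTop 0] with k h1 h2
    rw [div_lt_one (by exact_mod_cast h2)] at h1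
    exact_mod_cast h1
  have hs : Tendsto (fun k : ℕ => (k : ℝ) / k₀ k) atTop atTop := by
    have h1 : Tendsto (fun k : ℕ => (k₀ k : ℝ) / k) atTop (𝓝[>] 0) := by
      refine tendsto_nhdsWithin_iff.2 ⟨hk, ?_⟩
      filter_upwards [eventually_gt_atTop 0, hk₀.eventually_gt_atTop 0] with k h1 h2
      have h3 : (0 : ℝ) < k := by exact_mod_cast h1
      have h4 : (0 : ℝ) < k₀ k := by exact_mod_cast h2
      exact div_pos h4 h3
    refine h1.inv_tendsto_nhdsGT_zero.congr fun k => ?_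
    rw [Pi.inv_apply, inv_div]
  have hlam' : Tendsto (fun k : ℕ => Real.sqrt (k₀ k) * A' (m * ((k : ℝ) / k₀ k))) atTop
      (𝓝 lam) := by
    refine hlam.congr fun k => ?_
    rw [Nat.cast_mul, mul_div_assoc]
  have hlim := tendstoInDistribution_hill (P := pivotSpace k₀) (U := fun i ω => ω.2 i)
    (T := fun k ω => ω.1 k) (by fun_prop) (iIndepFun_pivotSpace k₀) (pivotSpace_map_snd k₀)
    (by fun_prop) hk₀ hs
    (tendstoInMeasure_beta (by fun_prop) (pivotSpace_map_fst k₀) hk₀ hlt)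
    (L := L) (a := fun t => A' (m * t)) (γ := γ) (by fun_prop) hρ hane
    (hloc.auxiliary_ratio (a := fun t => A' (m * t)) hρ hane) hP hlam'
  have hHill : ∀ k, AEMeasurable (hybridHill X m k (k₀ k)) μ := fun k =>
    (measurable_hillStat k (k₀ k)).comp_aemeasurable
      (aemeasurable_pi_lambda _ fun l => aemeasurable_blockMax hX m l)
  refine tendstoInDistribution_congr_map hlim
    (fun k => ((hHill k).sub_const γ).const_mul _) aemeasurable_id ?_ rfl
  filter_upwards [hlt] with k hkk
  obtain ⟨r, hr⟩ : ∃ r, k = k₀ k + r + 1 := ⟨k - 1 - k₀ k, by omega⟩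
  have h1 := map_hybridHill_eq hindep hident hm hgm hg (k₀ k) r
  have hbeta : betaMeasure (k₀ k + 1) (r + 1) = pivotLaw k₀ k := by
    rw [pivotLaw, show k - 1 - k₀ k = r by omega]
  have hmp := measurePreserving_pivotSpace k₀ k (k₀ k + r)
  rw [← hr, hbeta, ← hmp.map_eq,
    Measure.map_map (measurable_hillPivot hgm _ _) hmp.measurable] at h1
  -- The last `r` uniform variables, those above the pivot, do not enter the estimator.
  have hpiv : ∀ ω : (ℕ → ℝ) × (ℕ → ℝ),
      hillPivot g (k₀ k) (ω.1 k) (fun i : Fin (k₀ k + r) => ω.2 i) =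
      (∑ i ∈ Finset.range (k₀ k), L (1 / ω.1 k * (1 / ω.2 i))) / k₀ k - L (1 / ω.1 k) := by
    intro ω
    rw [hillPivot, Fin.sum_univ_add]
    simp [hL, Finset.sum_range, div_eq_inv_mul, mul_comm (ω.1 k)]
  have haff : Measurable fun x : ℝ => Real.sqrt (k₀ k) * (x - γ) := by fun_prop
  have h2 := congrArg (fun ν : Measure ℝ => ν.map fun x => Real.sqrt (k₀ k) * (x - γ)) h1
  rw [AEMeasurable.map_map_of_aemeasurable haff.aemeasurable (hHill k), Measure.map_map haff
    ((measurable_hillPivot hgm _ _).comp hmp.measurable)] at h2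
  refine Eq.trans ?_ h2.symm
  congr 1
  funext ω
  simp only [Function.comp_apply, hpiv]

end

theorem mainTheorem1
    {Ω : Type*} [MeasurableSpace Ω] (μ : Measure Ω) [IsProbabilityMeasure μ]
    (X : ℕ → Ω → ℝ) (hindep : iIndepFun X μ) (hident : ∀ j, IdentDistrib (X j) (X 0) μ μ)
    (F : ℝ → ℝ) (hF : ∀ x, F x = cdf (μ.map (X 0)) x)
    (γ ρ : ℝ) (hγ : 0 < γ) (hρ : ρ ≤ 0) (A : ℝ → ℝ)
    (hB : ConditionB F γ) (hA2 : ConditionA2 (quantileV F) γ ρ A)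
    (m : ℕ) (hm : 1 ≤ m) :
    ((ρ = -1 → ∃ c : ℝ, 0 < c ∧ ∀ᶠ t in atTop, c ≤ |t * A t + m * γ / 2|) →
      ∃ A' : ℝ → ℝ, ShiftedSecondOrder (quantileV F) γ (max ρ (-1)) m A' ∧
        RegVar (fun t => |A' t|) (max ρ (-1))) ∧
    (∀ A' : ℝ → ℝ, ShiftedSecondOrder (quantileV F) γ (max ρ (-1)) m A' →
      ∀ (k₀ : ℕ → ℕ) (lam : ℝ),
        Tendsto k₀ atTop atTop →
        Tendsto (fun k : ℕ => (k₀ k : ℝ) / k) atTop (𝓝 0) →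
        Tendsto (fun k : ℕ => Real.sqrt (k₀ k) * A' (((m * k : ℕ) : ℝ) / k₀ k))
          atTop (𝓝 lam) →
        TendstoInDistribution
          (fun (k : ℕ) ω => Real.sqrt (k₀ k) * (hybridHill X m k (k₀ k) ω - γ))
          atTop id (fun _ => μ)
          (gaussianReal (lam / (1 - max ρ (-1))) (Real.toNNReal (γ ^ 2)))) := by
  have hprob : IsProbabilityMeasure (μ.map (X 0)) :=
    Measure.isProbabilityMeasure_map (hident 0).aemeasurable_fst
  obtain rfl : F = cdf (μ.map (X 0)) := funext hF
  have hρ0 : max ρ (-1) ≤ 0 := max_le hρ (by norm_num)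
  refine ⟨fun hlow => ?_, fun A' hA' k₀ lam hk₀ hk hlam => ?_⟩
  · obtain ⟨A', hA'⟩ := hA2.exists_shiftedSecondOrder hγ hρ (monotoneOn_quantileV _)
      (hB.conditionA1.eventually_pos hγ (monotoneOn_quantileV _)) hm hlow
    exact ⟨A', hA', hA'.regVar hm hρ0⟩
  · exact tendstoInDistribution_hybridHill hindep hident hρ0 (le_max_right _ _) hm hA' hk₀ hk hlam
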